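/- **Setting.** Let $d,T\in\mathbb N$, $\mathcal B^d(\rho)=\{v\in\mathbb R^d:\|v\|_2\le\rho\}$, $S>0$, $\Theta=\mathcal B^d(S)$, $\theta_\star\in\Theta$, and $\|v\|_A=\sqrt{v^\top A v}$. Let $m:\mathbb R\to\mathbb R$ be convex and three times differentiable, $\mu=m'$, and let $g(\tau_1),\dots,g(\tau_T)>0$ be the dispersions of a deterministic sequence $\tau_1,\dots,\tau_T$. Assume that $m$ is the log-partition function of the generalized linear model: there are base measures $\nu_\tau$ on $\mathbb R$ such that for $\tau\in\{\tau_1,\dots,\tau_T\}$ and every $z\in\mathbb R$, $\exp\big((r z-m(z))/g(\tau)\big)\,d\nu_\tau(r)$ is a probability measure, denoted $GLM(\cdot\mid z,\tau)$. In each round $t\in[T]=\{1,\dots,T\}$ an arm set $\mathcal X_t\subseteq\mathcal B^d(1)$ (possibly random) is given, and an arm $x_t\in\mathcal X_t$ is chosen by any rule that depends only on the past (for instance optimistically with respect to the confidence sets below); given the past and $x_t$, a reward $r_t\sim GLM(\cdot\mid\langle x_t,\theta_\star\rangle,\tau_t)$ is drawn; then an adaptive adversary, which sees everything so far including $x_t$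 and $r_t$, chooses a corruption $c_t\in\mathbb R$, and $\tilde r_t=r_t+c_t$ is observed, together with $\tau_t$. Let $C=\sum_{t=1}^T|c_t|$. Assume that $L_\mu>0$ and $R_s\ge0$ satisfy $\dot\mu(\langle x,\theta\rangle)\le L_\mu$ and $|\ddot\mu(\langle x,\theta\rangle)|\le R_s\,\dot\mu(\langle x,\theta\rangle)$ for all $x\in\bigcup_{t\in[T]}\mathcal X_t$ and $\theta\in\Theta$. **Estimator.** Let $\alpha>0$, $\delta\in(0,1)$, $\eta=1+R_sS$ and $$\lambda=\max\Big\{14d\eta R_s^2,\;36\eta^2\alpha^2R_s^2S^2L_\mu^2,\;\frac{d}{4S^2}\Big\}.$$ Start with $\theta_1\in\Theta$ and $H_1=\lambda I_d$, and for $t\in[T]$ put $$w_t=\min\Big\{1,\frac{\alpha g(\tau_t)}{\|x_t\|_{H_t^{-1}}}\Big\}\ (w_t=1\text{ if }x_t=0),\qquad \tilde\ell_t(\theta)=\frac{w_t\big(m(\langle x_t,\theta\rangle)-\tilde r_t\langle x_t,\theta\rangle\big)}{g(\tau_t)},$$ $$\theta_{t+1}\in\operatorname*{argmin}_{\theta\in\Theta}\Big[\langle\nabla\tilde\ell_t(\theta_t),\theta-\theta_t\rangle+\tfrac12\|\theta-\theta_t\|^2_{\nabla^2\tilde\ell_t(\theta_t)}+\tfrac1{2\eta}\|\theta-\theta_t\|_{H_t}^2\Big],\qquad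 H_{t+1}=H_t+\nabla^2\tilde\ell_t(\theta_{t+1}).$$ **Theorem.** For $t\in[T]$ let $$\beta_t(\delta)=\sqrt{2\eta\log\frac1\delta+d(6\eta^2+\eta)\log\Big(1+\sum_{s=1}^{t-1}\frac{L_\mu}{\lambda g(\tau_s)}\Big)+4\lambda S^2},$$ $$\mathcal C_t(\delta)=\big\{\theta\in\Theta:\ \|\theta-\theta_t\|_{H_t}\le\beta_t(\delta)+2\eta\alpha C\big\}.$$ Then $\mathbb P\big(\forall t\in[T]:\ \theta_\star\in\mathcal C_t(\delta)\big)\ge1-\delta$. -/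

import Mathlib

open MeasureTheory ProbabilityTheory
open scoped Matrix

noncomputable section

namespace HCWGLB

/-- The parameter and arm space `ℝ^d` with its Euclidean norm. -/
abbrev Vec (d : ℕ) : Type := EuclideanSpace ℝ (Fin d)

/-- The parameter set `Θ = B^d(S)`, the closed Euclidean ball of radius `S`. -/
def paramSet (d : ℕ) (S : ℝ) : Set (Vec d) := Metric.closedBall 0 S

/-- The Mahalanobis norm `‖v‖_A = √(vᵀ A v)`. -/
def mahalanobis {d : ℕ} (A : Matrix (Fin d) (Fin d) ℝ) (v : Vec d) : ℝ :=
  √(v.ofLp ⬝ᵥ (A *ᵥ v.ofLp))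

/-- The Hessian matrix `∇² f(θ)` of second partial derivatives. -/
def hessian {d : ℕ} (f : Vec d → ℝ) (θ : Vec d) : Matrix (Fin d) (Fin d) ℝ :=
  Matrix.of fun i j =>
    iteratedFDeriv ℝ 2 f θ ![EuclideanSpace.single i 1, EuclideanSpace.single j 1]

/-! ### The generalized linear model -/

/-- The law on `ℝ` with density `exp((r z - m z) / γ)` with respect to the base measure `ν`,
where `z = ⟨x, θ⟩` is the natural parameter and `γ = g(τ)` the dispersion. -/
def glmLaw (m : ℝ → ℝ) (ν : Measure ℝ) (γ z : ℝ) : Measure ℝ :=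
  ν.withDensity fun r => ENNReal.ofReal (Real.exp ((r * z - m z) / γ))

/-- `m` is the log-partition function (for base measure `ν` and dispersion `γ`): for every natural
parameter `z` the density `exp((r z - m z) / γ)` is normalized. -/
def IsLogPartition (m : ℝ → ℝ) (ν : Measure ℝ) (γ : ℝ) : Prop :=
  ∀ z : ℝ, IsProbabilityMeasure (glmLaw m ν γ z)

/-- `m` is three times differentiable and convex. -/
structure RegularLogPartition (m : ℝ → ℝ) : Prop where
  differentiable₁ : Differentiable ℝ m
  differentiable₂ : Differentiable ℝ (deriv m)
  differentiable₃ : Differentiable ℝ (deriv (deriv m))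
  convex : ConvexOn ℝ Set.univ m

/-- Boundedness of the slope and self-concordance of the link function `μ = m'` on all inner
products of an arm in `arms` and a parameter in `Θ`:
`μ' ≤ L` and `|μ''| ≤ R μ'`. -/
def SelfConcordantOn {d : ℕ} (m : ℝ → ℝ) (arms : Set (Vec d)) (S L R : ℝ) : Prop :=
  ∀ x ∈ arms, ∀ θ ∈ paramSet d S,
    deriv (deriv m) (inner ℝ x θ) ≤ L ∧
    |deriv (deriv (deriv m)) (inner ℝ x θ)| ≤ R * deriv (deriv m) (inner ℝ x θ)

/-! ### The estimator -/

/-- The confidence weight `w = 1 ∧ α γ / ‖x‖_{H⁻¹}` (equal to `1` if `x = 0`). -/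
def confWeight {d : ℕ} (α γ : ℝ) (H : Matrix (Fin d) (Fin d) ℝ) (x : Vec d) : ℝ :=
  open Classical in
  if x = 0 then 1 else min 1 (α * γ / mahalanobis H⁻¹ x)

/-- The weighted negative log-likelihood `w (m ⟨x, θ⟩ - r ⟨x, θ⟩) / γ` of an observed reward `r`,
with `w` the confidence weight. -/
def weightedLoss {d : ℕ} (m : ℝ → ℝ) (α γ : ℝ) (H : Matrix (Fin d) (Fin d) ℝ)
    (x : Vec d) (r : ℝ) (θ : Vec d) : ℝ :=
  confWeight α γ H x * (m (inner ℝ x θ) - r * inner ℝ x θ) / γ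

/-- The objective of the online-mirror-descent step from `θ₀` with loss `ℓ`:
`⟨∇ℓ(θ₀), θ - θ₀⟩ + ½ ‖θ - θ₀‖²_{∇²ℓ(θ₀)} + (1/(2η)) ‖θ - θ₀‖²_H`. -/
def omdObjective {d : ℕ} (ℓ : Vec d → ℝ) (η : ℝ) (H : Matrix (Fin d) (Fin d) ℝ)
    (θ₀ θ : Vec d) : ℝ :=
  inner ℝ (gradient ℓ θ₀) (θ - θ₀) + 1 / 2 * mahalanobis (hessian ℓ θ₀) (θ - θ₀) ^ 2
    + 1 / (2 * η) * mahalanobis H (θ - θ₀) ^ 2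

/-- `(θ_t, H_t)` is the trajectory of the weighted online-mirror-descent estimator over rounds
`1, …, T`, when arms `x_t` are played, rewards `r_t` are observed (possibly corrupted), and the
dispersions are `γ_t`. -/
structure IsOMDTrajectory {d : ℕ} (T : ℕ) (m : ℝ → ℝ) (S η lam α : ℝ) (γ : ℕ → ℝ)
    (x : ℕ → Vec d) (r : ℕ → ℝ) (θ : ℕ → Vec d) (H : ℕ → Matrix (Fin d) (Fin d) ℝ) : Prop where
  init_mem : θ 1 ∈ paramSet d S
  init_H : H 1 = lam • (1 : Matrix (Fin d) (Fin d) ℝ)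
  step_mem : ∀ t ∈ Finset.Icc 1 T, θ (t + 1) ∈ paramSet d S
  step_min : ∀ t ∈ Finset.Icc 1 T,
    IsMinOn (omdObjective (weightedLoss m α (γ t) (H t) (x t) (r t)) η (H t) (θ t))
      (paramSet d S) (θ (t + 1))
  step_H : ∀ t ∈ Finset.Icc 1 T,
    H (t + 1) = H t + hessian (weightedLoss m α (γ t) (H t) (x t) (r t)) (θ (t + 1))

/-! ### The interaction protocol -/

/-- The bandit with adversarial corruptions over rounds `1, …, T`. The σ-algebra `𝓕 t` is the
information available right after the arm `x_t` has been chosen and before the reward `r_t` is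
drawn.  Given `𝓕 t`, the true reward `r_t` follows the generalized linear model with natural
parameter `⟨x_t, θ⋆⟩` and dispersion `γ_t`; the corruption `c_t` is chosen afterwards and may
depend on everything up to and including `r_t`. The arms are chosen from the arm sets in any way
that depends on the past only. -/
structure IsCorruptedGLB {d : ℕ} {Ω : Type*} {mΩ : MeasurableSpace Ω} (P : Measure Ω)
    (𝓕 : Filtration ℕ mΩ) (T : ℕ) (m : ℝ → ℝ) (ν : ℕ → Measure ℝ) (γ : ℕ → ℝ) (θstar : Vec d)
    (arms : ℕ → Ω → Set (Vec d)) (x : ℕ → Ω → Vec d) (r c : ℕ → Ω → ℝ) : Prop where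
  arm_mem : ∀ t ∈ Finset.Icc 1 T, ∀ ω, x t ω ∈ arms t ω
  arm_measurable : ∀ t ∈ Finset.Icc 1 T, Measurable[𝓕 t] (x t)
  reward_measurable : ∀ t ∈ Finset.Icc 1 T, Measurable[𝓕 (t + 1)] (r t)
  corruption_measurable : ∀ t ∈ Finset.Icc 1 T, Measurable[𝓕 (t + 1)] (c t)
  reward_law : ∀ t ∈ Finset.Icc 1 T, ∀ B : Set ℝ, MeasurableSet B →
    P[(r t ⁻¹' B).indicator (fun _ => (1 : ℝ)) | 𝓕 t]
      =ᵐ[P] fun ω => (glmLaw m (ν t) (γ t) (inner ℝ (x t ω) θstar)).real B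

/-! ### The confidence sequence -/

/-- The step size `η = 1 + R S`. -/
def stepSize (R S : ℝ) : ℝ := 1 + R * S

/-- The regularization parameter `λ = max {14 d η R², 36 η² α² R² S² L², d / (4 S²)}`. -/
def regParam (d : ℕ) (R S L α : ℝ) : ℝ :=
  max (14 * d * stepSize R S * R ^ 2)
    (max (36 * stepSize R S ^ 2 * α ^ 2 * R ^ 2 * S ^ 2 * L ^ 2) (d / (4 * S ^ 2)))

/-- The radius `β_t(δ)`. -/
def radius (d : ℕ) (R S L α δ : ℝ) (γ : ℕ → ℝ) (t : ℕ) : ℝ :=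
  √(2 * stepSize R S * Real.log (1 / δ)
    + d * (6 * stepSize R S ^ 2 + stepSize R S)
      * Real.log (1 + ∑ s ∈ Finset.Ico 1 t, L / (regParam d R S L α * γ s))
    + 4 * regParam d R S L α * S ^ 2)

/-- The confidence set
`C_t(δ) = {θ ∈ Θ : ‖θ - θ_t‖_{H_t} ≤ β_t(δ) + 2 η α C}`, with `C` the total corruption. -/
def confSet {d : ℕ} (R S L α δ C : ℝ) (γ : ℕ → ℝ) (t : ℕ) (θt : Vec d)
    (Ht : Matrix (Fin d) (Fin d) ℝ) : Set (Vec d) :=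
  {θ | θ ∈ paramSet d S ∧
    mahalanobis Ht (θ - θt) ≤ radius d R S L α δ γ t + 2 * stepSize R S * α * C}

end HCWGLB

end

/-! Write `X_t = ‖θ⋆ - θ_t‖_{H_t}` and, in round `t`, `z = ⟨x_t, θ⋆⟩`, `a = ⟨x_t, θ_t⟩`, `b = ⟨x_t,
θ_{t+1}⟩`, `σ = ‖x_t‖_{H_t⁻¹}`.

Deterministic part (`omd_step`). Optimality of `θ_{t+1}`, together with the quadratic lower bound
that self-concordance gives for the Bregman divergence of `m`, yields a recursion: `X_{t+1}² - X_t²`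
is at most `2η` times the uncorrupted loss gap between `z` and `b` minus `(b - a)²/(3ησ²)`, plus
`2ηα|c_t| X_{t+1}`. The corruption term has this form because the weight forces `wσ ≤ αg`. Summing
and arguing at the index where `X` is largest gives a scalar inequality `X² ≤ B + D X` with `D =
2ηαC`, hence `X ≤ √B + D`.

Probabilistic part. The prediction `b` depends on the reward of the same round, so the loss gap
cannot be treated as a martingale increment for a fixed comparator. Instead the supremum over all
`b` in the range is taken. After subtraction of the quadratic term and of `(3η + 1/2) log (1 +
κσ²)`, where `κ = w m''(b)/g`, the exponential of this supremum has conditional expectation at most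
one (`lintegral_iSup_roundFactor_le`). Ville's inequality then controls all partial sums at once,
and the logarithms add up to a log-determinant, at most `d log (1 + ∑ L/(λg))`
(`IsOMDTrajectory.sum_log_le`). Since `2η(3η + 1/2) = 6η² + η`, this is the radius.

The one-round bound is the heart of the proof. Convexity of `exp` removes the weight; the likelihood
ratio at `z` cancels the law of the reward, and re-tilting to the law at `a` leaves `exp (yX - D(y)
- y²/2)`, with `D` a cumulant generating function. Its supremum over `y` is bounded through its
positive variation (`lintegral_iSup_exp_le`), and `exists_exp_compensator_ge` checks that the
logarithmic compensator pays for the result. -/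

namespace HCWGLB

/-! ### Cumulant generating functions and positive variation -/

section Cumulant

variable {Ω : Type*} {mΩ : MeasurableSpace Ω} {Q : Measure Ω} {X : Ω → ℝ}

lemma mem_interior_integrableExpSet (hX : ∀ t, Integrable (fun ω => Real.exp (t * X ω)) Q) (t : ℝ) :
    t ∈ interior (integrableExpSet X Q) := by
  have : integrableExpSet X Q = Set.univ := Set.eq_univ_of_forall fun t => hX t
  simp [this]

lemma differentiable_cgf (hX : ∀ t, Integrable (fun ω => Real.exp (t * X ω)) Q) :
    Differentiable ℝ (cgf X Q) := fun t =>
  (analyticAt_cgf (mem_interior_integrableExpSet hX t)).differentiableAt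

lemma differentiable_deriv_cgf (hX : ∀ t, Integrable (fun ω => Real.exp (t * X ω)) Q) :
    Differentiable ℝ (deriv (cgf X Q)) := fun t =>
  (analyticAt_cgf (mem_interior_integrableExpSet hX t)).deriv.differentiableAt

variable [IsProbabilityMeasure Q]

/-- Under the law tilted by `exp (tX - D(t))`, `X` has mean `D'(t)` and variance `D''(t)`; the
pointwise bound `u - k ≤ u²/(4k)` turns the tail into a variance. -/
lemma lintegral_tail_tilted_le (hX : ∀ t, Integrable (fun ω => Real.exp (t * X ω)) Q)
    (t : ℝ) {k : ℝ} (hk : 0 < k) :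
    ∫⁻ ω, ENNReal.ofReal ((X ω - deriv (cgf X Q) t - k) * Real.exp (t * X ω - cgf X Q t)) ∂Q
      ≤ ENNReal.ofReal (iteratedDeriv 2 (cgf X Q) t / (4 * k)) := by
  have hi := mem_interior_integrableExpSet hX t
  have h0 := integrable_pow_mul_exp_of_mem_interior_integrableExpSet hi 0
  have h1 := integrable_pow_mul_exp_of_mem_interior_integrableExpSet hi 1
  have h2 := integrable_pow_mul_exp_of_mem_interior_integrableExpSet hi 2
  set D' := deriv (cgf X Q) t
  have hmgf : 0 < mgf X Q t := mgf_pos (hX t)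
  have hint : Integrable (fun ω => (X ω - D') ^ 2 * Real.exp (t * X ω)) Q := by
    have := (h2.sub (h1.const_mul (2 * D'))).add (h0.const_mul (D' ^ 2))
    refine this.congr (ae_of_all _ fun ω => ?_)
    simp; ring
  have hexp : ∀ ω, Real.exp (t * X ω - cgf X Q t) = Real.exp (t * X ω) / mgf X Q t := by
    intro ω; rw [Real.exp_sub, exp_cgf (hX t)]
  calc _ ≤ ∫⁻ ω, ENNReal.ofReal ((X ω - D') ^ 2 * Real.exp (t * X ω) / (mgf X Q t * (4 * k))) ∂Q := by
        refine lintegral_mono fun ω => ENNReal.ofReal_le_ofReal ?_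
        rw [hexp, mul_div_assoc', div_le_div_iff₀ hmgf (by positivity)]
        have : (X ω - D' - k) * (4 * k) ≤ (X ω - D') ^ 2 := by nlinarith [sq_nonneg (X ω - D' - 2 * k)]
        have he := mul_pos (Real.exp_pos (t * X ω)) hmgf
        nlinarith [mul_le_mul_of_nonneg_right this he.le]
    _ = _ := by
        rw [← ofReal_integral_eq_lintegral_ofReal (hint.div_const _)
          (ae_of_all _ fun ω => by positivity), integral_div, iteratedDeriv_two_cgf_eq_integral hi,
          div_div]

/-- For `t ≥ 0` the factor `X (e^{tX} - 1)` is nonnegative, so the truncation by `ofReal` is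
inactive; subtracting `1` does not change the integral because `X` is centred. -/
lemma lintegral_mul_exp_sub_one (hX : ∀ t, Integrable (fun ω => Real.exp (t * X ω)) Q)
    (hmean : ∫ ω, X ω ∂Q = 0) {t : ℝ} (ht : 0 ≤ t) :
    ∫⁻ ω, ENNReal.ofReal (X ω * (Real.exp (t * X ω) - 1) * Real.exp (-cgf X Q t)) ∂Q
      = ENNReal.ofReal (deriv (cgf X Q) t) := by
  have hi := mem_interior_integrableExpSet hX t
  have h1 := integrable_pow_mul_exp_of_mem_interior_integrableExpSet hi 1
  have hX1 : Integrable X Q := by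
    have := integrable_pow_mul_exp_of_mem_interior_integrableExpSet
      (mem_interior_integrableExpSet hX 0) 1
    simpa using this
  have hpos : ∀ x : ℝ, 0 ≤ x * (Real.exp (t * x) - 1) := by
    intro x
    rcases le_total 0 x with h | h
    · exact mul_nonneg h (by linarith [Real.one_le_exp (mul_nonneg ht h)])
    · exact mul_nonneg_of_nonpos_of_nonpos h
        (by linarith [Real.exp_le_one_iff.2 (mul_nonpos_of_nonneg_of_nonpos ht h)])
  rw [← ofReal_integral_eq_lintegral_ofReal _ (ae_of_all _ fun ω =>
    mul_nonneg (hpos _) (Real.exp_pos _).le)]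
  · rw [integral_mul_const]
    have : ∫ ω, X ω * (Real.exp (t * X ω) - 1) ∂Q = ∫ ω, X ω * Real.exp (t * X ω) ∂Q := by
      simp_rw [mul_sub, mul_one]
      rw [integral_sub (by simpa using h1) hX1, hmean, sub_zero]
    rw [this, deriv_cgf hi, Real.exp_neg, exp_cgf (hX t), div_eq_mul_inv]
  · refine Integrable.mul_const ?_ _
    simp_rw [mul_sub, mul_one]
    exact Integrable.sub (by simpa using h1) hX1

lemma deriv_cgf_nonneg (hX : ∀ t, Integrable (fun ω => Real.exp (t * X ω)) Q)
    (hmean : ∫ ω, X ω ∂Q = 0) {t : ℝ} (ht : 0 ≤ t) : 0 ≤ deriv (cgf X Q) t := by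
  have h0 : deriv (cgf X Q) 0 = 0 := by
    rw [deriv_cgf_zero (mem_interior_integrableExpSet hX 0)]; simp [hmean]
  have hmono : Monotone (deriv (cgf X Q)) := by
    refine monotone_of_deriv_nonneg (differentiable_deriv_cgf hX) fun s => ?_
    have := iteratedDeriv_two_cgf_eq_integral (mem_interior_integrableExpSet hX s)
    rw [iteratedDeriv_succ, iteratedDeriv_one] at this
    rw [this]
    exact div_nonneg (integral_nonneg fun ω => by positivity) mgf_nonneg
  rw [← h0]; exact hmono ht

lemma cgf_nonneg_of_mean_zero (hX : ∀ t, Integrable (fun ω => Real.exp (t * X ω)) Q)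
    (hmean : ∫ ω, X ω ∂Q = 0) {t : ℝ} (ht : 0 ≤ t) : 0 ≤ cgf X Q t := by
  have hmono : MonotoneOn (cgf X Q) (Set.Ici 0) := by
    refine monotoneOn_of_deriv_nonneg (convex_Ici 0) (differentiable_cgf hX).continuous.continuousOn
      (differentiable_cgf hX).differentiableOn fun s hs => ?_
    rw [interior_Ici] at hs
    exact deriv_cgf_nonneg hX hmean (le_of_lt hs)
  have := hmono (by simp) (show t ∈ Set.Ici 0 from ht) ht
  simpa [cgf_zero] using this

/-- If the second derivative of the cumulant generating function of a centred variable is at most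
`v e^{R t}` on `[0, Y]`, then its derivative is at most `v t e^{R t}` there. -/
lemma deriv_cgf_le (hX : ∀ t, Integrable (fun ω => Real.exp (t * X ω)) Q)
    (hmean : ∫ ω, X ω ∂Q = 0) {R v Y : ℝ} (hR : 0 ≤ R) (hv : 0 ≤ v)
    (hD : ∀ t ∈ Set.Icc 0 Y, iteratedDeriv 2 (cgf X Q) t ≤ v * Real.exp (R * t))
    {t : ℝ} (ht : t ∈ Set.Icc 0 Y) : deriv (cgf X Q) t ≤ v * Real.exp (R * t) * t := by
  have h0 : deriv (cgf X Q) 0 = 0 := by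
    rw [deriv_cgf_zero (mem_interior_integrableExpSet hX 0)]; simp [hmean]
  have := Convex.image_sub_le_mul_sub_of_deriv_le (convex_Icc 0 t)
    (f := deriv (cgf X Q)) (C := v * Real.exp (R * t))
    (differentiable_deriv_cgf hX).continuous.continuousOn
    (differentiable_deriv_cgf hX).differentiableOn (fun s hs => by
      rw [interior_Icc] at hs
      have h := hD s ⟨hs.1.le, hs.2.le.trans ht.2⟩
      rw [iteratedDeriv_succ, iteratedDeriv_one] at h
      refine h.trans ?_
      gcongr
      exact hs.2.le) 0 (by simp [ht.1]) t (by simp [ht.1]) ht.1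
  simpa [h0] using this

/-- The positive variation on `[0, Y]` of `y ↦ exp (y X - D y - y ^ 2 / 2)`, where `D` is the
cumulant generating function of `X`. -/
noncomputable def posVariation (X : Ω → ℝ) (Q : Measure Ω) (Y : ℝ) (ω : Ω) : ENNReal :=
  ∫⁻ t in Set.Ioc 0 Y, ENNReal.ofReal ((X ω - deriv (cgf X Q) t - t) *
    Real.exp (t * X ω - cgf X Q t - t ^ 2 / 2))

/-- The function equals `1` at `0`, and its increase is at most the integral of the positive part of
its derivative. The resulting bound does not depend on `y`. -/
lemma ofReal_exp_le_posVariation (hX : ∀ t, Integrable (fun ω => Real.exp (t * X ω)) Q)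
    {y Y : ℝ} (hy : y ∈ Set.Icc 0 Y) (ω : Ω) :
    ENNReal.ofReal (Real.exp (y * X ω - cgf X Q y - y ^ 2 / 2)) ≤ 1 + posVariation X Q Y ω := by
  set f := fun t : ℝ => Real.exp (t * X ω - cgf X Q t - t ^ 2 / 2)
  set f' := fun t : ℝ => (X ω - deriv (cgf X Q) t - t) *
    Real.exp (t * X ω - cgf X Q t - t ^ 2 / 2)
  have hc := (differentiable_cgf hX).continuous
  have hc' := (differentiable_deriv_cgf hX).continuous
  have hf : ∀ t, HasDerivAt f (f' t) t := by
    intro t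
    have h1 := ((((hasDerivAt_id t).mul_const (X ω)).sub ((differentiable_cgf hX t).hasDerivAt)).sub
      (((hasDerivAt_id t).pow 2).div_const 2)).exp
    convert! h1 using 1
    simp [f']; ring
  have hf'c : Continuous f' := by fun_prop
  have hftc : ∫ t in (0:ℝ)..y, f' t = f y - f 0 :=
    intervalIntegral.integral_eq_sub_of_hasDerivAt (fun t _ => hf t) (hf'c.intervalIntegrable _ _)
  have hf0 : f 0 = 1 := by simp [f, cgf_zero]
  have hle : f y ≤ 1 + ∫ t in Set.Ioc 0 y, max (f' t) 0 := by
    rw [← intervalIntegral.integral_of_le hy.1]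
    have := intervalIntegral.integral_mono_on (μ := volume) hy.1 (hf'c.intervalIntegrable _ _)
      ((hf'c.max (continuous_const (y := (0:ℝ)))).intervalIntegrable _ _)
      (fun t _ => le_max_left (f' t) 0)
    linarith
  have hint : IntegrableOn (fun t => max (f' t) 0) (Set.Ioc 0 y) :=
    ((hf'c.max continuous_const).intervalIntegrable 0 y).1
  calc ENNReal.ofReal (f y) ≤ ENNReal.ofReal (1 + ∫ t in Set.Ioc 0 y, max (f' t) 0) :=
        ENNReal.ofReal_le_ofReal hle
    _ = 1 + ∫⁻ t in Set.Ioc 0 y, ENNReal.ofReal (max (f' t) 0) := by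
        rw [ENNReal.ofReal_add zero_le_one
          (setIntegral_nonneg measurableSet_Ioc fun t _ => le_max_right (f' t) 0),
          ofReal_integral_eq_lintegral_ofReal hint (ae_of_all _ fun t => le_max_right (f' t) 0)]
        simp
    _ = 1 + ∫⁻ t in Set.Ioc 0 y, ENNReal.ofReal (f' t) := by
        congr 2; ext t
        rcases le_total (f' t) 0 with h | h
        · rw [max_eq_right h, ENNReal.ofReal_of_nonpos h, ENNReal.ofReal_zero]
        · rw [max_eq_left h]
    _ ≤ _ := by
        gcongr
        exact lintegral_mono_set (Set.Ioc_subset_Ioc_right hy.2)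

end Cumulant

/-! ### Numerical bound for a Gaussian-type integral -/

section Numeric

lemma lintegral_div_le {a b C : ℝ} (ha : 0 < a) (hab : a ≤ b) (hC : 0 ≤ C) :
    ∫⁻ t in Set.Ioc a b, ENNReal.ofReal (C / t) ≤ ENNReal.ofReal (C * Real.log (b / a)) := by
  have h0 : (0:ℝ) ∉ Set.uIcc a b := by
    rw [Set.uIcc_of_le hab]; simp [ha]
  have hi : IntervalIntegrable (fun t : ℝ => C / t) volume a b := by
    simp_rw [div_eq_mul_inv]
    exact (intervalIntegral.intervalIntegrable_inv (fun x hx h => h0 (h ▸ hx))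
      continuousOn_id).const_mul C
  rw [← ofReal_integral_eq_lintegral_ofReal hi.1]
  · rw [← intervalIntegral.integral_of_le hab]
    simp_rw [div_eq_mul_inv C]
    rw [intervalIntegral.integral_const_mul, integral_inv h0]
  · refine (ae_restrict_iff' measurableSet_Ioc).2 (ae_of_all _ fun t ht => ?_)
    exact div_nonneg hC (ha.trans ht.1).le

lemma log_le_of_le_sum {x y : ℝ} (n : ℕ) (hx : 0 ≤ x) (hy : 0 < y)
    (h : y ≤ ∑ i ∈ Finset.range n, x ^ i / i.factorial) : Real.log y ≤ x := by
  rw [Real.log_le_iff_le_exp hy]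
  exact h.trans (Real.sum_le_exp_of_nonneg hx n)

lemma exp_neg_le_of_le_sum {x y : ℝ} (n : ℕ) (hx : 0 ≤ x) (hy : 0 < y)
    (h : 1 ≤ y * ∑ i ∈ Finset.range n, x ^ i / i.factorial) : Real.exp (-x) ≤ y := by
  rw [Real.exp_neg, inv_le_comm₀ (Real.exp_pos _) hy]
  refine le_trans ?_ (Real.sum_le_exp_of_nonneg hx n)
  rwa [inv_le_iff_one_le_mul₀' hy]

/-- The exponent `0.41 t - t²/2` decreases for `t ≥ 0.41`, so the exponential is at most its value
at `a`, and `1/t` integrates to a logarithm. -/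
lemma lintegral_Ioc_gauss_le {a b E l p : ℝ} (ha : 0.41 ≤ a) (hab : a ≤ b)
    (hE : Real.exp (0.41 * a - a ^ 2 / 2) ≤ E) (hl : Real.log (b / a) ≤ l) (hp : E * l ≤ p) :
    ∫⁻ t in Set.Ioc a b, ENNReal.ofReal (Real.exp (0.41 * t - t ^ 2 / 2) / t)
      ≤ ENNReal.ofReal p := by
  have ha0 : 0 < a := by linarith
  have hE0 := (Real.exp_pos _).le.trans hE
  calc _ ≤ ∫⁻ t in Set.Ioc a b, ENNReal.ofReal (E / t) := by
        refine setLIntegral_mono' measurableSet_Ioc fun t ht => ENNReal.ofReal_le_ofReal ?_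
        have : 0 < t := ha0.trans ht.1
        gcongr
        refine le_trans (Real.exp_le_exp.2 ?_) hE
        nlinarith [ht.1]
    _ ≤ _ := (lintegral_div_le ha0 hab hE0).trans (ENNReal.ofReal_le_ofReal
        ((mul_le_mul_of_nonneg_left hl hE0).trans hp))

lemma lintegral_Ioi_three_le :
    ∫⁻ t in Set.Ioi (3:ℝ), ENNReal.ofReal (Real.exp (0.41 * t - t ^ 2 / 2) / t)
      ≤ ENNReal.ofReal 0.02 := by
  have hi : IntegrableOn (fun t : ℝ => Real.exp (-1.09 * t) / 3) (Set.Ioi 3) :=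
    (integrableOn_exp_mul_Ioi (by norm_num) 3).div_const 3
  calc _ ≤ ∫⁻ t in Set.Ioi (3:ℝ), ENNReal.ofReal (Real.exp (-1.09 * t) / 3) := by
        refine setLIntegral_mono' measurableSet_Ioi fun t ht => ENNReal.ofReal_le_ofReal ?_
        have ht' : 3 < t := ht
        gcongr
        -- Beyond `3`, `t²/2 ≥ 1.5 t`, and `0.41 - 1.5 = -1.09`.
        nlinarith
    _ = ENNReal.ofReal (∫ t in Set.Ioi (3:ℝ), Real.exp (-1.09 * t) / 3) := by
        rw [ofReal_integral_eq_lintegral_ofReal hi (ae_of_all _ fun t => by positivity)]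
    _ ≤ _ := by
        refine ENNReal.ofReal_le_ofReal ?_
        rw [integral_div, integral_exp_mul_Ioi (by norm_num)]
        have : Real.exp (-1.09 * 3) ≤ 0.06 := by
          have := exp_neg_le_of_le_sum (x := 3.27) (y := 0.06) 6 (by norm_num) (by norm_num)
            (by norm_num [Finset.sum_range_succ, Nat.factorial])
          convert this using 2; norm_num
        have e : ∀ z : ℝ, -z / -1.09 / 3 = z / 3.27 := fun z => by ring
        rw [e]
        exact (div_le_div_of_nonneg_right this (by norm_num)).trans (by norm_num)

lemma lintegral_gauss_le :
    ∫⁻ t in Set.Ioi (1/2:ℝ), ENNReal.ofReal (Real.exp (0.41 * t - t ^ 2 / 2) / t)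
      ≤ ENNReal.ofReal 1.442 := by
  have h1 : Real.exp (0.41 * (1/2) - (1/2) ^ 2 / 2) ≤ 1.0834 := by
    have := Real.exp_bound' (x := 0.08) (by norm_num) (by norm_num) (n := 4) (by norm_num)
    norm_num [Finset.sum_range_succ, Nat.factorial] at this ⊢
    linarith
  have l32 : Real.log 1.5 ≤ 0.4056 := log_le_of_le_sum 6 (by norm_num) (by norm_num)
    (by norm_num [Finset.sum_range_succ, Nat.factorial])
  have l43 : Real.log (2 / 1.5) ≤ 0.2878 := log_le_of_le_sum 5 (by norm_num) (by norm_num)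
    (by norm_num [Finset.sum_range_succ, Nat.factorial])
  have e2 : Real.exp (-0.09) ≤ 0.914 := exp_neg_le_of_le_sum 4 (by norm_num) (by norm_num)
    (by norm_num [Finset.sum_range_succ, Nat.factorial])
  have e3 : Real.exp (-0.51) ≤ 0.6006 := exp_neg_le_of_le_sum 6 (by norm_num) (by norm_num)
    (by norm_num [Finset.sum_range_succ, Nat.factorial])
  have e4 : Real.exp (-1.18) ≤ 0.3075 := exp_neg_le_of_le_sum 8 (by norm_num) (by norm_num)
    (by norm_num [Finset.sum_range_succ, Nat.factorial])
  have I1 := lintegral_Ioc_gauss_le (a := 1/2) (b := 1) (E := 1.0834) (l := 0.6932) (p := 0.752)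
    (by norm_num) (by norm_num) h1 (by norm_num; linarith [Real.log_two_lt_d9]) (by norm_num)
  have I2 := lintegral_Ioc_gauss_le (a := 1) (b := 1.5) (E := 0.914) (l := 0.4056) (p := 0.371)
    (by norm_num) (by norm_num) (by convert e2 using 2; norm_num) (by simpa using l32) (by norm_num)
  have I3 := lintegral_Ioc_gauss_le (a := 1.5) (b := 2) (E := 0.6006) (l := 0.2878) (p := 0.173)
    (by norm_num) (by norm_num) (by convert e3 using 2; norm_num) l43 (by norm_num)
  have I4 := lintegral_Ioc_gauss_le (a := 2) (b := 3) (E := 0.3075) (l := 0.4056) (p := 0.125)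
    (by norm_num) (by norm_num) (by convert e4 using 2; norm_num)
    (by convert l32 using 2; norm_num) (by norm_num)
  have hcover : Set.Ioi (1/2:ℝ) ⊆ Set.Ioc (1/2) 1 ∪ (Set.Ioc 1 1.5 ∪ (Set.Ioc 1.5 2 ∪
      (Set.Ioc 2 3 ∪ Set.Ioi 3))) := by
    rw [Set.Ioc_union_Ioi_eq_Ioi (by norm_num), Set.Ioc_union_Ioi_eq_Ioi (by norm_num),
      Set.Ioc_union_Ioi_eq_Ioi (by norm_num), Set.Ioc_union_Ioi_eq_Ioi (by norm_num)]
  refine (lintegral_mono_set hcover).trans ?_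
  refine (lintegral_union_le _ _ _).trans ?_
  refine (add_le_add I1 ((lintegral_union_le _ _ _).trans (add_le_add I2
    ((lintegral_union_le _ _ _).trans (add_le_add I3 ((lintegral_union_le _ _ _).trans
      (add_le_add I4 lintegral_Ioi_three_le))))))).trans ?_
  rw [← ENNReal.ofReal_add (by norm_num) (by norm_num), ← ENNReal.ofReal_add (by norm_num)
    (by norm_num), ← ENNReal.ofReal_add (by norm_num) (by norm_num),
    ← ENNReal.ofReal_add (by norm_num) (by norm_num)]
  exact ENNReal.ofReal_le_ofReal (by norm_num)

end Numeric

/-! ### The maximal inequality for a centred variable -/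

section PosVariation

lemma lintegral_ofReal_sub_le (x : ℝ) (A : Set ℝ) (hA : A ⊆ Set.Ioi 0) :
    ∫⁻ t in A, ENNReal.ofReal (x - t) ≤ ENNReal.ofReal (max x 0 ^ 2 / 2) := by
  refine (lintegral_mono_set hA).trans ?_
  rcases le_total x 0 with hx | hx
  · refine le_trans (le_of_eq ?_) zero_le
    rw [setLIntegral_congr_fun (g := fun _ => 0) measurableSet_Ioi]
    · simp
    · intro t ht
      exact ENNReal.ofReal_of_nonpos (by linarith [Set.mem_Ioi.1 ht])
  · rw [← Set.Ioc_union_Ioi_eq_Ioi hx]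
    refine (lintegral_union_le _ _ _).trans ?_
    have h2 : ∫⁻ t in Set.Ioi x, ENNReal.ofReal (x - t) = 0 := by
      rw [setLIntegral_congr_fun (g := fun _ => 0) measurableSet_Ioi]
      · simp
      · intro t ht
        exact ENNReal.ofReal_of_nonpos (by linarith [Set.mem_Ioi.1 ht])
    have hc : Continuous fun t : ℝ => x - t := by fun_prop
    have hi : IntervalIntegrable (fun t : ℝ => x - t) volume 0 x := hc.intervalIntegrable _ _
    rw [h2, add_zero, ← ofReal_integral_eq_lintegral_ofReal hi.1
      ((ae_restrict_iff' measurableSet_Ioc).2 (ae_of_all _ fun t ht => sub_nonneg.2 ht.2)),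
      ← intervalIntegral.integral_of_le hx, max_eq_left hx]
    refine ENNReal.ofReal_le_ofReal (le_of_eq ?_)
    rw [intervalIntegral.integral_sub (by simp) (by simp)]
    simp; ring

variable {Ω : Type*} {mΩ : MeasurableSpace Ω} {Q : Measure Ω} [IsProbabilityMeasure Q] {X : Ω → ℝ}

/-- The variation is split at `t = 1/2`. For small `t` the integrand is at most `(X - t)₊ + X
(e^{tX} - 1) e^{-D(t)}`: the first term integrates to half the square of `X₊`, the second has mean
`D'(t) ≤ v t e^{Rt}` and contributes at most `1.2276 v / 8`. For large `t` the tilted tail bound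
gives `v e^{0.41 t - t²/2}/(4t)`, which contributes at most `1.442 v / 4`. -/
lemma lintegral_posVariation_le (hXm : Measurable X)
    (hX : ∀ t, Integrable (fun ω => Real.exp (t * X ω)) Q)
    (hmean : ∫ ω, X ω ∂Q = 0) {R v Y : ℝ} (hR : 0 ≤ R) (hR' : R ≤ 0.41) (hv : 0 ≤ v)
    (hD : ∀ t ∈ Set.Icc 0 Y, iteratedDeriv 2 (cgf X Q) t ≤ v * Real.exp (R * t)) :
    ∫⁻ ω, posVariation X Q Y ω ∂Q
      ≤ ∫⁻ ω, ENNReal.ofReal (max (X ω) 0 ^ 2 / 2) ∂Q + ENNReal.ofReal (0.514 * v) := by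
  have hc := (differentiable_cgf hX).continuous
  have hc' := (differentiable_deriv_cgf hX).continuous
  set D := cgf X Q with hDdef
  set G : Ω → ℝ → ENNReal := fun ω t => ENNReal.ofReal ((X ω - deriv D t - t) *
    Real.exp (t * X ω - D t - t ^ 2 / 2)) with hG
  set Z : Ω → ℝ → ENNReal := fun ω t =>
    ENNReal.ofReal (X ω * (Real.exp (t * X ω) - 1) * Real.exp (-D t)) with hZ
  have hGm : Measurable (Function.uncurry G) := by
    refine ENNReal.measurable_ofReal.comp ?_
    have h1 := hc.measurable
    have h2 := hc'.measurable
    fun_prop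
  have hZm : Measurable (Function.uncurry Z) := by
    refine ENNReal.measurable_ofReal.comp ?_
    have h1 := hc.measurable
    fun_prop
  set A := Set.Ioc (0:ℝ) Y ∩ Set.Iic (1/2)
  set B := Set.Ioc (0:ℝ) Y ∩ Set.Ioi (1/2)
  have hAm : MeasurableSet A := measurableSet_Ioc.inter measurableSet_Iic
  have hBm : MeasurableSet B := measurableSet_Ioc.inter measurableSet_Ioi
  have hAB : Set.Ioc (0:ℝ) Y ⊆ A ∪ B := by
    intro t ht
    rcases le_or_gt t (1/2) with h | h
    · exact Or.inl ⟨ht, h⟩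
    · exact Or.inr ⟨ht, h⟩
  have hpt : ∀ ω, ∀ t ∈ A, G ω t ≤ ENNReal.ofReal (X ω - t) + Z ω t := by
    intro ω t ht
    have ht0 : 0 < t := ht.1.1
    have hDt := cgf_nonneg_of_mean_zero hX hmean ht0.le
    have hD't := deriv_cgf_nonneg hX hmean ht0.le
    change 0 ≤ D t at hDt
    change 0 ≤ deriv D t at hD't
    rcases le_or_gt (X ω) t with h | h
    · refine le_trans (le_of_eq (ENNReal.ofReal_of_nonpos ?_)) zero_le
      exact mul_nonpos_of_nonpos_of_nonneg (by linarith) (Real.exp_pos _).le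
    · have h1 : 1 ≤ Real.exp (t * X ω) := Real.one_le_exp (by nlinarith)
      rw [hZ, ← ENNReal.ofReal_add (by linarith)
        (mul_nonneg (mul_nonneg (by linarith) (by linarith)) (Real.exp_pos _).le)]
      refine ENNReal.ofReal_le_ofReal ?_
      have e1 : Real.exp (-D t) ≤ 1 := Real.exp_le_one_iff.2 (by linarith)
      have e0 := Real.exp_pos (-D t)
      calc (X ω - deriv D t - t) * Real.exp (t * X ω - D t - t ^ 2 / 2)
          ≤ (X ω - t) * Real.exp (t * X ω + -D t) := by
            apply mul_le_mul (by linarith) (Real.exp_le_exp.2 (by nlinarith)) (Real.exp_pos _).le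
              (by linarith)
        _ = (X ω - t) * Real.exp (-D t) + (X ω - t) * (Real.exp (t * X ω) - 1) * Real.exp (-D t) := by
            rw [Real.exp_add]; ring
        _ ≤ _ := by
            refine add_le_add (by nlinarith) ?_
            refine mul_le_mul_of_nonneg_right (mul_le_mul_of_nonneg_right ?_ ?_) e0.le <;> linarith
  have hle : ∀ ω, posVariation X Q Y ω ≤ ENNReal.ofReal (max (X ω) 0 ^ 2 / 2)
      + ((∫⁻ t in A, Z ω t) + ∫⁻ t in B, G ω t) := by
    intro ω
    calc posVariation X Q Y ω ≤ ∫⁻ t in A ∪ B, G ω t := lintegral_mono_set hAB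
      _ ≤ (∫⁻ t in A, G ω t) + ∫⁻ t in B, G ω t := lintegral_union_le _ _ _
      _ ≤ (∫⁻ t in A, (ENNReal.ofReal (X ω - t) + Z ω t)) + ∫⁻ t in B, G ω t := by
          gcongr ?_ + _
          exact setLIntegral_mono' hAm (hpt ω)
      _ ≤ _ := by
          rw [lintegral_add_left (by fun_prop), add_assoc]
          gcongr
          exact lintegral_ofReal_sub_le _ _ fun t ht => ht.1.1
  refine (lintegral_mono hle).trans ?_
  have hX2 : Measurable fun ω => ENNReal.ofReal (max (X ω) 0 ^ 2 / 2) := by fun_prop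
  have hZm' : Measurable fun ω => ∫⁻ t in A, Z ω t := hZm.lintegral_prod_right'
  rw [lintegral_add_left hX2, lintegral_add_left hZm',
    lintegral_lintegral_swap hZm.aemeasurable, lintegral_lintegral_swap hGm.aemeasurable]
  gcongr
  have he : Real.exp 0.205 ≤ 1.2276 := by
    have := Real.exp_bound' (x := 0.205) (by norm_num) (by norm_num) (n := 5) (by norm_num)
    norm_num [Finset.sum_range_succ, Nat.factorial] at this ⊢
    linarith
  have hA : ∫⁻ t in A, ∫⁻ ω, Z ω t ∂Q ≤ ENNReal.ofReal (0.1535 * v) := by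
    calc _ ≤ ∫⁻ t in A, ENNReal.ofReal (v * 1.2276 * t) := by
          refine setLIntegral_mono' hAm fun t ht => ?_
          have ht0 : 0 < t := ht.1.1
          rw [lintegral_mul_exp_sub_one hX hmean ht0.le]
          refine ENNReal.ofReal_le_ofReal ((deriv_cgf_le hX hmean hR hv hD ⟨ht0.le, ht.1.2⟩).trans ?_)
          gcongr
          refine (Real.exp_le_exp.2 ?_).trans he
          have : t ≤ 1/2 := ht.2
          nlinarith
      _ ≤ ∫⁻ t in Set.Ioc (0:ℝ) (1/2), ENNReal.ofReal (v * 1.2276 * t) :=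
          lintegral_mono_set fun t ht => ⟨ht.1.1, ht.2⟩
      _ = ENNReal.ofReal (∫ t in Set.Ioc (0:ℝ) (1/2), v * 1.2276 * t) := by
          have hcc : Continuous fun t : ℝ => v * 1.2276 * t := by fun_prop
          rw [ofReal_integral_eq_lintegral_ofReal (hcc.intervalIntegrable 0 (1/2)).1
            ((ae_restrict_iff' measurableSet_Ioc).2 (ae_of_all _ fun t ht => ?_))]
          have := ht.1
          positivity
      _ ≤ _ := by
          refine ENNReal.ofReal_le_ofReal ?_
          rw [← intervalIntegral.integral_of_le (by norm_num), intervalIntegral.integral_const_mul,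
            integral_id]
          nlinarith
  have hB : ∫⁻ t in B, ∫⁻ ω, G ω t ∂Q ≤ ENNReal.ofReal (0.3605 * v) := by
    calc _ ≤ ∫⁻ t in B, ENNReal.ofReal (v / 4) *
          ENNReal.ofReal (Real.exp (0.41 * t - t ^ 2 / 2) / t) := by
          refine setLIntegral_mono' hBm fun t ht => ?_
          have ht0 : 0 < t := ht.1.1
          have hGt : ∀ ω, G ω t = ENNReal.ofReal (Real.exp (-(t ^ 2 / 2))) *
              ENNReal.ofReal ((X ω - deriv D t - t) * Real.exp (t * X ω - D t)) := by
            intro ω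
            rw [← ENNReal.ofReal_mul (Real.exp_pos _).le, hG]
            simp only
            rw [sub_eq_add_neg (t * X ω - D t), Real.exp_add]
            ring_nf
          simp_rw [hGt]
          rw [lintegral_const_mul' _ _ ENNReal.ofReal_ne_top]
          refine (mul_le_mul_right (lintegral_tail_tilted_le hX t ht0) _).trans ?_
          rw [← ENNReal.ofReal_mul (Real.exp_pos _).le, ← ENNReal.ofReal_mul (by positivity)]
          refine ENNReal.ofReal_le_ofReal ?_
          have h1 : iteratedDeriv 2 D t ≤ v * Real.exp (0.41 * t) :=
            (hD t ⟨ht0.le, ht.1.2⟩).trans (by gcongr)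
          rw [sub_eq_add_neg, Real.exp_add]
          calc _ ≤ Real.exp (-(t ^ 2 / 2)) * (v * Real.exp (0.41 * t) / (4 * t)) := by gcongr
            _ = _ := by field_simp
      _ ≤ ENNReal.ofReal (v / 4) * ∫⁻ t in Set.Ioi (1/2:ℝ),
          ENNReal.ofReal (Real.exp (0.41 * t - t ^ 2 / 2) / t) := by
          rw [lintegral_const_mul' _ _ ENNReal.ofReal_ne_top]
          gcongr
          exact fun t ht => ht.2
      _ ≤ ENNReal.ofReal (v / 4) * ENNReal.ofReal 1.442 := by
          gcongr
          exact lintegral_gauss_le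
      _ ≤ _ := by
          rw [← ENNReal.ofReal_mul (by positivity)]
          exact ENNReal.ofReal_le_ofReal (by linarith)
  refine (add_le_add hA hB).trans ?_
  rw [← ENNReal.ofReal_add (by positivity) (by positivity)]
  exact ENNReal.ofReal_le_ofReal (by linarith)

/-- A maximal inequality for exponential families: if `X` is centred and the second derivative of
its cumulant generating function `D` is at most `v e^{R |t|}` on `[-Y₁, Y₂]` with `R ≤ 0.41`, then
`E sup_y exp (y X - D y - y ^ 2 / 2) ≤ 1 + 1.53 v`. -/
lemma lintegral_iSup_exp_le (hXm : Measurable X)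
    (hX : ∀ t, Integrable (fun ω => Real.exp (t * X ω)) Q)
    (hmean : ∫ ω, X ω ∂Q = 0) {R v Y₁ Y₂ : ℝ} (hR : 0 ≤ R) (hR' : R ≤ 0.41)
    (hY₁ : 0 ≤ Y₁) (hY₂ : 0 ≤ Y₂)
    (hD : ∀ t ∈ Set.Icc (-Y₁) Y₂, iteratedDeriv 2 (cgf X Q) t ≤ v * Real.exp (R * |t|)) :
    ∫⁻ ω, ⨆ y ∈ Set.Icc (-Y₁) Y₂,
      ENNReal.ofReal (Real.exp (y * X ω - cgf X Q y - y ^ 2 / 2)) ∂Q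
      ≤ ENNReal.ofReal (1 + 1.53 * v) := by
  have hX' : ∀ t, Integrable (fun ω => Real.exp (t * (-X) ω)) Q := by
    intro t
    have := hX (-t)
    simpa using this
  have hmean' : ∫ ω, (-X) ω ∂Q = 0 := by
    simp only [Pi.neg_apply]; rw [integral_neg, hmean, neg_zero]
  have h2 := integrable_pow_mul_exp_of_mem_interior_integrableExpSet
    (mem_interior_integrableExpSet hX 0) 2
  have hvar : ∫ ω, X ω ^ 2 ∂Q ≤ v := by
    have h := hD 0 (by simp [hY₁, hY₂])
    have h0 : deriv (cgf X Q) 0 = 0 := by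
      rw [deriv_cgf_zero (mem_interior_integrableExpSet hX 0)]; simp [hmean]
    rw [iteratedDeriv_two_cgf_eq_integral (mem_interior_integrableExpSet hX 0), h0] at h
    simpa using h
  have hv : 0 ≤ v := le_trans (integral_nonneg fun ω => sq_nonneg _) hvar
  have hsup : ∀ ω, (⨆ y ∈ Set.Icc (-Y₁) Y₂,
      ENNReal.ofReal (Real.exp (y * X ω - cgf X Q y - y ^ 2 / 2)))
      ≤ 1 + (posVariation X Q Y₂ ω + posVariation (-X) Q Y₁ ω) := by
    intro ω
    refine iSup₂_le fun y hy => ?_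
    rcases le_total 0 y with h | h
    · refine (ofReal_exp_le_posVariation hX ⟨h, hy.2⟩ ω).trans ?_
      gcongr
      exact le_self_add
    · have := ofReal_exp_le_posVariation hX' (y := -y) (Y := Y₁) ⟨by linarith, by linarith [hy.1]⟩ ω
      rw [cgf_neg, neg_neg] at this
      refine (le_of_eq ?_).trans (this.trans ?_)
      · simp
      · gcongr
        exact le_add_self
  have hpm : ∀ {W : Ω → ℝ} (Y : ℝ), Measurable W →
      (∀ t, Integrable (fun ω => Real.exp (t * W ω)) Q) → Measurable (posVariation W Q Y) := by
    intro W Y hW hWi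
    have h1 := (differentiable_cgf hWi).continuous.measurable
    have h2 := (differentiable_deriv_cgf hWi).continuous.measurable
    have : Measurable (Function.uncurry fun (ω : Ω) (t : ℝ) => ENNReal.ofReal
        ((W ω - deriv (cgf W Q) t - t) * Real.exp (t * W ω - cgf W Q t - t ^ 2 / 2))) := by
      refine ENNReal.measurable_ofReal.comp ?_
      fun_prop
    exact this.lintegral_prod_right'
  refine (lintegral_mono hsup).trans ?_
  rw [lintegral_add_left measurable_const, lintegral_add_left (hpm _ hXm hX)]
  have b1 := lintegral_posVariation_le hXm hX hmean hR hR' hv (Y := Y₂) fun t ht => by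
    have := hD t ⟨by linarith [ht.1], ht.2⟩
    rwa [abs_of_nonneg ht.1] at this
  have b2 := lintegral_posVariation_le hXm.neg hX' hmean' hR hR' hv (Y := Y₁) fun t ht => by
    have h := hD (-t) ⟨by linarith [ht.2], by linarith [ht.1]⟩
    rw [abs_neg, abs_of_nonneg ht.1] at h
    have e : cgf (-X) Q = fun t => cgf X Q (-t) := by ext t; exact cgf_neg
    rw [e, iteratedDeriv_comp_neg]
    simpa using h
  -- The positive parts of `X` and `-X` together make up `X²/2`, so the variance is paid only once
  -- for both directions; the total constant is `0.5 + 2 · 0.514 = 1.528`.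
  have hsq : ∫⁻ ω, ENNReal.ofReal (max (X ω) 0 ^ 2 / 2) ∂Q
      + ∫⁻ ω, ENNReal.ofReal (max ((-X) ω) 0 ^ 2 / 2) ∂Q ≤ ENNReal.ofReal (0.5 * v) := by
    rw [← lintegral_add_left (by fun_prop)]
    calc _ = ∫⁻ ω, ENNReal.ofReal (X ω ^ 2 / 2) ∂Q := by
          refine lintegral_congr fun ω => ?_
          rw [← ENNReal.ofReal_add (by positivity) (by positivity)]
          congr 1
          rcases le_total 0 (X ω) with h | h
          · simp [h]
          · simp [h]
      _ = ENNReal.ofReal (∫ ω, X ω ^ 2 / 2 ∂Q) := by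
          rw [ofReal_integral_eq_lintegral_ofReal ((by simpa using h2 :
            Integrable (fun ω => X ω ^ 2) Q).div_const 2) (ae_of_all _ fun ω => by positivity)]
      _ ≤ _ := by
          rw [integral_div]
          exact ENNReal.ofReal_le_ofReal (by linarith)
  calc _ ≤ 1 + ((_ + _) + (_ + _)) := by
        gcongr
        simp
    _ = 1 + ((∫⁻ ω, ENNReal.ofReal (max (X ω) 0 ^ 2 / 2) ∂Q
      + ∫⁻ ω, ENNReal.ofReal (max ((-X) ω) 0 ^ 2 / 2) ∂Q) +
        (ENNReal.ofReal (0.514 * v) + ENNReal.ofReal (0.514 * v))) := by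
        rw [add_add_add_comm]
    _ ≤ 1 + (ENNReal.ofReal (0.5 * v) + (ENNReal.ofReal (0.514 * v) + ENNReal.ofReal (0.514 * v))) := by
        gcongr
    _ ≤ _ := by
        rw [← ENNReal.ofReal_add (by positivity) (by positivity),
          ← ENNReal.ofReal_add (by positivity) (by positivity), ← ENNReal.ofReal_one,
          ← ENNReal.ofReal_add (by positivity) (by positivity)]
        exact ENNReal.ofReal_le_ofReal (by linarith)

end PosVariation

/-! ### Balancing the maximal inequality against the log compensator -/

section Scalar

/-- This is the case `η = 1`, `ι = 0.35` of the balance: `3.531` rounds up `1.53 · 1.5 / 0.65`,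
`3.5` is `3η + 1/2`, and `2.6788` rounds up `3.5 · 5 · (3/28) / 0.7`. The difference of the sides is
increasing on `[2/9, ∞)`, so only the left endpoint is checked numerically. -/
lemma log_one_add_affine_le {u : ℝ} (hu : 2 / 9 ≤ u) :
    Real.log (1 + 3.531 * u) ≤ 3.5 * Real.log (1 + u) - 2.6788 * (u / (1 + u)) ^ 2 := by
  set f : ℝ → ℝ := fun u => 3.5 * Real.log (1 + u) - 2.6788 * (u / (1 + u)) ^ 2
    - Real.log (1 + 3.531 * u) with hf
  have hder : ∀ x : ℝ, 0 < x → HasDerivAt f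
      (3.5 * (1 / (1 + x)) - 2.6788 * (2 * (x / (1 + x)) * (1 / (1 + x) ^ 2))
        - 3.531 / (1 + 3.531 * x)) x := by
    intro x hx
    have h1 : HasDerivAt (fun u : ℝ => 1 + u) 1 x := (hasDerivAt_id x).const_add 1
    have h2 : HasDerivAt (fun u : ℝ => 1 + 3.531 * u) 3.531 x := by
      simpa using ((hasDerivAt_id x).const_mul (3.531:ℝ)).const_add 1
    have n1 : (1 + x) ≠ 0 := by positivity
    have n2 : (1 + 3.531 * x) ≠ 0 := by positivity
    have := (((h1.log n1).const_mul (3.5:ℝ)).sub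
      ((((hasDerivAt_id x).div h1 n1).pow 2).const_mul (2.6788:ℝ))).sub (h2.log n2)
    convert! this using 1
    simp
  have hmono : MonotoneOn f (Set.Ici (2 / 9)) := by
    refine monotoneOn_of_deriv_nonneg (convex_Ici _) ?_ ?_ ?_
    · intro x hx
      exact (hder x (by linarith [Set.mem_Ici.1 hx])).continuousAt.continuousWithinAt
    · intro x hx
      rw [interior_Ici] at hx
      exact (hder x (by linarith [Set.mem_Ioi.1 hx])).differentiableAt.differentiableWithinAt
    · intro x hx
      rw [interior_Ici] at hx
      have hx' : 2 / 9 < x := hx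
      have hx0 : 0 < x := by linarith
      rw [(hder x hx0).deriv]
      have e : 3.5 * (1 / (1 + x)) - 2.6788 * (2 * (x / (1 + x)) * (1 / (1 + x) ^ 2))
        - 3.531 / (1 + 3.531 * x)
        = (3.5 * (1 + x) ^ 2 * (1 + 3.531 * x) - 5.3576 * x * (1 + 3.531 * x)
          - 3.531 * (1 + x) ^ 3) / ((1 + x) ^ 3 * (1 + 3.531 * x)) := by
        field_simp
        ring
      rw [e]
      refine div_nonneg ?_ (by positivity)
      -- Re-centring the polynomial at `2/9` makes all its coefficients nonnegative.
      obtain ⟨w, hw⟩ : ∃ w, x = 2 / 9 + w := ⟨x - 2 / 9, by ring⟩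
      have hw0 : 0 ≤ w := by linarith
      subst hw
      ring_nf
      positivity
  have h0 : 0 ≤ f (2 / 9) := by
    have hl : 0.2 ≤ Real.log (1 + 2 / 9) := by
      have := Real.le_log_one_add_of_nonneg (x := 2 / 9) (by norm_num)
      norm_num at this ⊢
      linarith
    have hr : Real.log (1 + 3.531 * (2 / 9)) ≤ 0.61 := log_le_of_le_sum 5 (by norm_num)
      (by norm_num) (by norm_num [Finset.sum_range_succ, Nat.factorial])
    simp only [hf]
    norm_num at hl hr ⊢
    linarith
  have := h0.trans (hmono (by simp) hu hu)
  simp only [hf] at this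
  linarith

/-- This handles the growth of the balance in `K = 3η + 1/2` beyond `3.5`: each unit of `K` adds
`3.531/3 = 1.177` times `u` on the left, and `log (1 + u)` minus the error term on the right. -/
lemma rational_le_log_sub {u : ℝ} (hu : 2 / 9 ≤ u) :
    1.177 * u / (1 + 3.531 * u) ≤ Real.log (1 + u) - 0.76536 * (u / (1 + u)) ^ 2 := by
  have hu0 : 0 < u := by linarith
  have h := Real.le_log_one_add_of_nonneg hu0.le
  suffices 1.177 * u / (1 + 3.531 * u) ≤ 2 * u / (u + 2) - 0.76536 * (u / (1 + u)) ^ 2 by linarith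
  have e : 2 * u / (u + 2) - 0.76536 * (u / (1 + u)) ^ 2 - 1.177 * u / (1 + 3.531 * u)
      = u * (2 * (1 + u) ^ 2 * (1 + 3.531 * u) - 0.76536 * u * (u + 2) * (1 + 3.531 * u)
        - 1.177 * (u + 2) * (1 + u) ^ 2) / ((u + 2) * (1 + u) ^ 2 * (1 + 3.531 * u)) := by
    field_simp
  rw [← sub_nonneg, e]
  refine div_nonneg (mul_nonneg hu0.le ?_) (by positivity)
  obtain ⟨w, hw⟩ : ∃ w, u = 2 / 9 + w := ⟨u - 2 / 9, by ring⟩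
  have hw0 : 0 ≤ w := by linarith
  subst hw
  ring_nf
  positivity

/-- The numerical inequality balancing the maximal inequality for exponential families against the
logarithmic compensator: `q` stands for `R² s²`, `τ` for `v s²`. -/
lemma exists_exp_compensator_ge {η τ q : ℝ} (hη : 1 ≤ η) (hτ : 0 ≤ τ) (hητ : (η - 1) * τ ≤ 1 / 4)
    (hq0 : 0 ≤ q) (hq : q ≤ 3 / 28) :
    ∃ ι : ℝ, 0 < ι ∧ ι ≤ 0.35 ∧ 1 + 1.53 * (τ / (1 - ι)) ≤
      Real.exp ((3 * η + 1 / 2) * Real.log (1 + τ / (1.5 * η))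
        - ((3 * η + 1 / 2) * (τ / (1.5 * η)) / (1 + τ / (1.5 * η))) ^ 2 * q / (2 * ι)) := by
  set u := τ / (1.5 * η) with hu
  set K := 3 * η + 1 / 2 with hK
  have hu0 : 0 ≤ u := by positivity
  have hτu : τ = 1.5 * η * u := by rw [hu]; field_simp
  set B := K * Real.log (1 + u) with hB
  set χ := K * u / (1 + u) with hχ
  have hK0 : 0 < K := by positivity
  have hχ0 : 0 ≤ χ := by positivity
  rcases le_total τ (1 / 2) with h | h
  -- Small `τ`: with `B = K log (1 + u)` between `2τ` and `7/6`, the exponent is at least `B -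
  -- 0.2679 B²`, which is increasing there. The second-order expansion of `exp` at `B = 2τ` then
  -- exceeds `1 + 1.9125 τ`.
  · refine ⟨0.2, by norm_num, by norm_num, ?_⟩
    have hχB : χ ≤ B := by
      rw [hχ, hB, mul_div_assoc]
      refine mul_le_mul_of_nonneg_left ?_ hK0.le
      have := Real.one_sub_inv_le_log_of_pos (x := 1 + u) (by positivity)
      refine le_trans (le_of_eq ?_) this
      field_simp
      ring
    have hB2 : 2 * τ ≤ B := by
      have h1 := Real.le_log_one_add_of_nonneg hu0
      refine le_trans ?_ (mul_le_mul_of_nonneg_left h1 hK0.le)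
      rw [mul_div_assoc', le_div_iff₀ (by positivity), hK, hτu]
      rw [hτu] at h
      nlinarith
    have hB1 : B ≤ 7 / 6 := by
      have h1 : Real.log (1 + u) ≤ u := by
        have := Real.log_le_sub_one_of_pos (x := 1 + u) (by positivity)
        linarith
      refine (mul_le_mul_of_nonneg_left h1 hK0.le).trans ?_
      have : u ≤ τ / 1.5 := by
        rw [hu]
        gcongr
        linarith
      rw [hK]
      nlinarith
    have hJ : χ ^ 2 * q / (2 * 0.2) ≤ 0.2679 * B ^ 2 := by
      have h1 : χ ^ 2 ≤ B ^ 2 := by gcongr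
      have h2 : χ ^ 2 * q ≤ B ^ 2 * (3 / 28) := mul_le_mul h1 hq hq0 (by positivity)
      rw [div_le_iff₀ (by norm_num)]
      nlinarith [sq_nonneg B]
    have hx : 2 * τ - 1.0716 * τ ^ 2 ≤ B - χ ^ 2 * q / (2 * 0.2) := by
      nlinarith
    refine le_trans ?_ (Real.exp_le_exp.2 hx)
    refine le_trans ?_ (Real.quadratic_le_exp_of_nonneg (by nlinarith))
    have h3 : 0 ≤ 0.5 - τ := by linarith
    have e : 1 + (2 * τ - 1.0716 * τ ^ 2) + (2 * τ - 1.0716 * τ ^ 2) ^ 2 / 2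
        - (1 + 1.53 * (τ / (1 - 0.2))) =
        τ * (0.0875 + 0.9284 * τ - 2.1432 * τ ^ 2 + 0.57416328 * τ ^ 3) := by
      ring
    have h4 : 0 ≤ 0.0875 + 0.9284 * τ - 2.1432 * τ ^ 2 + 0.57416328 * τ ^ 3 := by
      have : 0 ≤ τ * (0.5 - τ) := mul_nonneg hτ h3
      nlinarith [mul_nonneg (sq_nonneg τ) hτ, mul_nonneg hτ (sq_nonneg (0.5 - τ))]
    nlinarith [mul_nonneg hτ h4]
  -- Large `τ`: `(η - 1)τ ≤ 1/4` forces `η ≤ 1.5`, hence `3.5 ≤ K ≤ 5` and `u ≥ 2/9`.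
  · refine ⟨0.35, by norm_num, le_rfl, ?_⟩
    have hη' : η ≤ 1.5 := by nlinarith
    have hu29 : 2 / 9 ≤ u := by
      rw [hu, le_div_iff₀ (by positivity)]
      nlinarith
    have hK5 : K ≤ 5 := by rw [hK]; linarith
    have hK35 : 3.5 ≤ K := by rw [hK]; linarith
    have hJ : χ ^ 2 * q / (2 * 0.35) ≤ K * (0.76536 * (u / (1 + u)) ^ 2) := by
      have e : χ ^ 2 = K * (K * (u / (1 + u)) ^ 2) := by rw [hχ]; ring
      have h0 : 0 ≤ K * (u / (1 + u)) ^ 2 := by positivity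
      have h1 : χ ^ 2 ≤ 5 * (K * (u / (1 + u)) ^ 2) := by
        rw [e]; exact mul_le_mul_of_nonneg_right hK5 h0
      have h2 : χ ^ 2 * q ≤ 5 * (K * (u / (1 + u)) ^ 2) * (3 / 28) :=
        mul_le_mul h1 hq hq0 (by positivity)
      rw [div_le_iff₀ (by norm_num)]
      nlinarith
    have hA : (0:ℝ) < 1 + 3.531 * u := by positivity
    have hm : 1 + 1.53 * (τ / (1 - 0.35)) ≤ (1 + 3.531 * u) *
        Real.exp ((K - 3.5) * (1.177 * u / (1 + 3.531 * u))) := by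
      refine le_trans ?_ (mul_le_mul_of_nonneg_left (Real.add_one_le_exp _) hA.le)
      have : (1 + 3.531 * u) * ((K - 3.5) * (1.177 * u / (1 + 3.531 * u)) + 1)
        = (K - 3.5) * (1.177 * u) + (1 + 3.531 * u) := by field_simp
      rw [this, hτu, hK]
      norm_num
      nlinarith
    refine hm.trans ?_
    rw [← Real.log_le_iff_le_exp (by positivity), Real.log_mul hA.ne' (Real.exp_pos _).ne',
      Real.log_exp]
    have i1 := log_one_add_affine_le hu29
    have i2 := mul_le_mul_of_nonneg_left (rational_le_log_sub hu29) (sub_nonneg.2 hK35)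
    rw [hB]
    nlinarith [sq_nonneg (u / (1 + u))]

end Scalar

/-! ### Growth of the second derivative under self-concordance -/

section SelfConcordance

variable {m : ℝ → ℝ}

lemma RegularLogPartition.deriv_two_nonneg (hm : RegularLogPartition m) (z : ℝ) :
    0 ≤ deriv (deriv m) z := by
  have hmono : Monotone (deriv m) := by
    rw [← monotoneOn_univ]
    exact hm.convex.monotoneOn_deriv (fun x _ => hm.differentiable₁ x)
  exact hmono.deriv_nonneg

/-- Self-concordance bounds the growth of the second derivative. -/
lemma deriv_two_le_mul_exp (hm : RegularLogPartition m) {R h : ℝ}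
    (hsc : ∀ z ∈ Set.Icc (-h) h, |deriv (deriv (deriv m)) z| ≤ R * deriv (deriv m) z)
    {a b : ℝ} (ha : a ∈ Set.Icc (-h) h) (hb : b ∈ Set.Icc (-h) h) :
    deriv (deriv m) b ≤ deriv (deriv m) a * Real.exp (R * |b - a|) := by
  have hd := hm.differentiable₃
  have key : ∀ ρ : ℝ, ∀ x, HasDerivAt (fun t => deriv (deriv m) t * Real.exp (ρ * t))
      ((deriv (deriv (deriv m)) x + ρ * deriv (deriv m) x) * Real.exp (ρ * x)) x := by
    intro ρ x
    have h1 : HasDerivAt (fun t : ℝ => Real.exp (ρ * t)) (Real.exp (ρ * x) * ρ) x := by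
      simpa using ((hasDerivAt_id x).const_mul ρ).exp
    convert! (hd x).hasDerivAt.mul h1 using 1
    ring
  rcases le_total a b with hab | hab
  · have hanti : AntitoneOn (fun t => deriv (deriv m) t * Real.exp (-R * t)) (Set.Icc (-h) h) := by
      refine antitoneOn_of_deriv_nonpos (convex_Icc _ _)
        (fun x _ => (key (-R) x).continuousAt.continuousWithinAt)
        (fun x _ => (key (-R) x).differentiableAt.differentiableWithinAt) fun x hx => ?_
      rw [(key (-R) x).deriv]
      have := hsc x (interior_subset hx)
      exact mul_nonpos_of_nonpos_of_nonneg (by linarith [(abs_le.1 this).2]) (Real.exp_pos _).le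
    have := hanti ha hb hab
    simp only at this
    rw [abs_of_nonneg (sub_nonneg.2 hab)]
    calc deriv (deriv m) b = deriv (deriv m) b * Real.exp (-R * b) * Real.exp (R * b) := by
          rw [mul_assoc, ← Real.exp_add]; simp
      _ ≤ deriv (deriv m) a * Real.exp (-R * a) * Real.exp (R * b) := by gcongr
      _ = _ := by rw [mul_assoc, ← Real.exp_add]; ring_nf
  · have hmono : MonotoneOn (fun t => deriv (deriv m) t * Real.exp (R * t)) (Set.Icc (-h) h) := by
      refine monotoneOn_of_deriv_nonneg (convex_Icc _ _)
        (fun x _ => (key R x).continuousAt.continuousWithinAt)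
        (fun x _ => (key R x).differentiableAt.differentiableWithinAt) fun x hx => ?_
      rw [(key R x).deriv]
      have := hsc x (interior_subset hx)
      exact mul_nonneg (by linarith [(abs_le.1 this).1]) (Real.exp_pos _).le
    have := hmono hb ha hab
    simp only at this
    rw [abs_of_nonpos (sub_nonpos.2 hab)]
    calc deriv (deriv m) b = deriv (deriv m) b * Real.exp (R * b) * Real.exp (-R * b) := by
          rw [mul_assoc, ← Real.exp_add]; simp
      _ ≤ deriv (deriv m) a * Real.exp (R * a) * Real.exp (-R * b) := by gcongr
      _ = _ := by rw [mul_assoc, ← Real.exp_add]; ring_nf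

end SelfConcordance

/-! ### The one-round exponential inequality -/

section ExponentialFamily

variable {m : ℝ → ℝ} {ν : Measure ℝ} {g : ℝ}

/-- Convexity of `exp` between `0` and `E`; this reduces a weighted likelihood to an unweighted one.
-/
lemma exp_mul_le_add {w E : ℝ} (hw : 0 ≤ w) (hw1 : w ≤ 1) :
    Real.exp (w * E) ≤ w * Real.exp E + (1 - w) := by
  have := convexOn_exp.2 (Set.mem_univ E) (Set.mem_univ 0) hw (sub_nonneg.2 hw1) (by ring)
  simpa using this

/-- The left side is the tangent at `x = 0` of the convex function on the right. -/
lemma log_sub_mul_le_log_one_add_mul_exp {u x : ℝ} (hu : 0 ≤ u) :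
    Real.log (1 + u) - u / (1 + u) * x ≤ Real.log (1 + u * Real.exp (-x)) := by
  have h1 : 0 < 1 + u := by positivity
  have hp : u / (1 + u) ≤ 1 := (div_le_one h1).2 (by linarith)
  have := exp_mul_le_add (w := u / (1 + u)) (E := -x) (by positivity) hp
  rw [Real.le_log_iff_exp_le (by positivity), sub_eq_add_neg, Real.exp_add, Real.exp_log h1]
  calc _ = (1 + u) * Real.exp (u / (1 + u) * -x) := by ring_nf
    _ ≤ (1 + u) * (u / (1 + u) * Real.exp (-x) + (1 - u / (1 + u))) := by gcongr
    _ = _ := by field_simp; ring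

lemma measurable_glm_density (z : ℝ) :
    Measurable fun r => ENNReal.ofReal (Real.exp ((r * z - m z) / g)) := by fun_prop

/-- No measurability of `f` is required, because the formula is applied to uncountable suprema. -/
lemma lintegral_glmLaw (z : ℝ) (f : ℝ → ENNReal) :
    ∫⁻ r, f r ∂(glmLaw m ν g z)
      = ∫⁻ r, ENNReal.ofReal (Real.exp ((r * z - m z) / g)) * f r ∂ν := by
  rw [glmLaw, lintegral_withDensity_eq_lintegral_mul_non_measurable ν (measurable_glm_density z)
    (ae_of_all _ fun _ => ENNReal.ofReal_lt_top)]
  rfl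

lemma lintegral_glm_density (hν : IsLogPartition m ν g) (z : ℝ) :
    ∫⁻ r, ENNReal.ofReal (Real.exp ((r * z - m z) / g)) ∂ν = 1 := by
  have := (hν z).measure_univ
  rw [glmLaw, withDensity_apply _ MeasurableSet.univ] at this
  simpa using this

/-- Tilting the law at `a` by `κ` gives, up to a constant, the density at `a + κ`, whose
normalization evaluates the integral. All exponential moments are therefore finite. -/
lemma lintegral_exp_glmLaw (hν : IsLogPartition m ν g) (a κ μ : ℝ) :
    ∫⁻ r, ENNReal.ofReal (Real.exp (κ * (r - μ) / g)) ∂(glmLaw m ν g a)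
      = ENNReal.ofReal (Real.exp ((m (a + κ) - m a - μ * κ) / g)) := by
  rw [lintegral_glmLaw]
  calc _ = ∫⁻ r, ENNReal.ofReal (Real.exp ((m (a + κ) - m a - μ * κ) / g)) *
        ENNReal.ofReal (Real.exp ((r * (a + κ) - m (a + κ)) / g)) ∂ν := by
        refine lintegral_congr fun r => ?_
        rw [← ENNReal.ofReal_mul (Real.exp_pos _).le, ← ENNReal.ofReal_mul (Real.exp_pos _).le,
          ← Real.exp_add, ← Real.exp_add]
        congr 2
        ring
    _ = _ := by
        rw [lintegral_const_mul _ (measurable_glm_density _), lintegral_glm_density hν, mul_one]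

lemma integrable_exp_glmLaw (hν : IsLogPartition m ν g) (a κ μ : ℝ) :
    Integrable (fun r => Real.exp (κ * (r - μ) / g)) (glmLaw m ν g a) := by
  refine ⟨by fun_prop, ?_⟩
  rw [hasFiniteIntegral_iff_ofReal (ae_of_all _ fun r => (Real.exp_pos _).le),
    lintegral_exp_glmLaw hν]
  exact ENNReal.ofReal_lt_top

lemma cgf_glmLaw (hν : IsLogPartition m ν g) (a μ k y : ℝ) :
    cgf (fun r => (r - μ) / (g * k)) (glmLaw m ν g a) y
      = (m (a + y / k) - m a - μ * (y / k)) / g := by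
  have h : ∀ r, y * ((r - μ) / (g * k)) = y / k * (r - μ) / g := fun r => by
    simp only [div_eq_mul_inv, mul_inv]; ring
  rw [cgf, mgf]
  simp_rw [h]
  rw [integral_eq_lintegral_of_nonneg_ae (ae_of_all _ fun r => (Real.exp_pos _).le) (by fun_prop),
    lintegral_exp_glmLaw hν, ENNReal.toReal_ofReal (Real.exp_pos _).le, Real.log_exp]

/-- The maximal inequality for a self-concordant exponential family, with the quadratic
regularization and the logarithmic compensator of the online-mirror-descent analysis. -/
lemma lintegral_iSup_compensated_density_le (hm : RegularLogPartition m) (hg : 0 < g)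
    (hν : IsLogPartition m ν g) {R h η a s : ℝ} (hR : 0 ≤ R) (hη : 1 ≤ η) (hs : 0 < s)
    (hsc : ∀ z ∈ Set.Icc (-h) h, |deriv (deriv (deriv m)) z| ≤ R * deriv (deriv m) z)
    (ha : a ∈ Set.Icc (-h) h) (hRs : R ^ 2 * s ≤ 3 / 28)
    (hτ : (η - 1) * (deriv (deriv m) a / g * s) ≤ 1 / 4) :
    ∫⁻ r, ⨆ b ∈ Set.Icc (-h) h, ENNReal.ofReal (Real.exp ((r * b - m b) / g - (b - a) ^ 2 / (2 * s)
      - (3 * η + 1 / 2) * Real.log (1 + deriv (deriv m) b / g * s / (1.5 * η)))) ∂ν ≤ 1 := by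
  have := hν a
  have hv : 0 ≤ deriv (deriv m) a / g := div_nonneg (hm.deriv_two_nonneg a) hg.le
  obtain ⟨ι, hι0, hι, hfin⟩ := exists_exp_compensator_ge hη (mul_nonneg hv hs.le) hτ
    (mul_nonneg (sq_nonneg R) hs.le) hRs
  set u := deriv (deriv m) a / g * s / (1.5 * η) with hu
  set K := 3 * η + 1 / 2 with hK
  set J := (K * u / (1 + u)) ^ 2 * (R ^ 2 * s) / (2 * ι) with hJ
  have hu0 : 0 ≤ u := by positivity
  have hK0 : 0 < K := by positivity
  -- The quadratic penalty is divided: the share `1 - ι` becomes `y²/2` under `y = k (b - a)`, and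
  -- the share `ι` pays for replacing `b` by `a` in the compensator.
  set c := (1 - ι) / s with hc
  have hc0 : 0 < c := div_pos (by linarith) hs
  set k := √c with hk
  have hk0 : 0 < k := Real.sqrt_pos.2 hc0
  have hk2 : k ^ 2 = c := Real.sq_sqrt hc0.le
  set μ := deriv m a with hμ
  set Q := glmLaw m ν g a with hQ
  set X : ℝ → ℝ := fun r => (r - μ) / (g * k) with hXdef
  have hX : ∀ t, Integrable (fun r => Real.exp (t * X r)) Q := by
    intro t
    have := integrable_exp_glmLaw hν a (t / k) μ
    refine this.congr (ae_of_all _ fun r => ?_)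
    simp only [hXdef, div_eq_mul_inv, mul_inv]; ring_nf
  have hcgf : cgf X Q = fun y => (m (a + y / k) - m a - μ * (y / k)) / g := by
    ext y; exact cgf_glmLaw hν a μ k y
  have hlin : ∀ y : ℝ, HasDerivAt (fun y => a + y / k) (1 / k) y := fun y =>
    ((hasDerivAt_id y).div_const k).const_add a
  have hd1 : ∀ y, HasDerivAt (cgf X Q) ((deriv m (a + y / k) - μ) / (g * k)) y := by
    intro y
    rw [hcgf]
    have h1 := (hm.differentiable₁ (a + y / k)).hasDerivAt.comp y (hlin y)
    have h2 := ((h1.sub_const (m a)).sub (((hasDerivAt_id y).div_const k).const_mul μ)).div_const g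
    convert! h2 using 1
    field_simp
  have hderiv : deriv (cgf X Q) = fun y => (deriv m (a + y / k) - μ) / (g * k) := by
    ext y; exact (hd1 y).deriv
  have hd2 : ∀ y, iteratedDeriv 2 (cgf X Q) y = deriv (deriv m) (a + y / k) / (g * c) := by
    intro y
    rw [iteratedDeriv_succ, iteratedDeriv_one, hderiv]
    have h1 := (((hm.differentiable₂ (a + y / k)).hasDerivAt.comp y (hlin y)).sub_const μ).div_const
      (g * k)
    have h2 := h1.deriv
    rw [← hk2]
    refine h2.trans ?_
    field_simp
  have hmean : ∫ r, X r ∂Q = 0 := by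
    have h1 := deriv_cgf_zero (mem_interior_integrableExpSet hX 0)
    rw [hderiv] at h1
    simp [← hμ] at h1
    exact h1.symm
  -- Since `1 - ι ≥ 0.65`, the square is at most `(3/28)/0.65`, below `0.41²`.
  have hRk : R / k ≤ 0.41 := by
    rw [div_le_iff₀ hk0]
    have : R ^ 2 ≤ (0.41 * k) ^ 2 := by
      rw [mul_pow, hk2, hc, mul_div_assoc', le_div_iff₀ hs]
      nlinarith
    exact (abs_le_of_sq_le_sq' this (by positivity)).2
  have hA := lintegral_iSup_exp_le (Q := Q) (X := X) (R := R / k)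
    (v := deriv (deriv m) a / (g * c)) (Y₁ := k * (a + h)) (Y₂ := k * (h - a))
    (by fun_prop) hX hmean (by positivity) hRk (mul_nonneg hk0.le (by linarith [ha.1]))
    (mul_nonneg hk0.le (by linarith [ha.2])) (fun t ht => by
      rw [hd2]
      have h1 : t / k ≤ h - a := by rw [div_le_iff₀ hk0]; linarith [ht.2]
      have h2 : -(a + h) ≤ t / k := by rw [le_div_iff₀ hk0]; linarith [ht.1]
      have := deriv_two_le_mul_exp hm hsc ha (b := a + t / k) ⟨by linarith, by linarith⟩
      rw [add_sub_cancel_left, abs_div, abs_of_pos hk0, mul_div_assoc', mul_comm R,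
        mul_div_assoc, mul_comm |t|] at this
      rw [div_mul_eq_mul_div]
      gcongr)
  have hcomp : ∀ b ∈ Set.Icc (-h) h, K * Real.log (1 + u) - J - ι * (b - a) ^ 2 / (2 * s)
      ≤ K * Real.log (1 + deriv (deriv m) b / g * s / (1.5 * η)) := by
    intro b hb
    have h1 := deriv_two_le_mul_exp hm hsc hb ha
    rw [abs_sub_comm] at h1
    have h2 : u * Real.exp (-(R * |b - a|)) ≤ deriv (deriv m) b / g * s / (1.5 * η) := by
      rw [Real.exp_neg, mul_inv_le_iff₀ (Real.exp_pos _), hu]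
      calc deriv (deriv m) a / g * s / (1.5 * η)
          ≤ deriv (deriv m) b * Real.exp (R * |b - a|) / g * s / (1.5 * η) := by gcongr
        _ = _ := by ring
    have h3 : Real.log (1 + u * Real.exp (-(R * |b - a|)))
        ≤ Real.log (1 + deriv (deriv m) b / g * s / (1.5 * η)) := by
      gcongr
    have h4 := (log_sub_mul_le_log_one_add_mul_exp (x := R * |b - a|) hu0).trans h3
    have h5 := mul_le_mul_of_nonneg_left h4 hK0.le
    -- Completing the square; `J` is exactly the leftover constant.
    have h6 : K * (u / (1 + u) * (R * |b - a|)) ≤ J + ι * (b - a) ^ 2 / (2 * s) := by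
      have e : J + ι * (b - a) ^ 2 / (2 * s) - K * (u / (1 + u) * (R * |b - a|))
          = (K * u / (1 + u) * R * s - ι * |b - a|) ^ 2 / (2 * ι * s) := by
        rw [hJ, ← sq_abs (b - a)]
        field_simp
        ring
      have : 0 ≤ (K * u / (1 + u) * R * s - ι * |b - a|) ^ 2 / (2 * ι * s) := by positivity
      linarith
    linarith
  set S : ℝ → ENNReal := fun r => ⨆ y ∈ Set.Icc (-(k * (a + h))) (k * (h - a)),
    ENNReal.ofReal (Real.exp (y * X r - cgf X Q y - y ^ 2 / 2)) with hS
  have hpt : ∀ r, (⨆ b ∈ Set.Icc (-h) h, ENNReal.ofReal (Real.exp ((r * b - m b) / g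
      - (b - a) ^ 2 / (2 * s) - K * Real.log (1 + deriv (deriv m) b / g * s / (1.5 * η)))))
      ≤ ENNReal.ofReal (Real.exp ((r * a - m a) / g)) *
        (ENNReal.ofReal (Real.exp (-(K * Real.log (1 + u) - J))) * S r) := by
    intro r
    refine iSup₂_le fun b hb => ?_
    have hy : k * (b - a) ∈ Set.Icc (-(k * (a + h))) (k * (h - a)) :=
      ⟨by nlinarith [hb.1], by nlinarith [hb.2]⟩
    have hSr : ENNReal.ofReal (Real.exp (k * (b - a) * X r - cgf X Q (k * (b - a))
        - (k * (b - a)) ^ 2 / 2)) ≤ S r :=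
      le_iSup₂ (f := fun y (_ : y ∈ Set.Icc (-(k * (a + h))) (k * (h - a))) =>
        ENNReal.ofReal (Real.exp (y * X r - cgf X Q y - y ^ 2 / 2))) _ hy
    refine le_trans ?_ (mul_le_mul_right (mul_le_mul_right hSr _) _)
    rw [← ENNReal.ofReal_mul (Real.exp_pos _).le, ← ENNReal.ofReal_mul (Real.exp_pos _).le,
      ← Real.exp_add, ← Real.exp_add]
    refine ENNReal.ofReal_le_ofReal (Real.exp_le_exp.2 ?_)
    rw [hcgf]
    simp only [hXdef]
    have e1 : k * (b - a) / k = b - a := by field_simp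
    have e2 : k * (b - a) * ((r - μ) / (g * k)) = (b - a) * (r - μ) / g := by field_simp
    have e3 : (k * (b - a)) ^ 2 / 2 = (b - a) ^ 2 / (2 * s) - ι * (b - a) ^ 2 / (2 * s) := by
      rw [mul_pow, hk2, hc]; field_simp
    have e4 : (r * b - m b) / g = (r * a - m a) / g + ((b - a) * (r - μ) / g
        - (m b - m a - μ * (b - a)) / g) := by ring
    rw [e1, e2, e3, add_sub_cancel, e4]
    have := hcomp b hb
    linarith
  calc _ ≤ ∫⁻ r, ENNReal.ofReal (Real.exp ((r * a - m a) / g)) *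
        (ENNReal.ofReal (Real.exp (-(K * Real.log (1 + u) - J))) * S r) ∂ν := lintegral_mono hpt
    _ = ENNReal.ofReal (Real.exp (-(K * Real.log (1 + u) - J))) * ∫⁻ r, S r ∂Q := by
        rw [← lintegral_glmLaw, lintegral_const_mul' _ _ ENNReal.ofReal_ne_top]
    _ ≤ ENNReal.ofReal (Real.exp (-(K * Real.log (1 + u) - J))) *
        ENNReal.ofReal (Real.exp (K * Real.log (1 + u) - J)) := by
        gcongr
        refine hA.trans (ENNReal.ofReal_le_ofReal (le_trans (le_of_eq ?_) hfin))
        rw [hc]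
        have : 1 - ι ≠ 0 := by linarith
        field_simp
    _ = 1 := by
        rw [← ENNReal.ofReal_mul (Real.exp_pos _).le, ← Real.exp_add]; simp

/-- The conditional expectation bound for one round of the algorithm: `a` is the current linear
prediction, `z` the true natural parameter, `w` the confidence weight, and `σ` the squared
Mahalanobis norm of the arm. -/
lemma lintegral_iSup_roundFactor_le (hm : RegularLogPartition m) (hg : 0 < g)
    (hν : IsLogPartition m ν g) {R h η a σ w : ℝ} (z : ℝ) (hR : 0 ≤ R) (hη : 1 ≤ η) (hσ : 0 < σ)
    (hw : 0 < w) (hw1 : w ≤ 1)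
    (hsc : ∀ z ∈ Set.Icc (-h) h, |deriv (deriv (deriv m)) z| ≤ R * deriv (deriv m) z)
    (ha : a ∈ Set.Icc (-h) h) (hRs : R ^ 2 * (1.5 * η * (w * σ)) ≤ 3 / 28)
    (hτ : (η - 1) * (deriv (deriv m) a / g * (1.5 * η * (w * σ))) ≤ 1 / 4) :
    ∫⁻ r, ⨆ b ∈ Set.Icc (-h) h, ENNReal.ofReal (Real.exp (w * (m z - r * z) / g
      - w * (m b - r * b) / g - (b - a) ^ 2 / (3 * η * σ)
      - (3 * η + 1 / 2) * Real.log (1 + w / g * deriv (deriv m) b * σ))) ∂(glmLaw m ν g z) ≤ 1 := by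
  have := hν z
  -- With this `s`, multiplying `(b - a)²/(2s)` by `w` returns the penalty `(b - a)²/(3ησ)`. The log
  -- term shrinks under multiplication by `w ≤ 1`, which is the favourable direction.
  set s := 1.5 * η * (w * σ) with hs
  have hs0 : 0 < s := by positivity
  set E : ℝ → ℝ → ℝ := fun r b => (r * b - m b) / g - (b - a) ^ 2 / (2 * s)
      - (3 * η + 1 / 2) * Real.log (1 + deriv (deriv m) b / g * s / (1.5 * η)) with hE
  set G : ℝ → ENNReal := fun r => ⨆ b ∈ Set.Icc (-h) h, ENNReal.ofReal (Real.exp (E r b)) with hG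
  have hB : ∫⁻ r, G r ∂ν ≤ 1 := lintegral_iSup_compensated_density_le hm hg hν hR hη hs0 hsc ha hRs hτ
  have hpt : ∀ r, (⨆ b ∈ Set.Icc (-h) h, ENNReal.ofReal (Real.exp (w * (m z - r * z) / g
      - w * (m b - r * b) / g - (b - a) ^ 2 / (3 * η * σ)
      - (3 * η + 1 / 2) * Real.log (1 + w / g * deriv (deriv m) b * σ))))
      ≤ ENNReal.ofReal w * (ENNReal.ofReal (Real.exp (-((r * z - m z) / g))) * G r)
        + ENNReal.ofReal (1 - w) := by
    intro r
    refine iSup₂_le fun b hb => ?_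
    have hGr : ENNReal.ofReal (Real.exp (E r b)) ≤ G r :=
      le_iSup₂ (f := fun b (_ : b ∈ Set.Icc (-h) h) => ENNReal.ofReal (Real.exp (E r b))) b hb
    refine le_trans ?_ (add_le_add_left (mul_le_mul_right (mul_le_mul_right hGr _) _) _)
    rw [← ENNReal.ofReal_mul (Real.exp_pos _).le, ← Real.exp_add, ← ENNReal.ofReal_mul hw.le,
      ← ENNReal.ofReal_add (by positivity) (by linarith)]
    refine ENNReal.ofReal_le_ofReal (le_trans (Real.exp_le_exp.2 ?_) (exp_mul_le_add hw.le hw1))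
    have hl : 0 ≤ Real.log (1 + w / g * deriv (deriv m) b * σ) := by
      refine Real.log_nonneg ?_
      have := hm.deriv_two_nonneg b
      have : 0 ≤ w / g * deriv (deriv m) b * σ := by positivity
      linarith
    have e1 : deriv (deriv m) b / g * s / (1.5 * η) = w / g * deriv (deriv m) b * σ := by
      rw [hs]; field_simp
    have e2 : w * ((b - a) ^ 2 / (2 * s)) = (b - a) ^ 2 / (3 * η * σ) := by
      rw [hs]; field_simp; norm_num; ring
    simp only [hE, e1]
    have e3 : w * (-((r * z - m z) / g) + ((r * b - m b) / g - (b - a) ^ 2 / (2 * s)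
      - (3 * η + 1 / 2) * Real.log (1 + w / g * deriv (deriv m) b * σ)))
      = w * (m z - r * z) / g - w * (m b - r * b) / g - w * ((b - a) ^ 2 / (2 * s))
        - w * ((3 * η + 1 / 2) * Real.log (1 + w / g * deriv (deriv m) b * σ)) := by ring
    rw [e3, e2]
    have : w * ((3 * η + 1 / 2) * Real.log (1 + w / g * deriv (deriv m) b * σ))
        ≤ (3 * η + 1 / 2) * Real.log (1 + w / g * deriv (deriv m) b * σ) :=
      mul_le_of_le_one_left (by positivity) hw1
    linarith
  refine (lintegral_mono hpt).trans ?_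
  rw [lintegral_add_right _ measurable_const, lintegral_const_mul' _ _ ENNReal.ofReal_ne_top,
    lintegral_const, measure_univ, mul_one, lintegral_glmLaw]
  -- The likelihood at the true parameter cancels the density of the reward, so the bound no longer
  -- involves `z`.
  have : ∀ r, ENNReal.ofReal (Real.exp ((r * z - m z) / g)) *
      (ENNReal.ofReal (Real.exp (-((r * z - m z) / g))) * G r) = G r := by
    intro r
    rw [← mul_assoc, ← ENNReal.ofReal_mul (Real.exp_pos _).le, ← Real.exp_add]
    simp
  simp_rw [this]
  calc _ ≤ ENNReal.ofReal w * 1 + ENNReal.ofReal (1 - w) := by gcongr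
    _ = 1 := by
        rw [mul_one, ← ENNReal.ofReal_add hw.le (by linarith)]; simp

end ExponentialFamily

/-! ### Bregman lower bound and Taylor remainder -/

section SecondOrder

lemma nonneg_of_second_deriv_nonneg {f f' f'' : ℝ → ℝ} {T : ℝ} (hT : 0 ≤ T)
    (h1 : ∀ t, HasDerivAt f (f' t) t) (h2 : ∀ t, HasDerivAt f' (f'' t) t)
    (hf0 : 0 ≤ f 0) (hf'0 : 0 ≤ f' 0) (h : ∀ t ∈ Set.Icc 0 T, 0 ≤ f'' t) : 0 ≤ f T := by
  have hmono' : MonotoneOn f' (Set.Icc 0 T) :=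
    monotoneOn_of_deriv_nonneg (convex_Icc _ _)
      (fun x _ => (h2 x).continuousAt.continuousWithinAt)
      (fun x _ => (h2 x).differentiableAt.differentiableWithinAt)
      fun x hx => (h2 x).deriv ▸ h x (interior_subset hx)
  have hmono : MonotoneOn f (Set.Icc 0 T) :=
    monotoneOn_of_deriv_nonneg (convex_Icc _ _)
      (fun x _ => (h1 x).continuousAt.continuousWithinAt)
      (fun x _ => (h1 x).differentiableAt.differentiableWithinAt)
      fun x hx => (h1 x).deriv ▸ hf'0.trans (hmono' (by simp [hT]) (interior_subset hx)
        (interior_subset hx).1)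
  exact hf0.trans (hmono (by simp [hT]) (by simp [hT]) hT)

/-- Parametrizing a segment as `a + ε t` with `t ≥ 0` treats both directions by a single one-sided
argument. -/
lemma exists_sign_mul (y : ℝ) : ∃ ε : ℝ, ε * ε = 1 ∧ y = ε * |y| := by
  rcases le_total 0 y with h | h
  · exact ⟨1, by norm_num, by rw [abs_of_nonneg h]; ring⟩
  · exact ⟨-1, by norm_num, by rw [abs_of_nonpos h]; ring⟩

lemma add_sign_mul_mem_Icc {h a b ε t : ℝ} (hε : ε * ε = 1) (hb : b = a + ε * |b - a|)
    (ha : a ∈ Set.Icc (-h) h) (hbm : b ∈ Set.Icc (-h) h) (ht : t ∈ Set.Icc 0 |b - a|) :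
    a + ε * t ∈ Set.Icc (-h) h := by
  have hε' : ε = 1 ∨ ε = -1 := mul_self_eq_one_iff.1 hε
  rcases hε' with rfl | rfl
  · exact ⟨by linarith [ha.1, ht.1], by linarith [hbm.2, ht.2]⟩
  · exact ⟨by linarith [hbm.1, ht.2], by linarith [ha.2, ht.1]⟩

lemma sq_div_two_add_le {u : ℝ} (hu : 0 ≤ u) : u ^ 2 / (2 + u) ≤ Real.exp (-u) - 1 + u := by
  -- The bound `2x/(x + 2) ≤ log (1 + x)` at `x = e^u - 1` reads `2(e^u - 1)/(e^u + 1) ≤ u`.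
  have h1 := Real.le_log_one_add_of_nonneg (x := Real.exp u - 1) (by linarith [Real.add_one_le_exp u])
  rw [add_sub_cancel, Real.log_exp, div_le_iff₀ (by linarith [Real.exp_pos u])] at h1
  rw [div_le_iff₀ (by positivity), Real.exp_neg]
  have he := Real.exp_pos u
  have h2 : 2 - u ≤ (2 + u) * (Real.exp u)⁻¹ := by
    rw [← div_eq_mul_inv, le_div_iff₀ he]
    linarith
  nlinarith

variable {m : ℝ → ℝ}

/-- Self-concordance on `[-h, h]` yields a quadratic lower bound for the Bregman divergence. -/
lemma bregman_ge (hm : RegularLogPartition m) {R h S : ℝ} (hR : 0 ≤ R) (hhS : h ≤ S)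
    (hsc : ∀ z ∈ Set.Icc (-h) h, |deriv (deriv (deriv m)) z| ≤ R * deriv (deriv m) z)
    {b z : ℝ} (hb : b ∈ Set.Icc (-h) h) (hz : z ∈ Set.Icc (-h) h) :
    m b + deriv m b * (z - b) + deriv (deriv m) b * (z - b) ^ 2 / (2 * (1 + R * S)) ≤ m z := by
  obtain ⟨ε, hε, hy⟩ := exists_sign_mul (z - b)
  set T := |z - b| with hT
  have hT0 : 0 ≤ T := abs_nonneg _
  have hzb : z = b + ε * T := by linarith
  have hv := hm.deriv_two_nonneg b
  have hlin : ∀ t : ℝ, HasDerivAt (fun t => b + ε * t) ε t := fun t => by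
    simpa using ((hasDerivAt_id t).const_mul ε).const_add b
  have hS : 0 ≤ S := by linarith [hb.1, hb.2]
  have hTS : T ≤ 2 * S := by
    rw [hT, abs_le]; exact ⟨by linarith [hb.2, hz.1], by linarith [hb.1, hz.2]⟩
  have hsq : (z - b) ^ 2 = T ^ 2 := by rw [hT, sq_abs]
  have main : ∀ φ φ' φ'' : ℝ → ℝ, (∀ t, HasDerivAt φ (φ' t) t) → (∀ t, HasDerivAt φ' (φ'' t) t) →
      φ 0 = 0 → φ' 0 = 0 → (∀ t ∈ Set.Icc 0 T, φ'' t ≤ Real.exp (-(R * t))) →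
      m b + deriv m b * (z - b) + deriv (deriv m) b * φ T ≤ m z := by
    intro φ φ' φ'' h1 h2 hφ hφ' hle
    have := nonneg_of_second_deriv_nonneg (T := T)
      (f := fun t => m (b + ε * t) - (m b + deriv m b * (ε * t)) - deriv (deriv m) b * φ t)
      (f' := fun t => deriv m (b + ε * t) * ε - deriv m b * ε - deriv (deriv m) b * φ' t)
      (f'' := fun t => deriv (deriv m) (b + ε * t) - deriv (deriv m) b * φ'' t) hT0
      (fun t => by
        have g1 := (hm.differentiable₁ (b + ε * t)).hasDerivAt.comp t (hlin t)
        have g2 := (((hasDerivAt_id t).const_mul ε).const_mul (deriv m b)).const_add (m b)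
        convert! (g1.sub g2).sub ((h1 t).const_mul (deriv (deriv m) b)) using 1
        simp)
      (fun t => by
        have g1 := ((hm.differentiable₂ (b + ε * t)).hasDerivAt.comp t (hlin t)).mul_const ε
        convert! (g1.sub_const (deriv m b * ε)).sub ((h2 t).const_mul (deriv (deriv m) b)) using 1
        rw [mul_assoc, hε, mul_one])
      (by simp [hφ]) (by simp [hφ'])
      (fun t ht => by
        have hbt := add_sign_mul_mem_Icc hε hzb hb hz ht
        have g := deriv_two_le_mul_exp hm hsc hbt hb
        have hε1 : |ε| = 1 := by
          rw [← sq_eq_sq₀ (abs_nonneg _) zero_le_one, sq_abs, sq, hε, one_pow]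
        rw [show b - (b + ε * t) = -(ε * t) by ring, abs_neg, abs_mul, hε1, one_mul,
          abs_of_nonneg ht.1] at g
        have g2 := mul_le_mul_of_nonneg_left (hle t ht) hv
        rw [Real.exp_neg] at g2
        have g3 : deriv (deriv m) b * (Real.exp (R * t))⁻¹ ≤ deriv (deriv m) (b + ε * t) := by
          rwa [mul_inv_le_iff₀ (Real.exp_pos _)]
        linarith)
    rw [← hy, add_sub_cancel] at this
    linarith
  have hη : 0 < 1 + R * S := by positivity
  rcases hR.eq_or_lt with hR0 | hRpos
  · have := main (fun t => t ^ 2 / 2) (fun t => t) (fun _ => 1)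
      (fun t => by
        convert! ((hasDerivAt_id t).pow 2).div_const 2 using 1
        simp) (fun t => hasDerivAt_id t) (by simp) rfl (fun t _ => by simp [← hR0])
    rw [← hR0, hsq]
    refine le_trans (le_of_eq ?_) this
    ring
  · have := main (fun t => (Real.exp (-(R * t)) - 1 + R * t) / R ^ 2)
      (fun t => (1 - Real.exp (-(R * t))) / R) (fun t => Real.exp (-(R * t)))
      (fun t => by
        have g := ((hasDerivAt_id t).const_mul R).neg.exp
        convert! ((g.sub_const 1).add ((hasDerivAt_id t).const_mul R)).div_const (R ^ 2) using 1
        field_simp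
        simp
        ring)
      (fun t => by
        have g := ((hasDerivAt_id t).const_mul R).neg.exp
        convert! (g.const_sub 1).div_const R using 1
        field_simp
        simp)
      (by simp) (by simp) (fun t _ => le_rfl)
    refine le_trans ?_ this
    have h1 := sq_div_two_add_le (mul_nonneg hR hT0)
    -- The origin of `η = 1 + RS`: both points lie within `2S` of each other, so `2 + RT ≤ 2(1 +
    -- RS)`.
    have h2 : T ^ 2 / (2 * (1 + R * S)) ≤ (Real.exp (-(R * T)) - 1 + R * T) / R ^ 2 := by
      rw [le_div_iff₀ (by positivity)]
      refine le_trans ?_ h1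
      rw [div_mul_eq_mul_div, show T ^ 2 * R ^ 2 = (R * T) ^ 2 by ring]
      gcongr
      nlinarith
    have h3 := mul_le_mul_of_nonneg_left h2 hv
    rw [hsq, mul_div_assoc]
    linarith

lemma abs_deriv_remainder_le (hm : RegularLogPartition m) {R L h : ℝ} (hR : 0 ≤ R)
    (hL : ∀ z ∈ Set.Icc (-h) h, deriv (deriv m) z ≤ L)
    (hsc : ∀ z ∈ Set.Icc (-h) h, |deriv (deriv (deriv m)) z| ≤ R * deriv (deriv m) z)
    {a b : ℝ} (ha : a ∈ Set.Icc (-h) h) (hb : b ∈ Set.Icc (-h) h) :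
    |deriv m b - deriv m a - deriv (deriv m) a * (b - a)| ≤ R * L * (b - a) ^ 2 / 2 := by
  obtain ⟨ε, hε, hy⟩ := exists_sign_mul (b - a)
  set T := |b - a| with hT
  have hT0 : 0 ≤ T := abs_nonneg _
  have hba : b = a + ε * T := by linarith
  have hsq : (b - a) ^ 2 = T ^ 2 := by rw [hT, sq_abs]
  have hlin : ∀ t : ℝ, HasDerivAt (fun t => a + ε * t) ε t := fun t => by
    simpa using ((hasDerivAt_id t).const_mul ε).const_add a
  have main : ∀ ς : ℝ, ς * ς = 1 →
      0 ≤ R * L * (b - a) ^ 2 / 2 + ς * (deriv m b - deriv m a - deriv (deriv m) a * (b - a)) := by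
    intro ς hς
    have hς1 : |ς| = 1 := by
      rw [← sq_eq_sq₀ (abs_nonneg _) zero_le_one, sq_abs, sq, hς, one_pow]
    have := nonneg_of_second_deriv_nonneg (T := T)
      (f := fun t => R * L * (t ^ 2 / 2)
        + ς * (deriv m (a + ε * t) - (deriv m a + deriv (deriv m) a * (ε * t))))
      (f' := fun t => R * L * t
        + ς * (deriv (deriv m) (a + ε * t) * ε - deriv (deriv m) a * ε))
      (f'' := fun t => R * L + ς * deriv (deriv (deriv m)) (a + ε * t)) hT0
      (fun t => by
        have g1 := (hm.differentiable₂ (a + ε * t)).hasDerivAt.comp t (hlin t)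
        have g2 := (((hasDerivAt_id t).const_mul ε).const_mul (deriv (deriv m) a)).const_add
          (deriv m a)
        convert! ((((hasDerivAt_id t).pow 2).div_const 2).const_mul (R * L)).add
          ((g1.sub g2).const_mul ς) using 1
        simp)
      (fun t => by
        have g1 := ((hm.differentiable₃ (a + ε * t)).hasDerivAt.comp t (hlin t)).mul_const ε
        convert! ((hasDerivAt_id t).const_mul (R * L)).add
          ((g1.sub_const (deriv (deriv m) a * ε)).const_mul ς) using 1
        rw [mul_assoc _ ε ε, hε, mul_one, mul_one])
      (by simp) (by simp)
      (fun t ht => by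
        have hmem := add_sign_mul_mem_Icc hε hba ha hb ht
        have g := (hsc _ hmem).trans (mul_le_mul_of_nonneg_left (hL _ hmem) hR)
        have g2 : |ς * deriv (deriv (deriv m)) (a + ε * t)| ≤ R * L := by
          rwa [abs_mul, hς1, one_mul]
        linarith [(abs_le.1 g2).1])
    rw [← hy, add_sub_cancel] at this
    rw [hsq]
    linarith
  rw [abs_le]
  exact ⟨by linarith [main 1 (by norm_num)], by linarith [main (-1) (by norm_num)]⟩

end SecondOrder

/-! ### Gradient and Hessian of the weighted loss -/

section Ridge

variable {d : ℕ}

lemma hasFDerivAt_ridge {φ : ℝ → ℝ} (hφ : Differentiable ℝ φ) (x θ : Vec d) :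
    HasFDerivAt (fun θ : Vec d => φ (inner ℝ x θ)) (deriv φ (inner ℝ x θ) • innerSL ℝ x) θ :=
  (hφ (inner ℝ x θ)).hasDerivAt.comp_hasFDerivAt (f := fun θ : Vec d => inner ℝ x θ) θ
    ((innerSL ℝ x).hasFDerivAt)

lemma gradient_ridge {φ : ℝ → ℝ} (hφ : Differentiable ℝ φ) (x θ : Vec d) :
    gradient (fun θ : Vec d => φ (inner ℝ x θ)) θ = deriv φ (inner ℝ x θ) • x := by
  refine HasGradientAt.gradient ?_
  rw [hasGradientAt_iff_hasFDerivAt]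
  convert! hasFDerivAt_ridge hφ x θ using 1
  ext v
  simp

lemma hessian_ridge {φ : ℝ → ℝ} (hφ : Differentiable ℝ φ) (hφ' : Differentiable ℝ (deriv φ))
    (x θ : Vec d) : hessian (fun θ : Vec d => φ (inner ℝ x θ)) θ
      = deriv (deriv φ) (inner ℝ x θ) • Matrix.vecMulVec x.ofLp x.ofLp := by
  have h1 : fderiv ℝ (fun θ : Vec d => φ (inner ℝ x θ))
      = fun θ => deriv φ (inner ℝ x θ) • innerSL ℝ x := by
    ext1 θ; exact (hasFDerivAt_ridge hφ x θ).fderiv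
  have h2 := (hasFDerivAt_ridge hφ' x θ).smul_const (innerSL ℝ x)
  ext i j
  rw [hessian, Matrix.of_apply, iteratedFDeriv_two_apply, h1, h2.fderiv]
  simp [Matrix.vecMulVec_apply, EuclideanSpace.inner_single_right]
  ring

lemma weightedLoss_eq (m : ℝ → ℝ) (α γ : ℝ) (H : Matrix (Fin d) (Fin d) ℝ) (x : Vec d) (r : ℝ) :
    weightedLoss m α γ H x r = fun θ => (fun z => confWeight α γ H x * (m z - r * z) / γ)
      (inner ℝ x θ) := rfl

variable {m : ℝ → ℝ}

lemma hasDerivAt_weighted (hm : RegularLogPartition m) (w γ r z : ℝ) :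
    HasDerivAt (fun z => w * (m z - r * z) / γ) (w / γ * (deriv m z - r)) z := by
  convert! (((hm.differentiable₁ z).hasDerivAt.sub ((hasDerivAt_id z).const_mul r)).const_mul
    w).div_const γ using 1
  simp; ring

lemma deriv_weighted (hm : RegularLogPartition m) (w γ r : ℝ) :
    deriv (fun z => w * (m z - r * z) / γ) = fun z => w / γ * (deriv m z - r) := by
  ext z; exact (hasDerivAt_weighted hm w γ r z).deriv

lemma hasDerivAt_deriv_weighted (hm : RegularLogPartition m) (w γ r z : ℝ) :
    HasDerivAt (fun z => w / γ * (deriv m z - r)) (w / γ * deriv (deriv m) z) z :=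
  (((hm.differentiable₂ z).hasDerivAt.sub_const r).const_mul (w / γ))

lemma gradient_weightedLoss (hm : RegularLogPartition m) (α γ : ℝ) (H : Matrix (Fin d) (Fin d) ℝ)
    (x : Vec d) (r : ℝ) (θ : Vec d) :
    gradient (weightedLoss m α γ H x r) θ
      = (confWeight α γ H x / γ * (deriv m (inner ℝ x θ) - r)) • x := by
  rw [weightedLoss_eq, gradient_ridge fun z => (hasDerivAt_weighted hm _ _ _ z).differentiableAt,
    deriv_weighted hm]

lemma hessian_weightedLoss (hm : RegularLogPartition m) (α γ : ℝ) (H : Matrix (Fin d) (Fin d) ℝ)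
    (x : Vec d) (r : ℝ) (θ : Vec d) :
    hessian (weightedLoss m α γ H x r) θ
      = (confWeight α γ H x / γ * deriv (deriv m) (inner ℝ x θ)) •
        Matrix.vecMulVec x.ofLp x.ofLp := by
  rw [weightedLoss_eq, hessian_ridge (fun z => (hasDerivAt_weighted hm _ _ _ z).differentiableAt),
    deriv_weighted hm, (hasDerivAt_deriv_weighted hm _ _ _ _).deriv]
  rw [deriv_weighted hm]
  exact fun z => (hasDerivAt_deriv_weighted hm _ _ _ z).differentiableAt

end Ridge

/-! ### Quadratic forms and determinants -/

section Quadratic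

variable {d : ℕ}

lemma inner_eq_dotProduct (x v : Vec d) : inner ℝ x v = x.ofLp ⬝ᵥ v.ofLp := by
  rw [EuclideanSpace.inner_eq_star_dotProduct, dotProduct_comm]; simp

lemma mahalanobis_sq {A : Matrix (Fin d) (Fin d) ℝ} (hA : A.PosSemidef) (v : Vec d) :
    mahalanobis A v ^ 2 = v.ofLp ⬝ᵥ (A *ᵥ v.ofLp) := by
  have := hA.dotProduct_mulVec_nonneg v.ofLp
  exact Real.sq_sqrt (by simpa using this)

lemma dotProduct_mulVec_comm {A : Matrix (Fin d) (Fin d) ℝ} (hA : A.IsHermitian)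
    (u v : Fin d → ℝ) : u ⬝ᵥ (A *ᵥ v) = v ⬝ᵥ (A *ᵥ u) := by
  have hT : Aᵀ = A := by simpa using hA.eq
  rw [Matrix.dotProduct_mulVec, ← Matrix.mulVec_transpose, hT, dotProduct_comm]

lemma dotProduct_vecMulVec_mulVec (κ : ℝ) (x u v : Fin d → ℝ) :
    u ⬝ᵥ ((κ • Matrix.vecMulVec x x) *ᵥ v) = κ * (x ⬝ᵥ u) * (x ⬝ᵥ v) := by
  rw [Matrix.smul_mulVec, Matrix.vecMulVec_mulVec]
  simp [dotProduct_comm x u]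
  ring

lemma posSemidef_smul_vecMulVec {κ : ℝ} (hκ : 0 ≤ κ) (x : Fin d → ℝ) :
    (κ • Matrix.vecMulVec x x).PosSemidef := by
  have := Matrix.posSemidef_vecMulVec_self_star (R := ℝ) x
  simp only [star_trivial] at this
  exact this.smul hκ

/-- The Cauchy–Schwarz inequality for a positive definite form and its inverse. -/
lemma dotProduct_sq_le {A : Matrix (Fin d) (Fin d) ℝ} (hA : A.PosDef) (x v : Fin d → ℝ) :
    (x ⬝ᵥ v) ^ 2 ≤ (x ⬝ᵥ (A⁻¹ *ᵥ x)) * (v ⬝ᵥ (A *ᵥ v)) := by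
  have hdet : IsUnit A.det := hA.det_pos.ne'.isUnit
  set y := A⁻¹ *ᵥ x with hy
  have hAy : A *ᵥ y = x := by
    rw [hy, Matrix.mulVec_mulVec, Matrix.mul_nonsing_inv _ hdet, Matrix.one_mulVec]
  have hq : ∀ s : ℝ, 0 ≤ v ⬝ᵥ (A *ᵥ v) - 2 * s * (x ⬝ᵥ v) + s ^ 2 * (x ⬝ᵥ y) := by
    intro s
    have h0 := hA.posSemidef.dotProduct_mulVec_nonneg (v - s • y)
    rw [star_trivial, Matrix.mulVec_sub, Matrix.mulVec_smul, hAy, sub_dotProduct, dotProduct_sub,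
      dotProduct_sub, smul_dotProduct, smul_dotProduct, dotProduct_smul, dotProduct_smul,
      dotProduct_mulVec_comm hA.isHermitian y v, hAy, dotProduct_comm v x, dotProduct_comm y x] at h0
    simp only [smul_eq_mul] at h0
    nlinarith
  have hxy : 0 ≤ x ⬝ᵥ y := by
    have := hA.inv.posSemidef.dotProduct_mulVec_nonneg x
    simpa using this
  rcases hxy.eq_or_lt with h | h
  · rw [← h] at hq ⊢
    have h1 : x = 0 := by
      by_contra hx
      have := hA.inv.dotProduct_mulVec_pos hx
      simp only [star_trivial] at this
      linarith
    simp [h1]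
  · have := hq ((x ⬝ᵥ v) / (x ⬝ᵥ y))
    have e : v ⬝ᵥ (A *ᵥ v) - 2 * ((x ⬝ᵥ v) / (x ⬝ᵥ y)) * (x ⬝ᵥ v)
        + ((x ⬝ᵥ v) / (x ⬝ᵥ y)) ^ 2 * (x ⬝ᵥ y)
        = ((x ⬝ᵥ y) * (v ⬝ᵥ (A *ᵥ v)) - (x ⬝ᵥ v) ^ 2) / (x ⬝ᵥ y) := by
      field_simp; ring
    rw [e, div_nonneg_iff] at this
    rcases this with this | this <;> linarith

/-- With `y = A⁻¹ x`, the hypothesis gives `λ|y|² ≤ x·y`; expanding `|x - λy|² ≥ 0` yields `λ x·y ≤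
|x|²`. -/
lemma dotProduct_inv_mulVec_le {A : Matrix (Fin d) (Fin d) ℝ} (hA : A.PosDef) {lam : ℝ}
    (hlam : 0 < lam) (hle : ∀ v, lam * (v ⬝ᵥ v) ≤ v ⬝ᵥ (A *ᵥ v)) {x : Fin d → ℝ}
    (hx : x ⬝ᵥ x ≤ 1) : x ⬝ᵥ (A⁻¹ *ᵥ x) ≤ 1 / lam := by
  have hdet : IsUnit A.det := hA.det_pos.ne'.isUnit
  set y := A⁻¹ *ᵥ x with hy
  have hAy : A *ᵥ y = x := by
    rw [hy, Matrix.mulVec_mulVec, Matrix.mul_nonsing_inv _ hdet, Matrix.one_mulVec]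
  have h1 := hle y
  rw [hAy, dotProduct_comm y x] at h1
  have h2 : 0 ≤ (x - lam • y) ⬝ᵥ (x - lam • y) := by
    rw [dotProduct]; exact Finset.sum_nonneg fun i _ => mul_self_nonneg _
  simp only [sub_dotProduct, dotProduct_sub, smul_dotProduct, dotProduct_smul, smul_eq_mul,
    dotProduct_comm y x] at h2
  rw [le_div_iff₀ hlam]
  nlinarith

lemma det_add_smul_vecMulVec {A : Matrix (Fin d) (Fin d) ℝ} (hA : A.PosDef) (κ : ℝ)
    (x : Fin d → ℝ) :
    (A + κ • Matrix.vecMulVec x x).det = A.det * (1 + κ * (x ⬝ᵥ (A⁻¹ *ᵥ x))) := by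
  have hdet : IsUnit A.det := hA.det_pos.ne'.isUnit
  rw [← Matrix.smul_vecMulVec, Matrix.vecMulVec_eq Unit,
    Matrix.det_add_replicateCol_mul_replicateRow hdet, Matrix.det_unique (n := Unit), Matrix.add_apply,
    Matrix.one_apply_eq, Matrix.mul_assoc, ← Matrix.replicateCol_mulVec,
    Matrix.replicateRow_mul_replicateCol_apply, Matrix.mulVec_smul]
  simp

lemma det_le_pow {A : Matrix (Fin d) (Fin d) ℝ} (hA : A.PosSemidef) {U : ℝ}
    (hU : ∀ v, v ⬝ᵥ (A *ᵥ v) ≤ U * (v ⬝ᵥ v)) : A.det ≤ U ^ d := by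
  rw [hA.isHermitian.det_eq_prod_eigenvalues]
  calc _ ≤ ∏ _i : Fin d, U := by
        refine Finset.prod_le_prod (fun i _ => hA.eigenvalues_nonneg i) fun i _ => ?_
        have h1 := hA.isHermitian.eigenvalues_eq i
        have h2 := hU (hA.isHermitian.eigenvectorBasis i).ofLp
        have h3 : (hA.isHermitian.eigenvectorBasis i).ofLp ⬝ᵥ
            (hA.isHermitian.eigenvectorBasis i).ofLp = 1 := by
          rw [← inner_eq_dotProduct, real_inner_self_eq_norm_sq,
            hA.isHermitian.eigenvectorBasis.orthonormal.1 i, one_pow]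
        rw [h3, mul_one] at h2
        simp only [RCLike.re_to_real, star_trivial] at h1
        simpa [h1] using h2
    _ = U ^ d := by simp

end Quadratic

/-! ### First-order optimality of the mirror-descent step -/

section MirrorDescent

variable {d : ℕ}

lemma nonneg_of_forall_quadratic {A B : ℝ} (h : ∀ s ∈ Set.Ioc (0:ℝ) 1, 0 ≤ s * A + s ^ 2 * B) :
    0 ≤ A := by
  by_contra hA
  push Not at hA
  have h1 := h 1 (by simp)
  have hB : 0 < B := by linarith
  -- The minimizer of the quadratic; it lies in `(0, 1]` because `A + B ≥ 0` and `A < 0`.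
  have h2 := h (-A / (2 * B)) ⟨div_pos (by linarith) (by linarith), by
    rw [div_le_one (by linarith)]; linarith⟩
  have e : -A / (2 * B) * A + (-A / (2 * B)) ^ 2 * B = -(A ^ 2 / (4 * B)) := by
    field_simp; ring
  rw [e] at h2
  have : 0 < A ^ 2 / (4 * B) := div_pos (by nlinarith) (by linarith)
  linarith

/-- The first-order optimality condition of the mirror-descent step. -/
lemma omd_variational {ℓ : Vec d → ℝ} {η S p κ : ℝ} {H : Matrix (Fin d) (Fin d) ℝ}
    {θ₀ θ₁ θs x : Vec d} (hH : H.PosDef) (hκ : 0 ≤ κ)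
    (hgrad : gradient ℓ θ₀ = p • x) (hhess : hessian ℓ θ₀ = κ • Matrix.vecMulVec x.ofLp x.ofLp)
    (hmin : IsMinOn (omdObjective ℓ η H θ₀) (paramSet d S) θ₁)
    (h1 : θ₁ ∈ paramSet d S) (hs : θs ∈ paramSet d S) :
    0 ≤ p * inner ℝ x (θs - θ₁) + κ * inner ℝ x (θ₁ - θ₀) * inner ℝ x (θs - θ₁)
      + 1 / η * ((θ₁ - θ₀).ofLp ⬝ᵥ (H *ᵥ (θs - θ₁).ofLp)) := by
  have hconv : Convex ℝ (paramSet d S) := convex_closedBall _ _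
  have hobj : ∀ v : Vec d, omdObjective ℓ η H θ₀ (θ₀ + v) = p * inner ℝ x v
      + 1 / 2 * (κ * (inner ℝ x v) ^ 2) + 1 / (2 * η) * (v.ofLp ⬝ᵥ (H *ᵥ v.ofLp)) := by
    intro v
    rw [omdObjective, add_sub_cancel_left, hgrad, hhess, mahalanobis_sq hH.posSemidef,
      mahalanobis_sq (posSemidef_smul_vecMulVec hκ _), dotProduct_vecMulVec_mulVec,
      ← inner_eq_dotProduct, real_inner_smul_left]
    ring
  refine nonneg_of_forall_quadratic (B := 1 / 2 * (κ * (inner ℝ x (θs - θ₁)) ^ 2)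
    + 1 / (2 * η) * ((θs - θ₁).ofLp ⬝ᵥ (H *ᵥ (θs - θ₁).ofLp))) fun s hs01 => ?_
  have hmem : θ₁ + s • (θs - θ₁) ∈ paramSet d S :=
    hconv.add_smul_sub_mem h1 hs ⟨hs01.1.le, hs01.2⟩
  have := hmin hmem
  simp only [Set.mem_ofPred_eq] at this
  rw [show θ₁ + s • (θs - θ₁) = θ₀ + ((θ₁ - θ₀) + s • (θs - θ₁)) by abel,
    show omdObjective ℓ η H θ₀ θ₁ = omdObjective ℓ η H θ₀ (θ₀ + (θ₁ - θ₀)) by congr 1; abel,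
    hobj, hobj] at this
  simp only [inner_add_right, real_inner_smul_right, WithLp.ofLp_add, WithLp.ofLp_smul,
    Matrix.mulVec_add, Matrix.mulVec_smul, add_dotProduct, dotProduct_add, smul_dotProduct,
    dotProduct_smul, smul_eq_mul,
    dotProduct_mulVec_comm hH.isHermitian (θs - θ₁).ofLp (θ₁ - θ₀).ofLp] at this
  set a1 := inner ℝ x (θ₁ - θ₀)
  set a2 := inner ℝ x (θs - θ₁)
  set q0 := (θ₁ - θ₀).ofLp ⬝ᵥ (H *ᵥ (θ₁ - θ₀).ofLp)
  set q1 := (θ₁ - θ₀).ofLp ⬝ᵥ (H *ᵥ (θs - θ₁).ofLp)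
  set q2 := (θs - θ₁).ofLp ⬝ᵥ (H *ᵥ (θs - θ₁).ofLp)
  have e : 1 / η = 2 * (1 / (2 * η)) := by ring
  rw [e]
  set ζ := 1 / (2 * η)
  nlinarith

end MirrorDescent

/-! ### The deterministic recursion for one round -/

section Step

variable {d : ℕ}

/-- Self-concordance on all inner products of `x` with `Θ` is self-concordance on the interval
`[-S ‖x‖, S ‖x‖]`. -/
lemma SelfConcordantOn.of_mem_Icc {m : ℝ → ℝ} {arms : Set (Vec d)} {S L R : ℝ}
    (h : SelfConcordantOn m arms S L R) (hS : 0 ≤ S) {x : Vec d} (hx : x ∈ arms) {z : ℝ}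
    (hz : z ∈ Set.Icc (-(S * ‖x‖)) (S * ‖x‖)) :
    deriv (deriv m) z ≤ L ∧ |deriv (deriv (deriv m)) z| ≤ R * deriv (deriv m) z := by
  rcases eq_or_ne x 0 with h0 | h0
  · have hz0 : z = 0 := by
      rw [h0, norm_zero, mul_zero] at hz
      exact le_antisymm hz.2 (by simpa using hz.1)
    have := h x hx 0 (by simp [paramSet, hS])
    rwa [inner_zero_right, ← hz0] at this
  · have hn : 0 < ‖x‖ := norm_pos_iff.2 h0
    -- This multiple of `x` has inner product `z` with `x` and norm `|z|/‖x‖ ≤ S`.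
    have := h x hx ((z / ‖x‖ ^ 2) • x) (by
      rw [paramSet, mem_closedBall_zero_iff, norm_smul, Real.norm_eq_abs, abs_div,
        abs_of_pos (pow_pos hn 2), div_mul_eq_mul_div, div_le_iff₀ (pow_pos hn 2)]
      have := abs_le.2 hz
      nlinarith)
    rwa [real_inner_smul_right, real_inner_self_eq_norm_sq, div_mul_cancel₀ _ (pow_pos hn 2).ne']
      at this

lemma inner_mem_Icc {S : ℝ} (x : Vec d) {θ : Vec d} (hθ : θ ∈ paramSet d S) :
    inner ℝ x θ ∈ Set.Icc (-(S * ‖x‖)) (S * ‖x‖) := by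
  have h1 := abs_real_inner_le_norm x θ
  rw [paramSet, mem_closedBall_zero_iff] at hθ
  exact abs_le.1 (h1.trans (by rw [mul_comm]; gcongr))

lemma mahalanobis_inv_pos {H : Matrix (Fin d) (Fin d) ℝ} (hH : H.PosDef) {x : Vec d} (hx : x ≠ 0) :
    0 < mahalanobis H⁻¹ x := by
  refine Real.sqrt_pos.2 ?_
  have := hH.inv.dotProduct_mulVec_pos (x := x.ofLp) (fun h => hx (by ext i; simp [h]))
  simpa using this

lemma confWeight_mem {H : Matrix (Fin d) (Fin d) ℝ} (hH : H.PosDef) {α g : ℝ} (hα : 0 < α)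
    (hg : 0 < g) (x : Vec d) : 0 < confWeight α g H x ∧ confWeight α g H x ≤ 1 ∧
      confWeight α g H x * mahalanobis H⁻¹ x ≤ α * g := by
  rw [confWeight]
  split_ifs with h
  · refine ⟨one_pos, le_rfl, ?_⟩
    simp only [h, mahalanobis, WithLp.ofLp_zero, Matrix.mulVec_zero, dotProduct_zero,
      Real.sqrt_zero, mul_zero]
    positivity
  · have := mahalanobis_inv_pos hH h
    refine ⟨lt_min one_pos (by positivity), min_le_left _ _, ?_⟩
    refine (mul_le_mul_of_nonneg_right (min_le_right _ _) this.le).trans (le_of_eq ?_)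
    field_simp

variable {H : Matrix (Fin d) (Fin d) ℝ} {lam α g : ℝ} {x : Vec d}

lemma mahalanobis_inv_le (hH : H.PosDef) (hlam : 0 < lam)
    (hle : ∀ v, lam * (v ⬝ᵥ v) ≤ v ⬝ᵥ (H *ᵥ v)) (hx : ‖x‖ ≤ 1) :
    mahalanobis H⁻¹ x ^ 2 ≤ 1 / lam := by
  rw [mahalanobis_sq hH.inv.posSemidef]
  refine dotProduct_inv_mulVec_le hH hlam hle ?_
  rw [← inner_eq_dotProduct, real_inner_self_eq_norm_sq]
  nlinarith [norm_nonneg x]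

/-- The weighted leverage of an arm is controlled by the regularization. -/
lemma mul_weight_leverage_le (hH : H.PosDef) (hlam : 0 < lam)
    (hle : ∀ v, lam * (v ⬝ᵥ v) ≤ v ⬝ᵥ (H *ᵥ v)) (hx : ‖x‖ ≤ 1) (hα : 0 < α) (hg : 0 < g)
    {A : ℝ} (hA : 0 ≤ A) (hAlam : (A * α) ^ 2 ≤ lam) :
    A * (confWeight α g H x / g * mahalanobis H⁻¹ x ^ 2) ≤ 1 := by
  obtain ⟨hw0, hw1, hw⟩ := confWeight_mem hH hα hg x
  set w := confWeight α g H x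
  set σ := mahalanobis H⁻¹ x with hσ
  have hσ0 : 0 ≤ σ := Real.sqrt_nonneg _
  have h1 : w / g * σ ≤ α := by rw [div_mul_eq_mul_div, div_le_iff₀ hg]; exact hw
  have h2 := mahalanobis_inv_le hH hlam hle hx
  have h3 : (A * α * σ) ^ 2 ≤ 1 := by
    rw [mul_pow]
    calc _ ≤ lam * (1 / lam) := by gcongr
      _ = 1 := by field_simp
  have h4 : A * α * σ ≤ 1 := (sq_le_one_iff₀ (by positivity)).1 h3
  calc A * (w / g * σ ^ 2) = A * (w / g * σ) * σ := by ring
    _ ≤ A * α * σ := by gcongr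
    _ ≤ 1 := h4

/-- One step of online mirror descent: the squared distance to the comparator grows at most by the
loss gap of the new iterate, minus a quadratic stability term, plus the effect of the corruption. -/
lemma omd_step {m : ℝ → ℝ} (hm : RegularLogPartition m) {S R L r c : ℝ} (hg : 0 < g) (hα : 0 < α)
    (hR : 0 ≤ R) (hL : 0 < L) (hS : 0 < S) (hH : H.PosDef) (hlam : 0 < lam)
    (hlam2 : (6 * (1 + R * S) * R * L * S * α) ^ 2 ≤ lam)
    (hle : ∀ v, lam * (v ⬝ᵥ v) ≤ v ⬝ᵥ (H *ᵥ v)) (hx : ‖x‖ ≤ 1)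
    (hI : ∀ z ∈ Set.Icc (-(S * ‖x‖)) (S * ‖x‖),
      deriv (deriv m) z ≤ L ∧ |deriv (deriv (deriv m)) z| ≤ R * deriv (deriv m) z)
    {θ₀ θ₁ θs : Vec d} (h0 : θ₀ ∈ paramSet d S) (h1 : θ₁ ∈ paramSet d S) (hs : θs ∈ paramSet d S)
    (hmin : IsMinOn (omdObjective (weightedLoss m α g H x (r + c)) (1 + R * S) H θ₀)
      (paramSet d S) θ₁)
    {H' : Matrix (Fin d) (Fin d) ℝ} (hH' : H' = H + (confWeight α g H x / g *
      deriv (deriv m) (inner ℝ x θ₁)) • Matrix.vecMulVec x.ofLp x.ofLp) :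
    mahalanobis H' (θs - θ₁) ^ 2 ≤ mahalanobis H (θs - θ₀) ^ 2
      + 2 * (1 + R * S) * (confWeight α g H x * (m (inner ℝ x θs) - r * inner ℝ x θs) / g
        - confWeight α g H x * (m (inner ℝ x θ₁) - r * inner ℝ x θ₁) / g
        - (inner ℝ x θ₁ - inner ℝ x θ₀) ^ 2 / (3 * (1 + R * S) * mahalanobis H⁻¹ x ^ 2))
      + 2 * (1 + R * S) * α * |c| * mahalanobis H' (θs - θ₁) := by
  obtain ⟨hw0, hw1, hw⟩ := confWeight_mem hH hα hg x
  have hlev := mul_weight_leverage_le hH hlam hle hx hα hg (A := 6 * (1 + R * S) * R * L * S)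
    (by positivity) hlam2
  have ha := inner_mem_Icc x h0
  have hb := inner_mem_Icc x h1
  have hz := inner_mem_Icc x hs
  have hsc := fun z hz => (hI z hz).2
  have hB1 := bregman_ge hm hR (h := S * ‖x‖) (S := S) (by nlinarith [norm_nonneg x]) hsc hb hz
  have hB2 := abs_deriv_remainder_le hm hR (fun z hz => (hI z hz).1) hsc ha hb
  have hvar := omd_variational hH (mul_nonneg (div_pos hw0 hg).le (hm.deriv_two_nonneg _))
    (gradient_weightedLoss hm α g H x (r + c) θ₀) (hessian_weightedLoss hm α g H x (r + c) θ₀)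
    hmin h1 hs
  have hcs1 := dotProduct_sq_le hH x.ofLp (θ₁ - θ₀).ofLp
  have hcs2 := dotProduct_sq_le hH x.ofLp (θs - θ₁).ofLp
  rw [← inner_eq_dotProduct, ← mahalanobis_sq hH.inv.posSemidef] at hcs1 hcs2
  have hκ0 : 0 ≤ confWeight α g H x / g * deriv (deriv m) (inner ℝ x θ₁) :=
    mul_nonneg (div_pos hw0 hg).le (hm.deriv_two_nonneg _)
  have hH'p : H'.PosDef := hH' ▸ hH.add_posSemidef (posSemidef_smul_vecMulVec hκ0 _)
  have hX1 : mahalanobis H' (θs - θ₁) ^ 2 = (θs - θ₁).ofLp ⬝ᵥ (H *ᵥ (θs - θ₁).ofLp)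
      + confWeight α g H x / g * deriv (deriv m) (inner ℝ x θ₁) * (inner ℝ x (θs - θ₁)) ^ 2 := by
    rw [mahalanobis_sq hH'p.posSemidef, hH', Matrix.add_mulVec, dotProduct_add,
      dotProduct_vecMulVec_mulVec, inner_eq_dotProduct x (θs - θ₁)]
    ring
  have hX0 : mahalanobis H (θs - θ₀) ^ 2 = (θ₁ - θ₀).ofLp ⬝ᵥ (H *ᵥ (θ₁ - θ₀).ofLp)
      + 2 * ((θ₁ - θ₀).ofLp ⬝ᵥ (H *ᵥ (θs - θ₁).ofLp))
      + (θs - θ₁).ofLp ⬝ᵥ (H *ᵥ (θs - θ₁).ofLp) := by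
    rw [mahalanobis_sq hH.posSemidef, show θs - θ₀ = (θ₁ - θ₀) + (θs - θ₁) by abel]
    rw [WithLp.ofLp_add, Matrix.mulVec_add, add_dotProduct, dotProduct_add, dotProduct_add,
      dotProduct_mulVec_comm hH.isHermitian (θs - θ₁).ofLp (θ₁ - θ₀).ofLp]
    ring
  have hX1nn : 0 ≤ mahalanobis H' (θs - θ₁) := Real.sqrt_nonneg _
  have hσnn : 0 ≤ mahalanobis H⁻¹ x := Real.sqrt_nonneg _
  have hDD : 0 ≤ (θ₁ - θ₀).ofLp ⬝ᵥ (H *ᵥ (θ₁ - θ₀).ofLp) := by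
    simpa using hH.posSemidef.dotProduct_mulVec_nonneg (θ₁ - θ₀).ofLp
  have hbS : |inner ℝ x θs - inner ℝ x θ₁| ≤ 2 * S := by
    have : S * ‖x‖ ≤ S := by nlinarith [norm_nonneg x]
    rw [abs_le]
    exact ⟨by linarith [hz.1, hb.2], by linarith [hz.2, hb.1]⟩
  rw [inner_sub_right, inner_sub_right] at hvar
  rw [inner_sub_right] at hcs1 hcs2 hX1
  set a := inner ℝ x θ₀
  set b := inner ℝ x θ₁
  set z := inner ℝ x θs
  set w := confWeight α g H x
  set σ := mahalanobis H⁻¹ x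
  set η := 1 + R * S with hη
  set X1 := mahalanobis H' (θs - θ₁)
  set DD := (θ₁ - θ₀).ofLp ⬝ᵥ (H *ᵥ (θ₁ - θ₀).ofLp)
  set q1 := (θ₁ - θ₀).ofLp ⬝ᵥ (H *ᵥ (θs - θ₁).ofLp)
  set YY := (θs - θ₁).ofLp ⬝ᵥ (H *ᵥ (θs - θ₁).ofLp)
  have hη0 : 0 < η := by positivity
  have hwg : 0 < w / g := div_pos hw0 hg
  -- the stability term
  set G := (b - a) ^ 2 / σ ^ 2 with hG
  have hG1 : G ≤ DD := by
    rcases hσnn.eq_or_lt with h | h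
    · rw [hG, ← h]; simpa using hDD
    · rw [hG, div_le_iff₀ (by positivity)]; linarith
  have hG2 : 6 * η * R * L * S * (w / g) * (b - a) ^ 2 ≤ G := by
    rcases hσnn.eq_or_lt with h | h
    · rw [← h] at hcs1
      have : (b - a) ^ 2 = 0 := le_antisymm (by linarith) (sq_nonneg _)
      rw [hG, this]; simp
    · rw [hG, le_div_iff₀ (by positivity)]
      have := mul_le_mul_of_nonneg_right hlev (sq_nonneg (b - a))
      linarith
  have hG3 : (b - a) ^ 2 / (3 * η * σ ^ 2) = G / (3 * η) := by
    rw [hG, div_div, mul_comm (σ ^ 2)]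
  -- Linearizing `m'` at `a` instead of `b` costs a third of the stability term `G`; the constant
  -- `36 = 6²` in `λ` is chosen for this. The remaining `2G/3` is `2η · G/(3η)`.
  have hrem : -(2 * η * (w / g) * (deriv m b - deriv m a - deriv (deriv m) a * (b - a)) * (z - b))
      ≤ G / 3 := by
    have h1 : |(deriv m b - deriv m a - deriv (deriv m) a * (b - a)) * (z - b)|
        ≤ R * L * (b - a) ^ 2 / 2 * (2 * S) := by
      rw [abs_mul]
      exact mul_le_mul hB2 hbS (abs_nonneg _) (by positivity)
    have h2 := mul_le_mul_of_nonneg_left (neg_le_of_abs_le h1)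
      (by positivity : 0 ≤ 2 * η * (w / g))
    linarith
  -- Cauchy–Schwarz gives `|z - b| ≤ σ X1`, and the weight satisfies `wσ ≤ αg`, so the leverage
  -- disappears from the corruption term.
  have hc : -(2 * η * (w / g) * c * (z - b)) ≤ 2 * η * α * |c| * X1 := by
    have hYX : |z - b| ≤ σ * X1 := by
      refine abs_le_of_sq_le_sq ?_ (by positivity)
      rw [mul_pow, hX1]
      refine hcs2.trans ?_
      gcongr
      linarith [mul_nonneg hκ0 (sq_nonneg (z - b))]
    have h1 : w / g * |z - b| ≤ α * X1 := by
      calc w / g * |z - b| ≤ w / g * (σ * X1) := by gcongr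
        _ = (w * σ / g) * X1 := by ring
        _ ≤ α * X1 := by
          gcongr
          rw [div_le_iff₀ hg]; exact hw
    have h2 : -(c * (z - b)) ≤ |c| * |z - b| := by
      rw [← abs_mul]; exact neg_le_abs _
    have h3 : -(w / g * (c * (z - b))) ≤ |c| * (α * X1) := by
      calc -(w / g * (c * (z - b))) = w / g * -(c * (z - b)) := by ring
        _ ≤ w / g * (|c| * |z - b|) := by gcongr
        _ = |c| * (w / g * |z - b|) := by ring
        _ ≤ _ := by gcongr
    have := mul_le_mul_of_nonneg_left h3 (by positivity : 0 ≤ 2 * η)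
    linarith
  have hq : q1 / η * (2 * η) = 2 * q1 := by field_simp
  have hvar' := mul_nonneg hvar (by positivity : 0 ≤ 2 * η)
  -- The quadratic part of the Bregman bound, scaled by `2η`, is the rank-one term that turns the
  -- `H`-norm into the `H'`-norm.
  have hbreg : 2 * η * (w / g) * (deriv m b * (z - b)) + w / g * deriv (deriv m) b * (z - b) ^ 2
      ≤ 2 * η * (w / g) * (m z - m b) := by
    have h := mul_le_mul_of_nonneg_left hB1 (by positivity : 0 ≤ 2 * η * (w / g))
    have e : 2 * η * (w / g) * (deriv (deriv m) b * (z - b) ^ 2 / (2 * η))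
        = w / g * deriv (deriv m) b * (z - b) ^ 2 := by field_simp
    linarith
  have e1 : 2 * η * (w * (m z - r * z) / g - w * (m b - r * b) / g - G / (3 * η))
      = 2 * η * (w / g) * (m z - m b) - 2 * η * (w / g) * r * (z - b) - 2 / 3 * G := by
    field_simp
    ring
  rw [hG3, e1, hX1, hX0]
  have e2 : (w / g * (deriv m a - (r + c)) * (z - b) + w / g * deriv (deriv m) a * (b - a) * (z - b)
      + 1 / η * q1) * (2 * η) = 2 * η * (w / g) * (deriv m b * (z - b))
      - 2 * η * (w / g) * (deriv m b - deriv m a - deriv (deriv m) a * (b - a)) * (z - b)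
      - 2 * η * (w / g) * r * (z - b) - 2 * η * (w / g) * c * (z - b) + 2 * q1 := by
    rw [← hq]; ring
  rw [e2] at hvar'
  linarith

end Step

/-! ### Summation along the trajectory -/

section Trajectory

/-- The logarithm of the supermartingale increment of one round, for arm `x`, design matrix `H`,
true natural parameter `z`, predictions `a` and `b` before and after the update, and reward `r`. -/
noncomputable def logIncrement {d : ℕ} (m : ℝ → ℝ) (η α g : ℝ) (H : Matrix (Fin d) (Fin d) ℝ)
    (x : Vec d) (z a r b : ℝ) : ℝ :=
  confWeight α g H x * (m z - r * z) / g - confWeight α g H x * (m b - r * b) / g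
    - (b - a) ^ 2 / (3 * η * mahalanobis H⁻¹ x ^ 2)
    - (3 * η + 1 / 2)
      * Real.log (1 + confWeight α g H x / g * deriv (deriv m) b * mahalanobis H⁻¹ x ^ 2)

variable {d T : ℕ} {m : ℝ → ℝ} {S R L η lam α : ℝ} {γ : ℕ → ℝ} {x : ℕ → Vec d} {r c : ℕ → ℝ}
  {θ : ℕ → Vec d} {H : ℕ → Matrix (Fin d) (Fin d) ℝ}

lemma IsOMDTrajectory.H_succ (h : IsOMDTrajectory T m S η lam α γ x r θ H)
    (hm : RegularLogPartition m) {t : ℕ} (ht : t ∈ Finset.Icc 1 T) :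
    H (t + 1) = H t + (confWeight α (γ t) (H t) (x t) / γ t *
      deriv (deriv m) (inner ℝ (x t) (θ (t + 1)))) • Matrix.vecMulVec (x t).ofLp (x t).ofLp := by
  rw [h.step_H t ht, hessian_weightedLoss hm]

lemma IsOMDTrajectory.θ_mem (h : IsOMDTrajectory T m S η lam α γ x r θ H) {t : ℕ} (ht1 : 1 ≤ t)
    (ht : t ≤ T + 1) : θ t ∈ paramSet d S := by
  rcases ht1.eq_or_lt with rfl | h1
  · exact h.init_mem
  · obtain ⟨s, rfl⟩ : ∃ s, t = s + 1 := ⟨t - 1, by omega⟩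
    exact h.step_mem s (by simp; omega)

/-- The lower bound on `H t` controls the leverages; the upper bound and the log-determinant
identity, a telescoped rank-one determinant formula, feed the potential estimate. -/
lemma IsOMDTrajectory.invariant (h : IsOMDTrajectory T m S η lam α γ x r θ H)
    (hm : RegularLogPartition m) (hγ : ∀ t ∈ Finset.Icc 1 T, 0 < γ t) (hα : 0 < α)
    (hlam : 0 < lam) (hL : 0 ≤ L) (hx : ∀ t ∈ Finset.Icc 1 T, ‖x t‖ ≤ 1)
    (hmL : ∀ t ∈ Finset.Icc 1 T, deriv (deriv m) (inner ℝ (x t) (θ (t + 1))) ≤ L)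
    {t : ℕ} (ht1 : 1 ≤ t) (htT : t ≤ T + 1) :
    (H t).PosDef ∧ (∀ v, lam * (v ⬝ᵥ v) ≤ v ⬝ᵥ (H t *ᵥ v)) ∧
      (∀ v, v ⬝ᵥ (H t *ᵥ v) ≤ (lam + ∑ s ∈ Finset.Ico 1 t, L / γ s) * (v ⬝ᵥ v)) ∧
      Real.log (H t).det = d * Real.log lam + ∑ s ∈ Finset.Ico 1 t,
        Real.log (1 + confWeight α (γ s) (H s) (x s) / γ s *
          deriv (deriv m) (inner ℝ (x s) (θ (s + 1))) * mahalanobis (H s)⁻¹ (x s) ^ 2) := by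
  induction t, ht1 using Nat.le_induction with
  | base =>
    rw [h.init_H]
    refine ⟨Matrix.PosDef.one.smul hlam, fun v => ?_, fun v => ?_, ?_⟩
    · simp [Matrix.smul_mulVec]
    · simp [Matrix.smul_mulVec]
    · simp
  | succ t ht1 ih =>
    have htm : t ∈ Finset.Icc 1 T := Finset.mem_Icc.2 ⟨ht1, by omega⟩
    obtain ⟨i1, i2, i3, i4⟩ := ih (by omega)
    have hg := hγ t htm
    obtain ⟨hw0, hw1, -⟩ := confWeight_mem i1 hα hg (x t)
    have hv := hm.deriv_two_nonneg (inner ℝ (x t) (θ (t + 1)))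
    rw [h.H_succ hm htm]
    set κ := confWeight α (γ t) (H t) (x t) / γ t *
      deriv (deriv m) (inner ℝ (x t) (θ (t + 1))) with hκ
    have hκ0 : 0 ≤ κ := mul_nonneg (div_pos hw0 hg).le hv
    have hκL : κ ≤ L / γ t := by
      rw [hκ, div_mul_eq_mul_div]
      gcongr
      exact (mul_le_of_le_one_left hv hw1).trans (hmL t htm)
    have hquad : ∀ v, v ⬝ᵥ ((H t + κ • Matrix.vecMulVec (x t).ofLp (x t).ofLp) *ᵥ v)
        = v ⬝ᵥ (H t *ᵥ v) + κ * ((x t).ofLp ⬝ᵥ v) ^ 2 := by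
      intro v
      rw [Matrix.add_mulVec, dotProduct_add, dotProduct_vecMulVec_mulVec]
      ring
    refine ⟨i1.add_posSemidef (posSemidef_smul_vecMulVec hκ0 _), fun v => ?_, fun v => ?_, ?_⟩
    · rw [hquad]
      have := mul_nonneg hκ0 (sq_nonneg ((x t).ofLp ⬝ᵥ v))
      linarith [i2 v]
    · rw [hquad, Finset.sum_Ico_succ_top ht1]
      have hcs : ((x t).ofLp ⬝ᵥ v) ^ 2 ≤ v ⬝ᵥ v := by
        have h1 := abs_real_inner_le_norm (x t) (WithLp.toLp 2 v)
        have h2 : (inner ℝ (x t) (WithLp.toLp 2 v)) ^ 2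
            ≤ (‖x t‖ * ‖WithLp.toLp 2 v‖) ^ 2 := by
          rw [← sq_abs]; gcongr
        have h3 : ‖WithLp.toLp 2 v‖ ^ 2 = v ⬝ᵥ v := by
          rw [← real_inner_self_eq_norm_sq, inner_eq_dotProduct]
        rw [inner_eq_dotProduct, mul_pow, h3] at h2
        have h4 : 0 ≤ v ⬝ᵥ v := h3 ▸ sq_nonneg _
        have h5 : ‖x t‖ ^ 2 ≤ 1 := pow_le_one₀ (norm_nonneg _) (hx t htm)
        exact h2.trans (mul_le_of_le_one_left h4 h5)
      have h1 : κ * ((x t).ofLp ⬝ᵥ v) ^ 2 ≤ L / γ t * (v ⬝ᵥ v) :=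
        mul_le_mul hκL hcs (sq_nonneg _) (by positivity)
      have := i3 v
      linarith
    · have hσ : 0 ≤ κ * mahalanobis (H t)⁻¹ (x t) ^ 2 := mul_nonneg hκ0 (sq_nonneg _)
      rw [det_add_smul_vecMulVec i1, ← mahalanobis_sq i1.inv.posSemidef,
        Real.log_mul i1.det_pos.ne' (by positivity), i4, Finset.sum_Ico_succ_top ht1]
      ring

lemma IsOMDTrajectory.sum_log_le (h : IsOMDTrajectory T m S η lam α γ x r θ H)
    (hm : RegularLogPartition m) (hγ : ∀ t ∈ Finset.Icc 1 T, 0 < γ t) (hα : 0 < α)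
    (hlam : 0 < lam) (hL : 0 ≤ L) (hx : ∀ t ∈ Finset.Icc 1 T, ‖x t‖ ≤ 1)
    (hmL : ∀ t ∈ Finset.Icc 1 T, deriv (deriv m) (inner ℝ (x t) (θ (t + 1))) ≤ L)
    {t : ℕ} (ht1 : 1 ≤ t) (htT : t ≤ T + 1) :
    ∑ s ∈ Finset.Ico 1 t, Real.log (1 + confWeight α (γ s) (H s) (x s) / γ s *
          deriv (deriv m) (inner ℝ (x s) (θ (s + 1))) * mahalanobis (H s)⁻¹ (x s) ^ 2)
      ≤ d * Real.log (1 + ∑ s ∈ Finset.Ico 1 t, L / (lam * γ s)) := by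
  obtain ⟨i1, -, i3, i4⟩ := h.invariant hm hγ hα hlam hL hx hmL ht1 htT
  have hsum : 0 ≤ ∑ s ∈ Finset.Ico 1 t, L / γ s := Finset.sum_nonneg fun s hs => by
    have hs' := Finset.mem_Ico.1 hs
    exact div_nonneg hL (hγ s (by simp; omega)).le
  have h1 := Real.log_le_log i1.det_pos (det_le_pow i1.posSemidef i3)
  rw [Real.log_pow, i4] at h1
  have e : 1 + ∑ s ∈ Finset.Ico 1 t, L / (lam * γ s)
      = (lam + ∑ s ∈ Finset.Ico 1 t, L / γ s) / lam := by
    rw [add_div, div_self hlam.ne', Finset.sum_div]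
    congr 1
    refine Finset.sum_congr rfl fun s _ => ?_
    rw [div_div, mul_comm]
  rw [e, Real.log_div (by positivity) hlam.ne', mul_sub]
  linarith

/-- On the event that the accumulated log-increments never exceed `log (1 / δ)`, the comparator
stays in all confidence sets. -/
lemma IsOMDTrajectory.mahalanobis_le (hm : RegularLogPartition m)
    (hγ : ∀ t ∈ Finset.Icc 1 T, 0 < γ t) (hα : 0 < α) (hd : 0 < d) (hL : 0 < L) (hS : 0 < S)
    (hR : 0 ≤ R) {δ : ℝ} (hδ0 : 0 < δ) (hδ1 : δ ≤ 1)
    (h : IsOMDTrajectory T m S (stepSize R S) (regParam d R S L α) α γ x (fun t => r t + c t) θ H)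
    (hx : ∀ t ∈ Finset.Icc 1 T, ‖x t‖ ≤ 1)
    (hI : ∀ t ∈ Finset.Icc 1 T, ∀ z ∈ Set.Icc (-(S * ‖x t‖)) (S * ‖x t‖),
      deriv (deriv m) z ≤ L ∧ |deriv (deriv (deriv m)) z| ≤ R * deriv (deriv m) z)
    {θs : Vec d} (hs : θs ∈ paramSet d S)
    (hgood : ∀ t ∈ Finset.Icc 1 T, ∑ s ∈ Finset.Ico 1 t,
      logIncrement m (stepSize R S) α (γ s) (H s) (x s) (inner ℝ (x s) θs) (inner ℝ (x s) (θ s))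
        (r s) (inner ℝ (x s) (θ (s + 1))) ≤ Real.log (1 / δ))
    {t : ℕ} (ht : t ∈ Finset.Icc 1 T) :
    mahalanobis (H t) (θs - θ t)
      ≤ radius d R S L α δ γ t + 2 * stepSize R S * α * ∑ s ∈ Finset.Icc 1 T, |c s| := by
  set lam := regParam d R S L α with hlamdef
  have hdpos : (0:ℝ) < d := by exact_mod_cast hd
  have hlam : 0 < lam := lt_of_lt_of_le (by positivity)
    ((le_max_right _ _).trans (le_max_right _ _))
  have hlam2 : (6 * (1 + R * S) * R * L * S * α) ^ 2 ≤ lam := by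
    refine le_trans (le_of_eq ?_) ((le_max_left _ _).trans (le_max_right _ _))
    rw [stepSize]; ring
  have hmL : ∀ t ∈ Finset.Icc 1 T, deriv (deriv m) (inner ℝ (x t) (θ (t + 1))) ≤ L := fun t ht =>
    (hI t ht _ (inner_mem_Icc _ (h.step_mem t ht))).1
  have hη : 0 < stepSize R S := by rw [stepSize]; positivity
  set η := stepSize R S with hηdef
  set X : ℕ → ℝ := fun t => mahalanobis (H t) (θs - θ t) with hX
  have hXnn : ∀ t, 0 ≤ X t := fun t => Real.sqrt_nonneg _
  set B : ℕ → ℝ := fun t => 2 * η * Real.log (1 / δ) + d * (6 * η ^ 2 + η)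
      * Real.log (1 + ∑ s ∈ Finset.Ico 1 t, L / (lam * γ s)) + 4 * lam * S ^ 2 with hB
  have hstep : ∀ t ∈ Finset.Icc 1 T, X (t + 1) ^ 2 ≤ X t ^ 2 + 2 * η *
      (logIncrement m η α (γ t) (H t) (x t) (inner ℝ (x t) θs) (inner ℝ (x t) (θ t))
        (r t) (inner ℝ (x t) (θ (t + 1))) + (3 * η + 1 / 2) *
        Real.log (1 + confWeight α (γ t) (H t) (x t) / γ t *
          deriv (deriv m) (inner ℝ (x t) (θ (t + 1))) * mahalanobis (H t)⁻¹ (x t) ^ 2))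
      + 2 * η * α * |c t| * X (t + 1) := by
    intro t ht
    have ht' := Finset.mem_Icc.1 ht
    obtain ⟨i1, i2, -, -⟩ := h.invariant hm hγ hα hlam hL.le hx hmL ht'.1 (by omega)
    have := omd_step hm (hγ t ht) hα hR hL hS i1 hlam hlam2 i2 (hx t ht) (hI t ht)
      (h.θ_mem ht'.1 (by omega)) (h.step_mem t ht) hs (h.step_min t ht) (h.H_succ hm ht)
    refine this.trans (le_of_eq ?_)
    rw [logIncrement, hηdef, stepSize]
    ring
  have hX1 : X 1 ^ 2 ≤ 4 * lam * S ^ 2 := by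
    have hn : ‖θs - θ 1‖ ≤ 2 * S := by
      have h1 := h.init_mem
      rw [paramSet, mem_closedBall_zero_iff] at h1 hs
      linarith [norm_sub_le θs (θ 1)]
    rw [hX]
    simp only
    rw [h.init_H, mahalanobis_sq (Matrix.PosDef.one.smul hlam).posSemidef, Matrix.smul_mulVec,
      Matrix.one_mulVec, dotProduct_smul, ← inner_eq_dotProduct, real_inner_self_eq_norm_sq,
      smul_eq_mul]
    have : ‖θs - θ 1‖ ^ 2 ≤ (2 * S) ^ 2 := by gcongr
    nlinarith
  have hsum : ∀ t, 1 ≤ t → t ≤ T → X t ^ 2 ≤ 4 * lam * S ^ 2 + 2 * η * ∑ s ∈ Finset.Ico 1 t,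
      (logIncrement m η α (γ s) (H s) (x s) (inner ℝ (x s) θs) (inner ℝ (x s) (θ s))
        (r s) (inner ℝ (x s) (θ (s + 1))) + (3 * η + 1 / 2) *
        Real.log (1 + confWeight α (γ s) (H s) (x s) / γ s *
          deriv (deriv m) (inner ℝ (x s) (θ (s + 1))) * mahalanobis (H s)⁻¹ (x s) ^ 2))
      + 2 * η * α * ∑ s ∈ Finset.Ico 1 t, |c s| * X (s + 1) := by
    intro t ht1
    induction t, ht1 using Nat.le_induction with
    | base => intro _; simpa using hX1
    | succ t ht1 ih =>
      intro htT
      have i1 := ih (by omega)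
      have i2 := hstep t (by simp; omega)
      rw [Finset.sum_Ico_succ_top ht1, Finset.sum_Ico_succ_top ht1]
      linarith
  have hbound : ∀ t, 1 ≤ t → t ≤ T →
      X t ^ 2 ≤ B t + 2 * η * α * ∑ s ∈ Finset.Ico 1 t, |c s| * X (s + 1) := by
    intro t ht1 htT
    have h1 := hsum t ht1 htT
    rw [Finset.sum_add_distrib, ← Finset.mul_sum] at h1
    have h2 := hgood t (by simp; omega)
    have h3 := h.sum_log_le hm hγ hα hlam hL.le hx hmL ht1 (by omega)
    have h4 := mul_le_mul_of_nonneg_left h3 (by positivity : 0 ≤ 2 * η * (3 * η + 1 / 2))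
    have h5 := mul_le_mul_of_nonneg_left h2 (by positivity : 0 ≤ 2 * η)
    simp only [hB]
    linarith
  have ht' := Finset.mem_Icc.1 ht
  -- The recursion at `s` involves only `X (u + 1)` with `u + 1 ≤ s`, all at most `X s`, so the
  -- corruption sum is linear in `X s`.
  obtain ⟨s, hsm, hsmax⟩ := Finset.exists_max_image (Finset.Icc 1 t) X ⟨t, by simp; omega⟩
  have hs' := Finset.mem_Icc.1 hsm
  set D := 2 * η * α * ∑ s ∈ Finset.Icc 1 T, |c s| with hD
  have hC : ∑ u ∈ Finset.Ico 1 s, |c u| * X (u + 1) ≤ (∑ u ∈ Finset.Icc 1 T, |c u|) * X s := by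
    rw [Finset.sum_mul]
    calc _ ≤ ∑ u ∈ Finset.Ico 1 s, |c u| * X s := by
          refine Finset.sum_le_sum fun u hu => mul_le_mul_of_nonneg_left
            (hsmax _ ?_) (abs_nonneg _)
          have := Finset.mem_Ico.1 hu
          simp; omega
      _ ≤ _ := by
          refine Finset.sum_le_sum_of_subset_of_nonneg (fun u hu => ?_)
            fun u _ _ => mul_nonneg (abs_nonneg _) (hXnn _)
          have := Finset.mem_Ico.1 hu
          simp; omega
  have hterm : ∀ u ∈ Finset.Ico 1 t, 0 ≤ L / (lam * γ u) := fun u hu => by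
    have hu' := Finset.mem_Ico.1 hu
    have := hγ u (by simp; omega)
    positivity
  have hsums : ∑ u ∈ Finset.Ico 1 s, L / (lam * γ u) ≤ ∑ u ∈ Finset.Ico 1 t, L / (lam * γ u) :=
    Finset.sum_le_sum_of_subset_of_nonneg (Finset.Ico_subset_Ico_right hs'.2)
      fun u hu _ => hterm u hu
  have hsums0 : 0 ≤ ∑ u ∈ Finset.Ico 1 s, L / (lam * γ u) :=
    Finset.sum_nonneg fun u hu => hterm u (Finset.Ico_subset_Ico_right hs'.2 hu)
  have hBmono : B s ≤ B t := by
    simp only [hB]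
    gcongr
  have hBnn : 0 ≤ B t := by
    have h1 : 0 ≤ Real.log (1 / δ) := Real.log_nonneg (by rw [le_div_iff₀ hδ0]; linarith)
    have h2 : 0 ≤ Real.log (1 + ∑ s ∈ Finset.Ico 1 t, L / (lam * γ s)) :=
      Real.log_nonneg (by linarith)
    simp only [hB]
    positivity
  have hDnn : 0 ≤ D := by
    have : 0 ≤ ∑ s ∈ Finset.Icc 1 T, |c s| := Finset.sum_nonneg fun _ _ => abs_nonneg _
    positivity
  have hM : X s ^ 2 ≤ B t + D * X s := by
    have h1 := hbound s hs'.1 (by omega)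
    have h2 := mul_le_mul_of_nonneg_left hC (by positivity : 0 ≤ 2 * η * α)
    rw [hD]
    linarith
  have hfin : X s ≤ √(B t) + D := by
    by_contra hcon
    push Not at hcon
    have h1 := Real.sq_sqrt hBnn
    have h2 := Real.sqrt_nonneg (B t)
    nlinarith
  exact (hsmax t (by simp; omega)).trans hfin

end Trajectory

/-! ### Ville's inequality -/

section Ville

variable {Ω : Type*} {mΩ : MeasurableSpace Ω} {P : Measure Ω}

open Classical in
/-- The partial products `∏_{1 ≤ s < t} F s`, frozen after they first exceed `K`. -/
noncomputable def stoppedProd (F : ℕ → Ω → ENNReal) (K : ENNReal) : ℕ → Ω → ENNReal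
  | 0, _ => 1
  | 1, _ => 1
  | t + 2, ω => if stoppedProd F K (t + 1) ω ≤ K then
      stoppedProd F K (t + 1) ω * F (t + 1) ω else stoppedProd F K (t + 1) ω

/-- The indicator form isolates the coefficient of the new factor, which depends only on the past.
-/
lemma stoppedProd_succ (F : ℕ → Ω → ENNReal) (K : ENNReal) {t : ℕ} (ht : 1 ≤ t) (ω : Ω) :
    stoppedProd F K (t + 1) ω = {ω | stoppedProd F K t ω ≤ K}.indicator (stoppedProd F K t) ω * F t ω
      + {ω | K < stoppedProd F K t ω}.indicator (stoppedProd F K t) ω := by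
  obtain ⟨s, rfl⟩ : ∃ s, t = s + 1 := ⟨t - 1, by omega⟩
  rw [stoppedProd]
  by_cases h : stoppedProd F K (s + 1) ω ≤ K
  · simp [h]
  · simp [h, not_le.1 h]

/-- Either the product has not been frozen or the threshold is already crossed. A crossing at any
time thus shows at time `T`, where Markov's inequality suffices. -/
lemma stoppedProd_eq_or_lt (F : ℕ → Ω → ENNReal) (K : ENNReal) {t : ℕ} (ht : 1 ≤ t) (ω : Ω) :
    stoppedProd F K t ω = ∏ s ∈ Finset.Ico 1 t, F s ω ∨ K < stoppedProd F K t ω := by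
  induction t, ht using Nat.le_induction with
  | base => left; simp [stoppedProd]
  | succ t ht ih =>
    rw [stoppedProd_succ F K ht]
    by_cases h : stoppedProd F K t ω ≤ K
    · left
      rw [Finset.prod_Ico_succ_top ht, ← ih.resolve_right (not_lt.2 h)]
      simp [h]
    · right
      simp [h, not_le.1 h]

lemma lt_stoppedProd_of_le (F : ℕ → Ω → ENNReal) (K : ENNReal) {t T : ℕ} (ht : 1 ≤ t) (hT : t ≤ T)
    {ω : Ω} (h : K < stoppedProd F K t ω) : K < stoppedProd F K T ω := by
  induction T, hT using Nat.le_induction with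
  | base => exact h
  | succ T hT ih =>
    rw [stoppedProd_succ F K (ht.trans hT)]
    simp [not_le.2 ih, ih]

/-- Ville's inequality for products of conditionally sub-normalized factors. -/
lemma measure_exists_prod_gt_le [IsProbabilityMeasure P] {𝓕 : Filtration ℕ mΩ} {T : ℕ}
    {F : ℕ → Ω → ENNReal}
    (hF : ∀ t ∈ Finset.Ico 1 T, Measurable[𝓕 (t + 1)] (F t))
    (hcond : ∀ t ∈ Finset.Ico 1 T, ∀ Z : Ω → ENNReal, Measurable[𝓕 t] Z →
      ∫⁻ ω, Z ω * F t ω ∂P ≤ ∫⁻ ω, Z ω ∂P) {δ : ℝ} (hδ : 0 < δ) :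
    P {ω | ∃ t ∈ Finset.Icc 1 T, ENNReal.ofReal (1 / δ) < ∏ s ∈ Finset.Ico 1 t, F s ω}
      ≤ ENNReal.ofReal δ := by
  set K := ENNReal.ofReal (1 / δ) with hK
  have key : ∀ t, 1 ≤ t → t ≤ T → Measurable[𝓕 t] (stoppedProd F K t) ∧
      ∫⁻ ω, stoppedProd F K t ω ∂P ≤ 1 := by
    intro t ht
    induction t, ht using Nat.le_induction with
    | base =>
      intro _
      have : stoppedProd F K 1 = fun _ => 1 := by ext; simp [stoppedProd]
      rw [this]
      exact ⟨measurable_const, by simp⟩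
    | succ t ht ih =>
      intro htT
      obtain ⟨h1, h2⟩ := ih (by omega)
      have htm : t ∈ Finset.Ico 1 T := by simp; omega
      set A := {ω | stoppedProd F K t ω ≤ K}.indicator (stoppedProd F K t)
      set B := {ω | K < stoppedProd F K t ω}.indicator (stoppedProd F K t)
      have hA : Measurable[𝓕 t] A :=
        h1.indicator (@measurableSet_le _ _ _ _ _ (𝓕 t) _ _ _ _ _ h1 measurable_const)
      have hB : Measurable[𝓕 t] B :=
        h1.indicator (@measurableSet_lt _ _ _ _ _ (𝓕 t) _ _ _ _ _ measurable_const h1)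
      have hmono : 𝓕 t ≤ 𝓕 (t + 1) := 𝓕.mono (Nat.le_succ t)
      have heq : stoppedProd F K (t + 1) = fun ω => A ω * F t ω + B ω := by
        ext ω; exact stoppedProd_succ F K ht ω
      have hAF : Measurable[𝓕 (t + 1)] fun ω => A ω * F t ω :=
        (hA.mono hmono le_rfl).mul (hF t htm)
      rw [heq]
      refine ⟨hAF.add (hB.mono hmono le_rfl), ?_⟩
      rw [lintegral_add_left (hAF.mono (𝓕.le _) le_rfl)]
      calc _ ≤ ∫⁻ ω, A ω ∂P + ∫⁻ ω, B ω ∂P := by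
            exact add_le_add_left (hcond t htm A hA) _
        _ = ∫⁻ ω, stoppedProd F K t ω ∂P := by
            rw [← lintegral_add_left (hA.mono (𝓕.le _) le_rfl)]
            refine lintegral_congr fun ω => ?_
            by_cases h : stoppedProd F K t ω ≤ K
            · simp [A, B, h]
            · simp [A, B, h, not_le.1 h]
        _ ≤ 1 := h2
  rcases Nat.eq_zero_or_pos T with rfl | hT
  · simp
  obtain ⟨h1, h2⟩ := key T hT le_rfl
  have hK0 : K ≠ 0 := by rw [hK]; simpa using hδ
  calc _ ≤ P {ω | K ≤ stoppedProd F K T ω} := by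
        refine measure_mono ?_
        rintro ω ⟨t, ht, h⟩
        have ht' := Finset.mem_Icc.1 ht
        refine (lt_stoppedProd_of_le F K ht'.1 ht'.2 ?_).le
        rcases stoppedProd_eq_or_lt F K ht'.1 ω with h3 | h3
        · rwa [h3]
        · exact h3
    _ ≤ (∫⁻ ω, stoppedProd F K T ω ∂P) / K :=
        meas_ge_le_lintegral_div (h1.mono (𝓕.le _) le_rfl).aemeasurable hK0 ENNReal.ofReal_ne_top
    _ ≤ 1 / K := by gcongr
    _ = ENNReal.ofReal δ := by
        rw [hK, one_div, one_div, ENNReal.ofReal_inv_of_pos hδ, inv_inv]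

end Ville

/-! ### Conditional law of the reward and the tower property -/

section Disintegration

/-- If the conditional law of `r` given `φ` is the kernel `κ`, then integrals of functions of
`(φ, r)` may be computed by first integrating out `r` against `κ`. -/
lemma lintegral_comp_eq_lintegral_kernel {Ω Ω' : Type*} {mΩ : MeasurableSpace Ω}
    {mΩ' : MeasurableSpace Ω'} {P : Measure Ω} [IsProbabilityMeasure P] {φ : Ω → Ω'}
    (hφ : Measurable φ) {r : Ω → ℝ} (hr : Measurable r) {κ : Kernel Ω' ℝ} [IsMarkovKernel κ]
    (h : ∀ A : Set Ω', MeasurableSet A → ∀ B : Set ℝ, MeasurableSet B →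
      P (φ ⁻¹' A ∩ r ⁻¹' B) = ∫⁻ ω in φ ⁻¹' A, κ (φ ω) B ∂P)
    {Ψ : Ω' × ℝ → ENNReal} (hΨ : Measurable Ψ) :
    ∫⁻ ω, Ψ (φ ω, r ω) ∂P = ∫⁻ ω, ∫⁻ y, Ψ (φ ω, y) ∂(κ (φ ω)) ∂P := by
  have hprob : IsProbabilityMeasure (P.map φ) := Measure.isProbabilityMeasure_map hφ.aemeasurable
  have heq : P.map (fun ω => (φ ω, r ω)) = (P.map φ) ⊗ₘ κ := by
    have := Measure.isProbabilityMeasure_map (μ := P) (hφ.prodMk hr).aemeasurable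
    refine Measure.ext_prod fun {A B} hA hB => ?_
    rw [Measure.map_apply (hφ.prodMk hr) (hA.prod hB), Measure.compProd_apply_prod hA hB,
      setLIntegral_map hA (κ.measurable_coe hB) hφ, ← h A hA B hB]
    rfl
  rw [← lintegral_map hΨ (hφ.prodMk hr), heq, Measure.lintegral_compProd hΨ,
    lintegral_map hΨ.lintegral_kernel_prod_right' hφ]

variable {m : ℝ → ℝ} {ν : Measure ℝ} {g : ℝ}

/-- A base measure `ν` need not be s-finite; re-basing at the probability law with parameter `0`
makes measurability in `z` available through product integrals. -/
lemma glmLaw_eq_withDensity (z : ℝ) :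
    glmLaw m ν g z = (glmLaw m ν g 0).withDensity
      fun r => ENNReal.ofReal (Real.exp ((r * z - m z + m 0) / g)) := by
  rw [glmLaw, glmLaw, ← withDensity_mul _ (measurable_glm_density 0) (by fun_prop)]
  congr 1
  ext r
  rw [Pi.mul_apply, ← ENNReal.ofReal_mul (Real.exp_pos _).le, ← Real.exp_add]
  congr 2
  ring

/-- The reward law as a Markov kernel of the natural parameter. -/
noncomputable def glmKernel (hm : Continuous m) (hν : IsLogPartition m ν g) : Kernel ℝ ℝ where
  toFun := glmLaw m ν g
  measurable' := by
    have := hν 0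
    refine Measure.measurable_of_measurable_coe _ fun B hB => ?_
    have e : (fun z => glmLaw m ν g z B) = fun z => ∫⁻ r in B,
        ENNReal.ofReal (Real.exp ((r * z - m z + m 0) / g)) ∂(glmLaw m ν g 0) := by
      ext z
      rw [glmLaw_eq_withDensity z, withDensity_apply _ hB]
    rw [e]
    have hmm := hm.measurable
    have : Measurable (Function.uncurry fun z r : ℝ =>
        ENNReal.ofReal (Real.exp ((r * z - m z + m 0) / g))) := by fun_prop
    exact this.lintegral_prod_right'

instance (hm : Continuous m) (hν : IsLogPartition m ν g) : IsMarkovKernel (glmKernel hm hν) :=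
  ⟨fun z => hν z⟩

/-- The tower property in the form needed for the supermartingale: if the conditional law of `r`
given `𝓖` is `GLM(z)`, and `Φ ω` integrates to at most one against `GLM(z ω)`, then multiplying by
`Φ ω (r ω)` does not increase integrals of `𝓖`-measurable functions. -/
lemma lintegral_mul_comp_le {Ω : Type*} {𝓖 mΩ : MeasurableSpace Ω} {P : Measure Ω}
    [IsProbabilityMeasure P] (h𝓖 : 𝓖 ≤ mΩ) (hm : Continuous m) (hν : IsLogPartition m ν g)
    {z : Ω → ℝ} (hz : Measurable[𝓖] z) {r : Ω → ℝ} (hr : Measurable r)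
    (hlaw : ∀ B : Set ℝ, MeasurableSet B → P[(r ⁻¹' B).indicator (fun _ => (1 : ℝ)) | 𝓖]
      =ᵐ[P] fun ω => (glmLaw m ν g (z ω)).real B)
    {Φ : Ω × ℝ → ENNReal} (hΦ : Measurable[𝓖.prod inferInstance] Φ)
    (hΦ1 : ∀ ω, ∫⁻ y, Φ (ω, y) ∂(glmLaw m ν g (z ω)) ≤ 1)
    {Z : Ω → ENNReal} (hZ : Measurable[𝓖] Z) :
    ∫⁻ ω, Z ω * Φ (ω, r ω) ∂P ≤ ∫⁻ ω, Z ω ∂P := by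
  have hrect : ∀ A : Set Ω, MeasurableSet[𝓖] A → ∀ B : Set ℝ, MeasurableSet B →
      P (A ∩ r ⁻¹' B) = ∫⁻ ω in A, glmLaw m ν g (z ω) B ∂P := by
    intro A hA B hB
    have hint : Integrable ((r ⁻¹' B).indicator fun _ => (1:ℝ)) P :=
      (integrable_const 1).indicator (hr hB)
    have h1 := setIntegral_condExp h𝓖 hint hA
    rw [setIntegral_congr_ae (g := fun ω => (glmLaw m ν g (z ω)).real B) (h𝓖 A hA)
      ((hlaw B hB).mono fun ω h _ => h), setIntegral_indicator (hr hB), setIntegral_const,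
      smul_eq_mul, mul_one] at h1
    have hfin : ∀ ω, glmLaw m ν g (z ω) B ≠ ⊤ := fun ω => by
      have := hν (z ω)
      exact measure_ne_top _ _
    have hmeas : Measurable fun ω => glmLaw m ν g (z ω) B :=
      ((glmKernel hm hν).measurable_coe hB).comp (hz.mono h𝓖 le_rfl)
    have h2 : ∫ ω in A, (glmLaw m ν g (z ω)).real B ∂P
        = (∫⁻ ω in A, glmLaw m ν g (z ω) B ∂P).toReal := by
      rw [← integral_toReal hmeas.aemeasurable (ae_of_all _ fun ω => (hfin ω).lt_top)]
      rfl
    rw [h2, Measure.real] at h1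
    refine ((ENNReal.toReal_eq_toReal_iff' ?_ (measure_ne_top _ _)).1 h1).symm
    refine ne_top_of_le_ne_top (b := P A) (measure_ne_top _ _) ?_
    calc _ ≤ ∫⁻ ω in A, 1 ∂P := lintegral_mono fun ω => by
          have := hν (z ω)
          exact prob_le_one
      _ = P A := by simp
  -- Here `φ` is the identity, viewed as a map from `Ω` with the full σ-algebra to `Ω` with `𝓖`.
  have hker := lintegral_comp_eq_lintegral_kernel (mΩ' := 𝓖) (P := P) (φ := id)
    (measurable_id'' h𝓖) hr (κ := (glmKernel hm hν).comap z hz) hrect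
    (Ψ := fun p => Z p.1 * Φ p) ((hZ.comp measurable_fst).mul hΦ)
  simp only [id] at hker
  rw [hker]
  refine lintegral_mono fun ω => ?_
  change ∫⁻ y, Z ω * Φ (ω, y) ∂(glmLaw m ν g (z ω)) ≤ Z ω
  have hΦω : Measurable fun y => Φ (ω, y) := by
    have : @Measurable _ _ _ (𝓖.prod inferInstance) (fun y : ℝ => (ω, y)) :=
      @measurable_prodMk_left _ _ 𝓖 _ ω
    exact hΦ.comp this
  rw [lintegral_const_mul _ hΦω]
  exact mul_le_of_le_one_right' (hΦ1 ω)

end Disintegration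

/-! ### Measurability of norms and weights -/

section Measurability

variable {Ω : Type*} {mΩ : MeasurableSpace Ω} {d : ℕ}

lemma measurable_det {ι : Type*} [Fintype ι] [DecidableEq ι] {A : Ω → Matrix ι ι ℝ}
    (hA : ∀ i j, Measurable fun ω => A ω i j) : Measurable fun ω => (A ω).det := by
  simp_rw [Matrix.det_apply]
  exact Finset.measurable_sum _ fun σ _ =>
    (Finset.measurable_prod _ fun i _ => hA (σ i) i).const_smul (Equiv.Perm.sign σ)

lemma measurable_inv_apply {ι : Type*} [Fintype ι] [DecidableEq ι] {A : Ω → Matrix ι ι ℝ}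
    (hA : ∀ i j, Measurable fun ω => A ω i j) (i j : ι) : Measurable fun ω => (A ω)⁻¹ i j := by
  simp_rw [Matrix.inv_def, Ring.inverse_eq_inv', Matrix.smul_apply, Matrix.adjugate_apply,
    smul_eq_mul]
  refine (measurable_det hA).inv.mul (measurable_det fun k l => ?_)
  simp_rw [Matrix.updateRow_apply]
  split_ifs
  · exact measurable_const
  · exact hA k l

lemma measurable_mahalanobis {A : Ω → Matrix (Fin d) (Fin d) ℝ} {x : Ω → Vec d}
    (hA : ∀ i j, Measurable fun ω => A ω i j) (hx : Measurable x) :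
    Measurable fun ω => mahalanobis (A ω) (x ω) := by
  have hxi : ∀ i, Measurable fun ω => (x ω).ofLp i := fun i => by fun_prop
  refine Real.continuous_sqrt.measurable.comp ?_
  simp only [dotProduct, Matrix.mulVec]
  exact Finset.measurable_sum _ fun i _ => (hxi i).mul
    (Finset.measurable_sum _ fun j _ => (hA i j).mul (hxi j))

lemma measurable_confWeight {A : Ω → Matrix (Fin d) (Fin d) ℝ} {x : Ω → Vec d} (α g : ℝ)
    (hA : ∀ i j, Measurable fun ω => A ω i j) (hx : Measurable x) :
    Measurable fun ω => confWeight α g (A ω) (x ω) := by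
  have := measurable_mahalanobis (measurable_inv_apply hA) hx
  unfold confWeight
  exact Measurable.ite (hx (measurableSet_singleton 0)) measurable_const
    (measurable_const.min (this.const_div _))

end Measurability

/-! ### Predictability of the design matrix -/

section Design

/-- The design matrix of round `t` is known before the reward of round `t` is drawn. -/
lemma measurable_design {Ω : Type*} {mΩ : MeasurableSpace Ω} {𝓕 : Filtration ℕ mΩ} {d T : ℕ}
    {m : ℝ → ℝ} {S η lam α : ℝ} {γ : ℕ → ℝ} {x θ : ℕ → Ω → Vec d} {r : ℕ → Ω → ℝ}
    {H : ℕ → Ω → Matrix (Fin d) (Fin d) ℝ} (hm : RegularLogPartition m)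
    (hx : ∀ t ∈ Finset.Icc 1 T, Measurable[𝓕 t] (x t))
    (hθ : ∀ t ∈ Finset.Icc 1 T, Measurable[𝓕 t] (θ t))
    (h : ∀ ω, IsOMDTrajectory T m S η lam α γ (fun t => x t ω) (fun t => r t ω)
      (fun t => θ t ω) (fun t => H t ω))
    {t : ℕ} (ht1 : 1 ≤ t) (htT : t ≤ T) (i j : Fin d) : Measurable[𝓕 t] fun ω => H t ω i j := by
  have hv := hm.differentiable₃.continuous.measurable
  induction t, ht1 using Nat.le_induction generalizing i j with
  | base =>
    have : (fun ω => H 1 ω i j) = fun _ => (lam • (1 : Matrix (Fin d) (Fin d) ℝ)) i j := by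
      ext ω; rw [(h ω).init_H]
    rw [this]
    exact measurable_const
  | succ t ht ih =>
    have htm : t ∈ Finset.Icc 1 T := Finset.mem_Icc.2 ⟨ht, by omega⟩
    have hmono : 𝓕 t ≤ 𝓕 (t + 1) := 𝓕.mono (Nat.le_succ t)
    have hH1 : ∀ i j, Measurable[𝓕 (t + 1)] fun ω => H t ω i j := fun i j =>
      (ih (by omega) i j).mono hmono le_rfl
    have hx' : Measurable[𝓕 (t + 1)] (x t) := (hx t htm).mono hmono le_rfl
    have hθ' : Measurable[𝓕 (t + 1)] (θ (t + 1)) := hθ (t + 1) (by simp; omega)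
    have hw := measurable_confWeight α (γ t) hH1 hx'
    have hin := hx'.inner (𝕜 := ℝ) hθ'
    have hxi : ∀ i, Measurable[𝓕 (t + 1)] fun ω => (x t ω).ofLp i := fun i =>
      (by fun_prop : Measurable fun v : Vec d => v.ofLp i).comp hx'
    have heq : (fun ω => H (t + 1) ω i j) = fun ω => H t ω i j +
        confWeight α (γ t) (H t ω) (x t ω) / γ t *
        deriv (deriv m) (inner ℝ (x t ω) (θ (t + 1) ω)) * ((x t ω).ofLp i * (x t ω).ofLp j) := by
      ext ω
      rw [(h ω).H_succ hm htm, Matrix.add_apply, Matrix.smul_apply, Matrix.vecMulVec_apply,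
        smul_eq_mul]
    rw [heq]
    exact (hH1 i j).add (((hw.div_const _).mul (hv.comp hin)).mul ((hxi i).mul (hxi j)))

end Design

/-! ### A measurable version of the one-round supremum -/

section RoundFactor

/-- The projection of `q` to `[-h, h]`. -/
noncomputable def clip (h q : ℝ) : ℝ := max (-h) (min h q)

lemma clip_mem {h : ℝ} (hh : 0 ≤ h) (q : ℝ) : clip h q ∈ Set.Icc (-h) h :=
  ⟨le_max_left _ _, max_le (by linarith) (min_le_left _ _)⟩

lemma clip_eq {h q : ℝ} (hq : q ∈ Set.Icc (-h) h) : clip h q = q := by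
  rw [clip, min_eq_right hq.2, max_eq_right hq.1]

/-- The supremum over the predictions `b ∈ [-h, h]` of the exponential of the log-increment. -/
noncomputable def roundFactor (m : ℝ → ℝ) (η g w σ z a h y : ℝ) : ENNReal :=
  ⨆ q : ℚ, ENNReal.ofReal (Real.exp (w * (m z - y * z) / g - w * (m (clip h q) - y * clip h q) / g
    - (clip h q - a) ^ 2 / (3 * η * σ ^ 2)
    - (3 * η + 1 / 2) * Real.log (1 + w / g * deriv (deriv m) (clip h q) * σ ^ 2)))

variable {m : ℝ → ℝ}

lemma measurable_roundFactor (hm : RegularLogPartition m) {Ω : Type*} {mΩ : MeasurableSpace Ω}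
    (η g : ℝ) {w σ z a h : Ω → ℝ} (hw : Measurable w) (hσ : Measurable σ) (hz : Measurable z)
    (ha : Measurable a) (hh : Measurable h) :
    Measurable fun p : Ω × ℝ =>
      roundFactor m η g (w p.1) (σ p.1) (z p.1) (a p.1) (h p.1) p.2 := by
  have h0 := hm.differentiable₁.continuous.measurable
  have h2 := hm.differentiable₃.continuous.measurable
  unfold roundFactor clip
  refine Measurable.iSup fun q => ?_
  fun_prop

lemma measurable_roundFactor_design (hm : RegularLogPartition m) {Ω : Type*}
    {mΩ : MeasurableSpace Ω} {d : ℕ} (η g α S : ℝ) (θs : Vec d)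
    {A : Ω → Matrix (Fin d) (Fin d) ℝ} {x θ : Ω → Vec d}
    (hA : ∀ i j, Measurable fun ω => A ω i j) (hx : Measurable x) (hθ : Measurable θ) :
    Measurable fun p : Ω × ℝ => roundFactor m η g (confWeight α g (A p.1) (x p.1))
      (mahalanobis (A p.1)⁻¹ (x p.1)) (inner ℝ (x p.1) θs) (inner ℝ (x p.1) (θ p.1))
      (S * ‖x p.1‖) p.2 := by
  have h1 := measurable_confWeight α g hA hx
  have h2 := measurable_mahalanobis (measurable_inv_apply hA) hx
  have h3 : Measurable fun ω => inner ℝ (x ω) θs := hx.inner measurable_const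
  have h4 : Measurable fun ω => inner ℝ (x ω) (θ ω) := hx.inner hθ
  have h5 : Measurable fun ω => S * ‖x ω‖ := hx.norm.const_mul S
  have := measurable_roundFactor hm η g h1 h2 h3 h4 h5
  exact this

/-- The exponent is continuous in `q` and the rationals are dense, so the countable supremum
dominates every `b` in the interval, including predictions chosen after seeing the reward. -/
lemma le_roundFactor (hm : RegularLogPartition m) {η g w σ z a h y b : ℝ} (hw : 0 ≤ w)
    (hg : 0 < g) (hb : b ∈ Set.Icc (-h) h) :
    ENNReal.ofReal (Real.exp (w * (m z - y * z) / g - w * (m b - y * b) / g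
      - (b - a) ^ 2 / (3 * η * σ ^ 2)
      - (3 * η + 1 / 2) * Real.log (1 + w / g * deriv (deriv m) b * σ ^ 2)))
      ≤ roundFactor m η g w σ z a h y := by
  have h0 := hm.differentiable₁.continuous
  have h2 := hm.differentiable₃.continuous
  have hcl : Continuous (clip h) := by unfold clip; fun_prop
  have hpos : ∀ q : ℝ, 1 + w / g * deriv (deriv m) (clip h q) * σ ^ 2 ≠ 0 := fun q => by
    have := hm.deriv_two_nonneg (clip h q)
    positivity
  have key : ∀ q : ℝ, ENNReal.ofReal (Real.exp (w * (m z - y * z) / g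
      - w * (m (clip h q) - y * clip h q) / g - (clip h q - a) ^ 2 / (3 * η * σ ^ 2)
      - (3 * η + 1 / 2) * Real.log (1 + w / g * deriv (deriv m) (clip h q) * σ ^ 2)))
      ≤ roundFactor m η g w σ z a h y := by
    intro q
    refine isClosed_property (p := fun q : ℝ => ENNReal.ofReal (Real.exp (w * (m z - y * z) / g
      - w * (m (clip h q) - y * clip h q) / g - (clip h q - a) ^ 2 / (3 * η * σ ^ 2)
      - (3 * η + 1 / 2) * Real.log (1 + w / g * deriv (deriv m) (clip h q) * σ ^ 2)))
      ≤ roundFactor m η g w σ z a h y) Rat.denseRange_cast (isClosed_le ?_ continuous_const)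
      (fun q => le_iSup (fun q : ℚ => ENNReal.ofReal (Real.exp (w * (m z - y * z) / g
      - w * (m (clip h q) - y * clip h q) / g - (clip h q - a) ^ 2 / (3 * η * σ ^ 2)
      - (3 * η + 1 / 2) * Real.log (1 + w / g * deriv (deriv m) (clip h q) * σ ^ 2)))) q) q
    have hlog : Continuous fun q => Real.log (1 + w / g * deriv (deriv m) (clip h q) * σ ^ 2) :=
      Continuous.log (by fun_prop) hpos
    exact ENNReal.continuous_ofReal.comp (by fun_prop)
  have := key b
  rwa [clip_eq hb] at this

variable {d : ℕ} {ν : Measure ℝ} {g S R L α : ℝ}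

lemma lintegral_roundFactor_le (hm : RegularLogPartition m) (hg : 0 < g)
    (hν : IsLogPartition m ν g) (hS : 0 < S) (hL : 0 < L) (hR : 0 ≤ R) (hα : 0 < α) (hd : 0 < d)
    {H : Matrix (Fin d) (Fin d) ℝ} (hH : H.PosDef)
    (hle : ∀ v, regParam d R S L α * (v ⬝ᵥ v) ≤ v ⬝ᵥ (H *ᵥ v)) {x : Vec d} (hx : ‖x‖ ≤ 1)
    (hI : ∀ z ∈ Set.Icc (-(S * ‖x‖)) (S * ‖x‖),
      deriv (deriv m) z ≤ L ∧ |deriv (deriv (deriv m)) z| ≤ R * deriv (deriv m) z)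
    {θ θs : Vec d} (hθ : θ ∈ paramSet d S) :
    ∫⁻ y, roundFactor m (stepSize R S) g (confWeight α g H x) (mahalanobis H⁻¹ x) (inner ℝ x θs)
      (inner ℝ x θ) (S * ‖x‖) y ∂(glmLaw m ν g (inner ℝ x θs)) ≤ 1 := by
  have hprob := hν (inner ℝ x θs)
  rcases eq_or_ne x 0 with h0 | h0
  -- For a zero arm every prediction is `0`, and the penalty with zero denominator equals `0`, so
  -- the factor is exactly one.
  · have : ∀ y, roundFactor m (stepSize R S) g (confWeight α g H x) (mahalanobis H⁻¹ x)
        (inner ℝ x θs) (inner ℝ x θ) (S * ‖x‖) y = 1 := by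
      intro y
      have hc : ∀ q, clip 0 q = 0 := fun q => by
        have := clip_mem le_rfl q
        simpa using this
      simp [roundFactor, h0, mahalanobis, hc]
    simp_rw [this]
    simp
  · have hdpos : (1:ℝ) ≤ d := by exact_mod_cast hd
    have hη1 : 1 ≤ stepSize R S := by
      rw [stepSize]; linarith [mul_nonneg hR hS.le]
    set lam := regParam d R S L α with hlamdef
    have hlam : 0 < lam := lt_of_lt_of_le (by positivity)
      ((le_max_right _ _).trans (le_max_right _ _))
    have hlam1 : 14 * stepSize R S * R ^ 2 ≤ lam := by
      refine le_trans ?_ (le_max_left _ _)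
      have : 0 ≤ 14 * stepSize R S * R ^ 2 := by positivity
      nlinarith
    have hlam2 : (6 * (1 + R * S) * R * L * S * α) ^ 2 ≤ lam := by
      refine le_trans (le_of_eq ?_) ((le_max_left _ _).trans (le_max_right _ _))
      rw [stepSize]; ring
    have hσ := mahalanobis_inv_pos hH h0
    have hσ1 := mahalanobis_inv_le hH hlam hle hx
    obtain ⟨hw0, hw1, -⟩ := confWeight_mem hH hα hg x
    have hlev := mul_weight_leverage_le hH hlam hle hx hα hg (A := 6 * (1 + R * S) * R * L * S)
      (by positivity) hlam2
    set w := confWeight α g H x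
    set σ := mahalanobis H⁻¹ x
    have ha := inner_mem_Icc x hθ
    -- Here `λ ≥ 14ηR²` enters: `1.5/14 = 3/28`.
    have hRs : R ^ 2 * (1.5 * stepSize R S * (w * σ ^ 2)) ≤ 3 / 28 := by
      have h1 : w * σ ^ 2 ≤ 1 / lam := (mul_le_of_le_one_left (sq_nonneg σ) hw1).trans hσ1
      calc R ^ 2 * (1.5 * stepSize R S * (w * σ ^ 2))
          ≤ R ^ 2 * (1.5 * stepSize R S * (1 / lam)) := by gcongr
        _ = 3 / 28 * (14 * stepSize R S * R ^ 2) / lam := by ring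
        _ ≤ 3 / 28 := by
            rw [div_le_iff₀ hlam]
            linarith
    -- Here `λ ≥ (6ηRLSα)²` enters: `1.5/6 = 1/4`, with `η - 1 = RS`.
    have hτ : (stepSize R S - 1) * (deriv (deriv m) (inner ℝ x θ) / g *
        (1.5 * stepSize R S * (w * σ ^ 2))) ≤ 1 / 4 := by
      have hmL := (hI _ ha).1
      calc _ = R * S * deriv (deriv m) (inner ℝ x θ) * (1.5 * (1 + R * S) * (w / g * σ ^ 2)) := by
            rw [stepSize]; ring
        _ ≤ R * S * L * (1.5 * (1 + R * S) * (w / g * σ ^ 2)) := by gcongr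
        _ ≤ 1 / 4 := by nlinarith
    have := lintegral_iSup_roundFactor_le hm hg hν (inner ℝ x θs) hR hη1 (pow_pos hσ 2) hw0 hw1
      (fun z hz => (hI z hz).2) ha hRs hτ
    refine le_trans (lintegral_mono fun y => ?_) this
    refine iSup_le fun q => ?_
    exact le_iSup₂ (f := fun b (_ : b ∈ Set.Icc (-(S * ‖x‖)) (S * ‖x‖)) =>
      ENNReal.ofReal (Real.exp (w * (m (inner ℝ x θs) - y * inner ℝ x θs) / g
      - w * (m b - y * b) / g - (b - inner ℝ x θ) ^ 2 / (3 * stepSize R S * σ ^ 2)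
      - (3 * stepSize R S + 1 / 2) * Real.log (1 + w / g * deriv (deriv m) b * σ ^ 2))))
      _ (clip_mem (by positivity) q)

end RoundFactor

end HCWGLB

/-! ### The confidence sequence -/

open HCWGLB in
theorem theorem5 {d : ℕ} {Ω : Type*} {mΩ : MeasurableSpace Ω}
    (P : Measure Ω) [IsProbabilityMeasure P] (𝓕 : Filtration ℕ mΩ) (T : ℕ)
    -- the model: log-partition function, dispersion function, base measures, dispersions
    (m : ℝ → ℝ) (g : ℝ → ℝ) (ν : ℝ → Measure ℝ) (τ : ℕ → ℝ)
    (hm : RegularLogPartition m)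
    (hg : ∀ t ∈ Finset.Icc 1 T, 0 < g (τ t))
    (hν : ∀ t ∈ Finset.Icc 1 T, IsLogPartition m (ν (τ t)) (g (τ t)))
    -- the constants
    (S L R α δ : ℝ) (hS : 0 < S) (hL : 0 < L) (hR : 0 ≤ R) (hα : 0 < α)
    (hδ : δ ∈ Set.Ioo (0 : ℝ) 1)
    -- the true parameter and the arm sets
    (θstar : Vec d) (hθstar : θstar ∈ paramSet d S)
    (arms : ℕ → Ω → Set (Vec d))
    (harms : ∀ t ∈ Finset.Icc 1 T, ∀ ω, arms t ω ⊆ Metric.closedBall 0 1)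
    (hself : ∀ t ∈ Finset.Icc 1 T, ∀ ω, SelfConcordantOn m (arms t ω) S L R)
    -- the interaction: arms, true rewards, corruptions
    (x : ℕ → Ω → Vec d) (r c : ℕ → Ω → ℝ)
    (hbandit : IsCorruptedGLB P 𝓕 T m (fun t => ν (τ t)) (fun t => g (τ t)) θstar arms x r c)
    -- the estimator, computed from the corrupted rewards
    (θ : ℕ → Ω → Vec d) (H : ℕ → Ω → Matrix (Fin d) (Fin d) ℝ)
    (hθ : ∀ t ∈ Finset.Icc 1 T, Measurable[𝓕 t] (θ t))
    (homd : ∀ ω, IsOMDTrajectory T m S (stepSize R S) (regParam d R S L α) α (fun t => g (τ t))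
      (fun t => x t ω) (fun t => r t ω + c t ω) (fun t => θ t ω) (fun t => H t ω)) :
    ENNReal.ofReal (1 - δ) ≤
      P {ω | ∀ t ∈ Finset.Icc 1 T,
        θstar ∈ confSet R S L α δ (∑ s ∈ Finset.Icc 1 T, |c s ω|) (fun s => g (τ s)) t
          (θ t ω) (H t ω)} := by
  obtain ⟨hδ0, hδ1⟩ := hδ
  -- In dimension zero `λ` may vanish, but all Mahalanobis norms are zero.
  rcases Nat.eq_zero_or_pos d with rfl | hd
  · have hall : {ω | ∀ t ∈ Finset.Icc 1 T,
        θstar ∈ confSet R S L α δ (∑ s ∈ Finset.Icc 1 T, |c s ω|) (fun s => g (τ s)) t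
          (θ t ω) (H t ω)} = Set.univ := by
      refine Set.eq_univ_of_forall fun ω t _ => ⟨hθstar, ?_⟩
      have h1 : mahalanobis (H t ω) (θstar - θ t ω) = 0 := by simp [mahalanobis]
      have h2 : 0 ≤ ∑ s ∈ Finset.Icc 1 T, |c s ω| := Finset.sum_nonneg fun _ _ => abs_nonneg _
      have h3 : 0 ≤ stepSize R S := by rw [stepSize]; positivity
      rw [h1]
      exact add_nonneg (Real.sqrt_nonneg _) (by positivity)
    rw [hall, measure_univ]
    simpa using hδ0.le
  have hdpos : (0:ℝ) < d := by exact_mod_cast hd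
  have hlam : 0 < regParam d R S L α := lt_of_lt_of_le (by positivity)
    ((le_max_right _ _).trans (le_max_right _ _))
  have hx1 : ∀ ω, ∀ t ∈ Finset.Icc 1 T, ‖x t ω‖ ≤ 1 := fun ω t ht => by
    simpa using harms t ht ω (hbandit.arm_mem t ht ω)
  have hI : ∀ ω, ∀ t ∈ Finset.Icc 1 T, ∀ z ∈ Set.Icc (-(S * ‖x t ω‖)) (S * ‖x t ω‖),
      deriv (deriv m) z ≤ L ∧ |deriv (deriv (deriv m)) z| ≤ R * deriv (deriv m) z :=
    fun ω t ht z hz => (hself t ht ω).of_mem_Icc hS.le (hbandit.arm_mem t ht ω) hz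
  have hmL : ∀ ω, ∀ t ∈ Finset.Icc 1 T,
      deriv (deriv m) (inner ℝ (x t ω) (θ (t + 1) ω)) ≤ L := fun ω t ht =>
    (hI ω t ht _ (inner_mem_Icc _ ((homd ω).step_mem t ht))).1
  have hinv : ∀ ω t, 1 ≤ t → t ≤ T + 1 → (H t ω).PosDef ∧
      ∀ v, regParam d R S L α * (v ⬝ᵥ v) ≤ v ⬝ᵥ (H t ω *ᵥ v) := fun ω t ht1 htT =>
    have h := (homd ω).invariant hm hg hα hlam hL.le (hx1 ω) (hmL ω) ht1 htT
    ⟨h.1, h.2.1⟩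
  have hHm := fun t ht1 htT => measurable_design hm hbandit.arm_measurable hθ homd (t := t) ht1 htT
  -- the supermartingale increments
  let Φ : ℕ → Ω × ℝ → ENNReal := fun t p => roundFactor m (stepSize R S) (g (τ t))
    (confWeight α (g (τ t)) (H t p.1) (x t p.1)) (mahalanobis (H t p.1)⁻¹ (x t p.1))
    (inner ℝ (x t p.1) θstar) (inner ℝ (x t p.1) (θ t p.1)) (S * ‖x t p.1‖) p.2
  have hΦ : ∀ t ∈ Finset.Icc 1 T, Measurable[(𝓕 t).prod inferInstance] (Φ t) := by
    intro t ht
    have ht' := Finset.mem_Icc.1 ht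
    have := measurable_roundFactor_design (mΩ := 𝓕 t) hm (stepSize R S) (g (τ t)) α S θstar
      (hHm t ht'.1 ht'.2) (hbandit.arm_measurable t ht) (hθ t ht)
    exact this
  have hΦ1 : ∀ t ∈ Finset.Icc 1 T, ∀ ω,
      ∫⁻ y, Φ t (ω, y) ∂(glmLaw m (ν (τ t)) (g (τ t)) (inner ℝ (x t ω) θstar)) ≤ 1 := by
    intro t ht ω
    have ht' := Finset.mem_Icc.1 ht
    obtain ⟨h1, h2⟩ := hinv ω t ht'.1 (by omega)
    have h3 : θ t ω ∈ paramSet d S := (homd ω).θ_mem ht'.1 (by omega)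
    have := lintegral_roundFactor_le (θs := θstar) hm (hg t ht) (hν t ht) hS hL hR hα hd h1 h2
      (hx1 ω t ht) (hI ω t ht) h3
    exact this
  -- The set at time `t` involves only the factors of rounds before `t`, so the factor of round `T`
  -- is never needed.
  have hIcc : ∀ t ∈ Finset.Ico 1 T, t ∈ Finset.Icc 1 T := fun t ht =>
    Finset.Ico_subset_Icc_self ht
  have hville := measure_exists_prod_gt_le (P := P) (𝓕 := 𝓕) (T := T)
    (F := fun t ω => Φ t (ω, r t ω))
    (fun t ht => by
      have h1 : Measurable[𝓕 (t + 1), (𝓕 t).prod inferInstance] fun ω => (ω, r t ω) :=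
        Measurable.prodMk (measurable_id'' (𝓕.mono (Nat.le_succ t)))
          (hbandit.reward_measurable t (hIcc t ht))
      exact (hΦ t (hIcc t ht)).comp h1)
    (fun t ht Z hZ => lintegral_mul_comp_le (𝓕.le t) hm.differentiable₁.continuous
      (hν t (hIcc t ht)) ((hbandit.arm_measurable t (hIcc t ht)).inner (𝕜 := ℝ) measurable_const)
      ((hbandit.reward_measurable t (hIcc t ht)).mono (𝓕.le _) le_rfl)
      (hbandit.reward_law t (hIcc t ht)) (hΦ t (hIcc t ht)) (hΦ1 t (hIcc t ht)) hZ) hδ0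
  set E := {ω | ∀ t ∈ Finset.Icc 1 T,
        θstar ∈ confSet R S L α δ (∑ s ∈ Finset.Icc 1 T, |c s ω|) (fun s => g (τ s)) t
          (θ t ω) (H t ω)}
  set bad := {ω | ∃ t ∈ Finset.Icc 1 T,
    ENNReal.ofReal (1 / δ) < ∏ s ∈ Finset.Ico 1 t, Φ s (ω, r s ω)}
  have hcover : Set.univ ⊆ E ∪ bad := by
    intro ω _
    by_cases hbad : ω ∈ bad
    · exact Or.inr hbad
    refine Or.inl fun t ht => ⟨hθstar, ?_⟩
    have hgood : ∀ t ∈ Finset.Icc 1 T,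
        ∏ s ∈ Finset.Ico 1 t, Φ s (ω, r s ω) ≤ ENNReal.ofReal (1 / δ) := by
      intro t ht
      by_contra hcon
      exact hbad ⟨t, ht, not_le.1 hcon⟩
    refine (homd ω).mahalanobis_le hm hg hα hd hL hS hR hδ0 hδ1.le (hx1 ω) (hI ω) hθstar ?_ ht
    intro t ht
    have ht' := Finset.mem_Icc.1 ht
    rw [Real.le_log_iff_exp_le (by positivity), Real.exp_sum,
      ← ENNReal.ofReal_le_ofReal_iff (by positivity),
      ENNReal.ofReal_prod_of_nonneg fun _ _ => (Real.exp_pos _).le]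
    refine le_trans (Finset.prod_le_prod' fun s hs => ?_) (hgood t ht)
    have hs' := Finset.mem_Ico.1 hs
    have hsm : s ∈ Finset.Icc 1 T := by simp; omega
    -- The updated iterate depends on the current reward, yet it stays in `Θ`, so its prediction is
    -- among those covered by the supremum.
    exact le_roundFactor hm (confWeight_mem (hinv ω s hs'.1 (by omega)).1 hα (hg s hsm) _).1.le
      (hg s hsm) (inner_mem_Icc _ ((homd ω).step_mem s hsm))
  have h1 : 1 ≤ P E + ENNReal.ofReal δ := by
    calc (1 : ENNReal) = P Set.univ := measure_univ.symm
      _ ≤ P (E ∪ bad) := measure_mono hcover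
      _ ≤ P E + P bad := measure_union_le _ _
      _ ≤ _ := by gcongr
  rw [ENNReal.ofReal_sub 1 hδ0.le, ENNReal.ofReal_one]
  exact tsub_le_iff_right.2 h1
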